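/- Let $n,l\ge 0$ be integers, let $Z\subset\mathbb{R}^{n+l}\times\mathbb{R}$ be open, with points $(a,u)$ ($a$ the independent variables, $u$ the dependent one), and let $G$ be a real Lie group of dimension $n$ that acts smoothly on $Z$ from the right as a local group of transformations. Suppose that the action is free, at least in the local sense that the isotropy groups are discrete; it is intransitive in the sense that the dimension $n$ of its orbits is smaller than $\dim Z=n+l+1$. Let $e$ be a smooth function on the second-order jets over $Z$, and suppose that $G$ is a symmetry group of the equation $e(a,u,u_i,u_{ij})=0$: either every jet satisfying the equation is the jet of a local solution and $G$ transforms solutions to solutions, or the set $e=0$ is invariant under the prolonged action of $G$. Adapted coordinates are smooth local coordinates $(x,y,u)=(x^1,\dots,x^n,y^1,\dots,y^l,u)$ on an open subset of $Z$ in which $x$ are coordinates of a chart of $G$ and the generators of the action are the left-invariant vector fields $\xi_i=\xi_i^j(x)\partial_{x^j}$ of $G$, so that $y$ and $u$ are invariants. Let $\eta_i=\eta_i^j(x)\partial_{x^j}$ be the right-invariant vector fields on $G$ whose values at the identity are a given basis $e_1,\dots,e_n$ of the Lie algebra. For $u=u(x,y)$ put $u_{(i)}=\eta_iu$, $u_{(ij)}=\tfrac12(\eta_i\eta_j+\eta_j\eta_i)u$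 and $u_{(i)y^\mu}=\partial_{y^\mu}(\eta_iu)$. (1) For every first-order jet over $Z$ there are adapted coordinates around its base point in which all graphs with nearby first-order jets are graphs $u=u(x,y)$, and in which the equation, for all second-order jets over a neighbourhood of the given first-order jet, takes the form $$F(y,u,u_{y^\mu},u_{(i)},u_{y^\mu y^\nu},u_{(ij)},u_{(i)y^\mu})=0$$ with a smooth function $F$ (defined for first-order arguments in some open set and all second-order arguments). (2) Given any adapted coordinates with domain $\{x\in X,\ (y,u)\in W\}$, $X$ nonempty and connected, in which the independent variables $(x,y)$ are functions of the original independent variables $a$ alone, the equation takes this form, with one smooth $F$, for all second-order jets over the domain of the coordinates. In (1) and (2): if $de\neq0$ wherever $e=0$, then $dF\ne0$ wherever $F=0$; and if the equation is linear in the highest derivatives, i.e. $e=\sum_{i,k} A^{ik}(a,u,u_j)u_{ik}+B(a,u,u_j)$, then $F=0$ is the equation $$\sum_{\mu,\nu=1}^{l}a^{\mu\nu}u_{y^\mu y^\nu}+\sum_{i,j=1}^{n}b^{ij}u_{(ij)}+\sum_{\mu=1}^{l}\sum_{i=1}^n c^{\mu i}u_{(i)y^\mu}+d=0,$$ where $a^{\mu\nu},b^{ij},c^{\mu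 i},d$ are smooth functions of $y^\mu,u,u_{y^\mu},u_{(i)}$. (3) Conversely, in any adapted coordinates $y,u,u_{y^\mu},u_{(i)},u_{y^\mu y^\nu},u_{(ij)},u_{(i)y^\mu}$ are differential invariants: for each point of the domain, they are unchanged when a graph $u=u(x,y)$ through the point is transformed by an element of $G$ close enough to the identity. So all choices of $F$, and of $a^{\mu\nu},b^{ij},c^{\mu i},d$, give equations that are invariant under the local action of $G$. -/

import Mathlib

open Set Filter Topology Manifold
open scoped ContDiff

/-! ## Jets of functions and second-order equations -/

/-- The derivative of the function `f` along the vector field `V`. -/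
noncomputable def lieD {E : Type*} [NormedAddCommGroup E] [NormedSpace ℝ E]
    (V : E → E) (f : E → ℝ) : E → ℝ :=
  fun p => fderiv ℝ f p (V p)

/-- The symmetrized second derivatives `½ (V i (V j f) + V j (V i f))` of `f` at `p` along a family
`V` of vector fields, indexed by unordered pairs `{i, j}`. -/
noncomputable def symD {E κ : Type*} [NormedAddCommGroup E] [NormedSpace ℝ E]
    (V : κ → E → E) (f : E → ℝ) (p : E) : Sym2 κ → ℝ :=
  Sym2.lift ⟨fun i j => (lieD (V i) (lieD (V j) f) p + lieD (V j) (lieD (V i) f) p) / 2,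
    fun _ _ => by simp only [add_comm]⟩

/-- The coordinate vector fields `∂/∂aⁱ` on `ℝ^ι`. -/
def coordField {ι : Type*} [DecidableEq ι] (i : ι) : (ι → ℝ) → (ι → ℝ) :=
  fun _ => Pi.single i 1

/-- First-order jets `(a, u, uᵢ)` of functions of the variables `a ∈ ℝ^ι`. -/
abbrev Jet1 (ι : Type*) : Type _ := (ι → ℝ) × ℝ × (ι → ℝ)

/-- Second-order jets `((a, u, uᵢ), u_{ij})`; the second derivatives are indexed by unordered
pairs. -/
abbrev Jet2 (ι : Type*) : Type _ := Jet1 ι × (Sym2 ι → ℝ)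

/-- The first-order jet of `f` at `a`. -/
noncomputable def jet1 {ι : Type*} [Fintype ι] [DecidableEq ι] (f : (ι → ℝ) → ℝ) (a : ι → ℝ) :
    Jet1 ι :=
  (a, f a, fun i => lieD (coordField i) f a)

/-- The second-order jet of `f` at `a`. -/
noncomputable def jet2 {ι : Type*} [Fintype ι] [DecidableEq ι] (f : (ι → ℝ) → ℝ) (a : ι → ℝ) :
    Jet2 ι :=
  (jet1 f a, symD coordField f a)

/-- The space of second-order jets over a set `Z` of points `(a, u)`. -/
def jetsOver {ι : Type*} (Z : Set ((ι → ℝ) × ℝ)) : Set (Jet2 ι) :=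
  {j | (j.1.1, j.1.2.1) ∈ Z}

/-- `f` is smooth on the open set `Ω`, and its graph over `Ω` lies in `Z`. -/
structure IsSmoothGraph {ι : Type*} [Fintype ι] (Z : Set ((ι → ℝ) × ℝ))
    (f : (ι → ℝ) → ℝ) (Ω : Set (ι → ℝ)) : Prop where
  isOpen : IsOpen Ω
  smooth : ContDiffOn ℝ ∞ f Ω
  mem : ∀ a ∈ Ω, (a, f a) ∈ Z

/-- `f` is a solution on `Ω` of the equation `e = 0` over `Z`. -/
structure IsSolution {ι : Type*} [Fintype ι] [DecidableEq ι] (Z : Set ((ι → ℝ) × ℝ))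
    (e : Jet2 ι → ℝ) (f : (ι → ℝ) → ℝ) (Ω : Set (ι → ℝ)) : Prop extends
    IsSmoothGraph Z f Ω where
  eq_zero : ∀ a ∈ Ω, e (jet2 f a) = 0

/-- Every jet over `Z` that satisfies the equation `e = 0` is the jet of a local solution. -/
def LocallySolvable {ι : Type*} [Fintype ι] [DecidableEq ι] (Z : Set ((ι → ℝ) × ℝ))
    (e : Jet2 ι → ℝ) : Prop :=
  ∀ j ∈ jetsOver Z, e j = 0 → ∃ f Ω, IsSolution Z e f Ω ∧ j.1.1 ∈ Ω ∧ jet2 f j.1.1 = j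

/-- The equation `e = 0` is linear in the highest derivatives:
`∑ A^{ij}(a, u, uₖ) u_{ij} + B(a, u, uₖ) = 0`. -/
def IsQuasilinear {ι : Type*} [Fintype ι] (Z : Set ((ι → ℝ) × ℝ)) (e : Jet2 ι → ℝ) : Prop :=
  ∃ (A : Jet1 ι → ι → ι → ℝ) (B : Jet1 ι → ℝ), ∀ j ∈ jetsOver Z,
    e j = ∑ i, ∑ k, A j.1 i k * j.2 s(i, k) + B j.1

/-- The graph of `v` over `Ω'` is contained in the image of the graph of `f` over `Ω` under the
map `T`, which is defined on `D`. -/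
def GraphInImage {ι ι' : Type*} (D : Set ((ι → ℝ) × ℝ)) (T : (ι → ℝ) × ℝ → (ι' → ℝ) × ℝ)
    (f : (ι → ℝ) → ℝ) (Ω : Set (ι → ℝ)) (v : (ι' → ℝ) → ℝ) (Ω' : Set (ι' → ℝ)) : Prop :=
  ∀ b ∈ Ω', ∃ a ∈ Ω, (a, f a) ∈ D ∧ T (a, f a) = (b, v b)

/-- `GraphInImage`, with the point of the first graph over `a` mapped to the point of the second
graph over `b`. -/
structure GraphInImageAt {ι ι' : Type*} (D : Set ((ι → ℝ) × ℝ))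
    (T : (ι → ℝ) × ℝ → (ι' → ℝ) × ℝ) (f : (ι → ℝ) → ℝ) (Ω : Set (ι → ℝ)) (a : ι → ℝ)
    (v : (ι' → ℝ) → ℝ) (Ω' : Set (ι' → ℝ)) (b : ι' → ℝ) : Prop where
  graph : GraphInImage D T f Ω v Ω'
  mem_source : a ∈ Ω
  mem_target : b ∈ Ω'
  mem_dom : (a, f a) ∈ D
  map_eq : T (a, f a) = (b, v b)

/-! ## Local Lie groups of transformations -/

/-- A smooth local action (on the right) of the Lie group `G` on the open set `Z ⊆ E`; `z · g` is
defined for `(z, g)` in the open set `dom`. -/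
structure LocalAction (n : ℕ) (G : Type*) [Group G] [TopologicalSpace G]
    [ChartedSpace (Fin n → ℝ) G] {E : Type*} [NormedAddCommGroup E] [NormedSpace ℝ E]
    (Z : Set E) where
  /-- the domain of definition -/
  dom : Set (E × G)
  /-- the map `(z, g) ↦ z · g` -/
  act : E → G → E
  isOpen_space : IsOpen Z
  isOpen_dom : IsOpen dom
  mem_space : ∀ z g, (z, g) ∈ dom → z ∈ Z
  act_mem : ∀ z g, (z, g) ∈ dom → act z g ∈ Z
  smooth : ContMDiffOn (𝓘(ℝ, E).prod 𝓘(ℝ, Fin n → ℝ)) 𝓘(ℝ, E) ∞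
    (fun p : E × G => act p.1 p.2) dom
  one_mem : ∀ z ∈ Z, (z, (1 : G)) ∈ dom
  act_one : ∀ z ∈ Z, act z 1 = z
  act_mul : ∀ z g h, (z, g) ∈ dom → (act z g, h) ∈ dom → (z, g * h) ∈ dom →
    act (act z g) h = act z (g * h)
  inv_mem : ∀ z g, (z, g) ∈ dom → (act z g, g⁻¹) ∈ dom

namespace LocalAction

variable {n : ℕ} {G : Type*} [Group G] [TopologicalSpace G] [ChartedSpace (Fin n → ℝ) G]

/-- The action is free in the local sense: an element of `G` close to the identity that fixes a
point is the identity (all isotropy groups are discrete, i.e. have zero Lie algebra). -/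
def IsFree {E : Type*} [NormedAddCommGroup E] [NormedSpace ℝ E] {Z : Set E}
    (A : LocalAction n G Z) : Prop :=
  ∀ z ∈ Z, ∀ᶠ g in 𝓝 (1 : G), A.act z g = z → g = 1

/-- The infinitesimal generator of the action that belongs to the element `w` of the Lie
algebra. -/
noncomputable def generator {E : Type*} [NormedAddCommGroup E] [NormedSpace ℝ E] {Z : Set E}
    (A : LocalAction n G Z) (w : GroupLieAlgebra 𝓘(ℝ, Fin n → ℝ) G) (z : E) : E :=
  mfderiv 𝓘(ℝ, Fin n → ℝ) 𝓘(ℝ, E) (fun g => A.act z g) (1 : G) w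

/-- The points that the element `g` can be applied to. -/
def domAt {E : Type*} [NormedAddCommGroup E] [NormedSpace ℝ E] {Z : Set E}
    (A : LocalAction n G Z) (g : G) : Set E :=
  {z | (z, g) ∈ A.dom}

/-- The group transforms solutions of the equation `e = 0` to solutions. -/
def PreservesSolutions {ι : Type*} [Fintype ι] [DecidableEq ι] {Z : Set ((ι → ℝ) × ℝ)}
    (A : LocalAction n G Z) (e : Jet2 ι → ℝ) : Prop :=
  ∀ (g : G) (f : (ι → ℝ) → ℝ) (Ω : Set (ι → ℝ)) (v : (ι → ℝ) → ℝ) (Ω' : Set (ι → ℝ)),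
    IsSolution Z e f Ω → IsSmoothGraph Z v Ω' →
    GraphInImage (A.domAt g) (fun z => A.act z g) f Ω v Ω' → IsSolution Z e v Ω'

/-- The surface `e = 0` in the space of second-order jets is invariant under the prolonged action
of the group (the image of the second-order jet of a graph being the jet of the transformed
graph). -/
def PreservesEquation {ι : Type*} [Fintype ι] [DecidableEq ι] {Z : Set ((ι → ℝ) × ℝ)}
    (A : LocalAction n G Z) (e : Jet2 ι → ℝ) : Prop :=
  ∀ (g : G) (f : (ι → ℝ) → ℝ) (Ω : Set (ι → ℝ)) (a : ι → ℝ)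
    (v : (ι → ℝ) → ℝ) (Ω' : Set (ι → ℝ)) (b : ι → ℝ),
    IsSmoothGraph Z f Ω → IsSmoothGraph Z v Ω' →
    GraphInImageAt (A.domAt g) (fun z => A.act z g) f Ω a v Ω' b →
    e (jet2 f a) = 0 → e (jet2 v b) = 0

end LocalAction

/-! ## Invariant vector fields and adapted coordinates -/

section Invariant

variable {n : ℕ} {G : Type*} [Group G] [TopologicalSpace G] [ChartedSpace (Fin n → ℝ) G]

/-- The right-invariant vector field on `G` with value `w` at the identity. -/
noncomputable def rightInvariantField (w : GroupLieAlgebra 𝓘(ℝ, Fin n → ℝ) G) (g : G) :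
    TangentSpace 𝓘(ℝ, Fin n → ℝ) g :=
  (mfderiv 𝓘(ℝ, Fin n → ℝ) 𝓘(ℝ, Fin n → ℝ) (fun a : G => a * g) (1 : G) w : Fin n → ℝ)

/-- The components `ξʲ(x)` in the chart `κ` of the left-invariant vector field with value `w` at
the identity. -/
noncomputable def leftComp (κ : OpenPartialHomeomorph G (Fin n → ℝ))
    (w : GroupLieAlgebra 𝓘(ℝ, Fin n → ℝ) G) (x : Fin n → ℝ) : Fin n → ℝ :=
  mfderiv 𝓘(ℝ, Fin n → ℝ) 𝓘(ℝ, Fin n → ℝ) κ (κ.symm x) (mulInvariantVectorField w (κ.symm x))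

/-- The components `ηʲ(x)` in the chart `κ` of the right-invariant vector field with value `w` at
the identity. -/
noncomputable def rightComp (κ : OpenPartialHomeomorph G (Fin n → ℝ))
    (w : GroupLieAlgebra 𝓘(ℝ, Fin n → ℝ) G) (x : Fin n → ℝ) : Fin n → ℝ :=
  mfderiv 𝓘(ℝ, Fin n → ℝ) 𝓘(ℝ, Fin n → ℝ) κ (κ.symm x) (rightInvariantField w (κ.symm x))

/-- The part `x = (x¹, …, xⁿ)` of the independent variables `(x, y)`. -/
def xPart {l : ℕ} (p : Fin n ⊕ Fin l → ℝ) : Fin n → ℝ := fun i => p (Sum.inl i)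

/-- The part `y = (y¹, …, yˡ)` of the independent variables `(x, y)`. -/
def yPart {l : ℕ} (p : Fin n ⊕ Fin l → ℝ) : Fin l → ℝ := fun μ => p (Sum.inr μ)

/-- Adapted coordinates `φ : z ↦ ((x, y), u)` for a local action: they are smooth coordinates on an
open part of `Z`, the `x` are coordinates on `G` (in the chart `κ`), and the generators of the
action are the left-invariant fields `ξʲ(x) ∂/∂xʲ`; so `y` and `u` are invariants. -/
structure IsAdaptedChart {l : ℕ} {E : Type*} [NormedAddCommGroup E] [NormedSpace ℝ E]
    {Z : Set E} (A : LocalAction n G Z) (κ : OpenPartialHomeomorph G (Fin n → ℝ))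
    (φ : OpenPartialHomeomorph E ((Fin n ⊕ Fin l → ℝ) × ℝ)) : Prop where
  chart_mem : κ ∈ IsManifold.maximalAtlas 𝓘(ℝ, Fin n → ℝ) ∞ G
  source_subset : φ.source ⊆ Z
  smooth : ContDiffOn ℝ ∞ φ φ.source
  smooth_symm : ContDiffOn ℝ ∞ φ.symm φ.target
  x_mem : ∀ z ∈ φ.source, xPart (φ z).1 ∈ κ.target
  generator_eq : ∀ z ∈ φ.source, ∀ w : GroupLieAlgebra 𝓘(ℝ, Fin n → ℝ) G,
    fderiv ℝ φ z (A.generator w z) = (Sum.elim (leftComp κ w (xPart (φ z).1)) 0, 0)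

/-- The right-invariant vector fields `ηᵢ = ηᵢʲ(x) ∂/∂xʲ` of the basis `β`, on the space of
independent variables `(x, y)`. -/
noncomputable def etaField {l : ℕ} (κ : OpenPartialHomeomorph G (Fin n → ℝ))
    (β : Module.Basis (Fin n) ℝ (GroupLieAlgebra 𝓘(ℝ, Fin n → ℝ) G)) (i : Fin n) :
    (Fin n ⊕ Fin l → ℝ) → (Fin n ⊕ Fin l → ℝ) :=
  fun p => Sum.elim (rightComp κ (β i) (xPart p)) 0

/-- The vector fields `∂/∂y^μ` on the space of independent variables `(x, y)`. -/
def yField {l : ℕ} (μ : Fin l) : (Fin n ⊕ Fin l → ℝ) → (Fin n ⊕ Fin l → ℝ) :=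
  coordField (Sum.inr μ)

end Invariant

/-! ## Differential invariants -/

/-- Values `(y, u, u_{y^μ}, u_(i))` of the invariants of order at most one. -/
abbrev Inv1 (n l : ℕ) : Type := (Fin l → ℝ) × ℝ × (Fin l → ℝ) × (Fin n → ℝ)

/-- Values `((y, u, u_{y^μ}, u_(i)), (u_{y^μ y^ν}, u_(ij), u_(i)y^μ))` of the invariants of order at
most two. -/
abbrev Inv2 (n l : ℕ) : Type :=
  Inv1 n l × (Sym2 (Fin l) → ℝ) × (Sym2 (Fin n) → ℝ) × (Fin n → Fin l → ℝ)

section Differential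

variable {n l : ℕ} {G : Type*} [Group G] [TopologicalSpace G] [ChartedSpace (Fin n → ℝ) G]

/-- The invariants `(y, u, u_{y^μ}, u_(i))` of the function `u = v(x, y)` at a point. -/
noncomputable def inv1 (κ : OpenPartialHomeomorph G (Fin n → ℝ))
    (β : Module.Basis (Fin n) ℝ (GroupLieAlgebra 𝓘(ℝ, Fin n → ℝ) G))
    (v : (Fin n ⊕ Fin l → ℝ) → ℝ) (p : Fin n ⊕ Fin l → ℝ) : Inv1 n l :=
  (yPart p, v p, fun μ => lieD (yField μ) v p, fun i => lieD (etaField κ β i) v p)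

/-- The invariants `(y, u, u_{y^μ}, u_(i); u_{y^μ y^ν}, u_(ij), u_(i)y^μ)` of the function
`u = v(x, y)` at a point. -/
noncomputable def inv2 (κ : OpenPartialHomeomorph G (Fin n → ℝ))
    (β : Module.Basis (Fin n) ℝ (GroupLieAlgebra 𝓘(ℝ, Fin n → ℝ) G))
    (v : (Fin n ⊕ Fin l → ℝ) → ℝ) (p : Fin n ⊕ Fin l → ℝ) : Inv2 n l :=
  (inv1 κ β v p, symD yField v p, symD (etaField κ β) v p,
    fun i μ => lieD (yField μ) (lieD (etaField κ β i) v) p)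

/-- For graphs with first-order jet in `S`, the equation `e = 0` is written as `F = 0` in terms of
the invariants: every smooth graph `u = f(a)` with first-order jet at `a` in `S` is, near the point
over `a`, a graph `u = v(x, y)` in the coordinates `φ`, and its second-order jet satisfies the
equation if and only if `F` vanishes at the values of the invariants. The values of the first-order
invariants lie in `O`. -/
def WrittenInInvariants {ι : Type*} [Fintype ι] [DecidableEq ι] (e : Jet2 ι → ℝ)
    (κ : OpenPartialHomeomorph G (Fin n → ℝ))
    (β : Module.Basis (Fin n) ℝ (GroupLieAlgebra 𝓘(ℝ, Fin n → ℝ) G))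
    (φ : OpenPartialHomeomorph ((ι → ℝ) × ℝ) ((Fin n ⊕ Fin l → ℝ) × ℝ))
    (S : Set (Jet1 ι)) (O : Set (Inv1 n l)) (F : Inv2 n l → ℝ) : Prop :=
  ∀ (f : (ι → ℝ) → ℝ) (Ω : Set (ι → ℝ)) (a : ι → ℝ),
    IsSmoothGraph univ f Ω → a ∈ Ω → jet1 f a ∈ S →
    (∃ v Ω' b, IsSmoothGraph univ v Ω' ∧ GraphInImageAt φ.source φ f Ω a v Ω' b) ∧
    ∀ v Ω' b, IsSmoothGraph univ v Ω' → GraphInImageAt φ.source φ f Ω a v Ω' b →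
      inv1 κ β v b ∈ O ∧ (e (jet2 f a) = 0 ↔ F (inv2 κ β v b) = 0)

/-- The function `F` has, over `O`, the form
`∑ a^{μν} u_{y^μ y^ν} + ∑ b^{ij} u_(ij) + ∑ c^{μi} u_(i)y^μ + d` with coefficients that are smooth
functions of `(y, u, u_{y^μ}, u_(i))`. -/
def HasQuasilinearForm (O : Set (Inv1 n l)) (F : Inv2 n l → ℝ) : Prop :=
  ∃ (a : Fin l → Fin l → Inv1 n l → ℝ) (b : Fin n → Fin n → Inv1 n l → ℝ)
    (c : Fin l → Fin n → Inv1 n l → ℝ) (d : Inv1 n l → ℝ),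
    (∀ μ ν, ContDiffOn ℝ ∞ (a μ ν) O) ∧ (∀ i j, ContDiffOn ℝ ∞ (b i j) O) ∧
    (∀ μ i, ContDiffOn ℝ ∞ (c μ i) O) ∧ ContDiffOn ℝ ∞ d O ∧
    ∀ t ∈ O, ∀ (uyy : Sym2 (Fin l) → ℝ) (uxx : Sym2 (Fin n) → ℝ) (uxy : Fin n → Fin l → ℝ),
      F (t, uyy, uxx, uxy) =
        ∑ μ, ∑ ν, a μ ν t * uyy s(μ, ν) + ∑ i, ∑ j, b i j t * uxx s(i, j) +
          ∑ μ, ∑ i, c μ i t * uxy i μ + d t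

/-- The equation `e = 0` over `Z` is written, for graphs with first-order jet in `S`, in the general
invariant form `F = 0` with `F` smooth (over the open set `O`); `F = 0` is a regular surface if
`e = 0` is one, and `F` has the quasilinear form if `e` is linear in the highest derivatives. -/
def HasInvariantForm {ι : Type*} [Fintype ι] [DecidableEq ι] (Z : Set ((ι → ℝ) × ℝ))
    (e : Jet2 ι → ℝ) (κ : OpenPartialHomeomorph G (Fin n → ℝ))
    (β : Module.Basis (Fin n) ℝ (GroupLieAlgebra 𝓘(ℝ, Fin n → ℝ) G))
    (φ : OpenPartialHomeomorph ((ι → ℝ) × ℝ) ((Fin n ⊕ Fin l → ℝ) × ℝ))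
    (S : Set (Jet1 ι)) (O : Set (Inv1 n l)) : Prop :=
  IsOpen O ∧ ∃ F : Inv2 n l → ℝ,
    ContDiffOn ℝ ∞ F (O ×ˢ univ) ∧
    WrittenInInvariants e κ β φ S O F ∧
    ((∀ j ∈ jetsOver Z, e j = 0 → fderiv ℝ e j ≠ 0) →
      ∀ t, t.1 ∈ O → F t = 0 → fderiv ℝ F t ≠ 0) ∧
    (IsQuasilinear Z e → HasQuasilinearForm O F)

end Differential

/-! Left-invariant fields generate right translations. Since the generators are the left-invariant
fields in `x`, an element `g` near `1` acts in adapted coordinates by `(x, y, u) ↦ (x·g, y, u)`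
(`LocalAction.eventually_chart_act_eq`). The right-invariant fields `ηᵢ` and the fields `∂/∂y` are
mapped to themselves by this motion, so the derivatives of `u` along them do not change
(`frameJet_comp_eq`, `inv2_eq_of_translateX`). This is the converse part.

For the direct part, these fields form a frame, and the passage from coordinate derivatives to
symmetrized frame derivatives is invertible. So `x` and the invariants `t` are together coordinates
on second-order jets, in which the equation reads `E(x, t) = 0` (`LocalAction.invEquation`). Writing
`g(x)` for the group element with coordinates `x`, translation by `g(x)⁻¹ g(x')` carries a jet over
`x` with invariants `t` to one over `x'` with the same `t`. Hence the condition `E(x, t) = 0` is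
locally independent of `x` (`LocalAction.eventually_invEquation_iff`), so it is constant over
connected sets of `x`, and `F = E(x₀, ·)` works for any fixed `x₀`.

Only the zero set of `E`, not `E` itself, is known to be independent of `x`. If `F` and `dF` vanish
at `t`, then `E(·, t)` vanishes near `x₀`, so the whole differential of `E` is zero there, and with
it that of `e`; this gives regularity. Once the first-order jet is fixed, second derivatives
transform affinely, even under changes that mix dependent and independent variables; this gives the
quasilinear form.

Adapted coordinates exist because a free action has linearly independent generators (uniqueness for
ODEs): an affine slice of dimension `l + 1` is moved by the group, and the inverse function theorem
applies. The `u`-axis of the slice is chosen off the tangent plane of the given jet, so that nearby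
graphs remain graphs.

Jets are handled through graphs. Implicit differentiation gives the induced map `jetMap`
(`MapsGerm.jet2_eq`); its inverse is read off by realizing every jet by a polynomial. As the
second-order jet of an image depends only on that of the graph, local solvability reduces the
hypothesis on solutions to invariance of `e = 0`. -/

set_option linter.unusedSectionVars false

/-! ## Second derivatives and implicit functions -/

section Calculus

variable {E F H : Type*} [NormedAddCommGroup E] [NormedSpace ℝ E]
  [NormedAddCommGroup F] [NormedSpace ℝ F] [NormedAddCommGroup H] [NormedSpace ℝ H]

/-- `f` is smooth at all points near `a`. -/
def SmoothNear (f : E → F) (a : E) : Prop := ∀ᶠ x in 𝓝 a, ContDiffAt ℝ ∞ f x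

theorem SmoothNear.contDiffAt {f : E → F} {a : E} (h : SmoothNear f a) : ContDiffAt ℝ ∞ f a :=
  h.self_of_nhds

theorem SmoothNear.differentiableAt {f : E → F} {a : E} (h : SmoothNear f a) :
    DifferentiableAt ℝ f a :=
  h.contDiffAt.differentiableAt (by simp)

theorem SmoothNear.two {f : E → F} {a : E} (h : SmoothNear f a) : ContDiffAt ℝ 2 f a :=
  h.contDiffAt.of_le (WithTop.coe_le_coe.2 (le_top (a := (2 : ℕ∞))))

theorem ContDiffOn.smoothNear {f : E → F} {s : Set E} {a : E} (h : ContDiffOn ℝ ∞ f s)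
    (hs : IsOpen s) (ha : a ∈ s) : SmoothNear f a := by
  filter_upwards [hs.mem_nhds ha] with x hx using h.contDiffAt (hs.mem_nhds hx)

theorem ContDiff.smoothNear {f : E → F} (h : ContDiff ℝ ∞ f) (a : E) : SmoothNear f a :=
  Eventually.of_forall fun _ => h.contDiffAt

theorem SmoothNear.comp {g : F → H} {f : E → F} {a : E} (hg : SmoothNear g (f a))
    (hf : SmoothNear f a) : SmoothNear (g ∘ f) a := by
  filter_upwards [hf, hf.contDiffAt.continuousAt.eventually hg] with x hx hx'
  exact hx'.comp x hx

theorem SmoothNear.congr {f g : E → F} {a : E} (hf : SmoothNear f a) (h : g =ᶠ[𝓝 a] f) :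
    SmoothNear g a := by
  filter_upwards [hf, h.eventually_nhds] with x hx hx'
  exact hx.congr_of_eventuallyEq hx'

theorem SmoothNear.exists_isOpen {f : E → F} {a : E} (h : SmoothNear f a) {U : Set E}
    (hU : U ∈ 𝓝 a) : ∃ s, IsOpen s ∧ a ∈ s ∧ s ⊆ U ∧ ContDiffOn ℝ ∞ f s := by
  obtain ⟨s, hs, hso, has⟩ := eventually_nhds_iff.1 (h.and hU)
  exact ⟨s, hso, has, fun x hx => (hs x hx).2, fun x hx => (hs x hx).1.contDiffWithinAt⟩

theorem eventually_differentiableAt_of_contDiffAt_two {f : E → F} {a : E}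
    (h : ContDiffAt ℝ 2 f a) : ∀ᶠ x in 𝓝 a, DifferentiableAt ℝ f x :=
  (h.eventually (by simp)).mono fun _ hx => hx.differentiableAt (by simp)

theorem differentiableAt_fderiv_of_contDiffAt_two {f : E → F} {a : E}
    (h : ContDiffAt ℝ 2 f a) : DifferentiableAt ℝ (fderiv ℝ f) a :=
  (h.fderiv_right (m := 1) (by norm_num)).differentiableAt (by simp)

theorem fderiv_fderiv_comp {g : F → H} {k : E → F} {p : E} (hg : ContDiffAt ℝ 2 g (k p))
    (hk : ContDiffAt ℝ 2 k p) (X Y : E) :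
    fderiv ℝ (fderiv ℝ (g ∘ k)) p X Y =
      fderiv ℝ (fderiv ℝ g) (k p) (fderiv ℝ k p X) (fderiv ℝ k p Y) +
        fderiv ℝ g (k p) (fderiv ℝ (fderiv ℝ k) p X Y) := by
  have h1 : fderiv ℝ (g ∘ k) =ᶠ[𝓝 p] fun x => (fderiv ℝ g (k x)).comp (fderiv ℝ k x) := by
    filter_upwards [eventually_differentiableAt_of_contDiffAt_two hk,
      hk.continuousAt.eventually (eventually_differentiableAt_of_contDiffAt_two hg)] with x hx hx'
    exact fderiv_comp x hx' hx
  have h2 := ((differentiableAt_fderiv_of_contDiffAt_two hg).hasFDerivAt.comp p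
    (hk.differentiableAt (by simp)).hasFDerivAt).clm_comp
    (differentiableAt_fderiv_of_contDiffAt_two hk).hasFDerivAt
  rw [h1.fderiv_eq]
  refine (congrArg (fun L => L X Y) h2.fderiv).trans ?_
  simp [add_comm]

theorem fderiv_fderiv_symm {f : E → F} {a : E} (h : ContDiffAt ℝ 2 f a) (X Y : E) :
    fderiv ℝ (fderiv ℝ f) a X Y = fderiv ℝ (fderiv ℝ f) a Y X :=
  (h.isSymmSndFDerivAt (by simp)).eq X Y

/-- The first-order term comes from differentiating the field `W`; it is the source of
`frameCorrection`. -/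
theorem lieD_lieD {f : E → ℝ} {V W : E → E} {p : E} (hf : ContDiffAt ℝ 2 f p)
    (hW : DifferentiableAt ℝ W p) :
    lieD V (lieD W f) p =
      fderiv ℝ (fderiv ℝ f) p (V p) (W p) + fderiv ℝ f p (fderiv ℝ W p (V p)) := by
  have h := (differentiableAt_fderiv_of_contDiffAt_two hf).hasFDerivAt.clm_apply hW.hasFDerivAt
  have : lieD V (lieD W f) p = fderiv ℝ (fun x => fderiv ℝ f x (W x)) p (V p) := rfl
  rw [this, h.fderiv]
  simp [add_comm]

theorem symD_mk {κ : Type*} (V : κ → E → E) (f : E → ℝ) (p : E) (i j : κ) :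
    symD V f p s(i, j) = (lieD (V i) (lieD (V j) f) p + lieD (V j) (lieD (V i) f) p) / 2 := rfl

theorem symD_mk_eq {κ : Type*} {V : κ → E → E} {f : E → ℝ} {p : E} (hf : ContDiffAt ℝ 2 f p)
    (hV : ∀ i, DifferentiableAt ℝ (V i) p) (i j : κ) :
    symD V f p s(i, j) = fderiv ℝ (fderiv ℝ f) p (V i p) (V j p) +
      fderiv ℝ f p (fderiv ℝ (V j) p (V i p) + fderiv ℝ (V i) p (V j p)) / 2 := by
  rw [symD_mk, lieD_lieD hf (hV j), lieD_lieD hf (hV i), fderiv_fderiv_symm hf (V j p), map_add]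
  ring

/-- The implicit function theorem for one real dependent variable. -/
theorem exists_implicit_graph [CompleteSpace E] {h : E × ℝ → ℝ} {q : E × ℝ} (hh : SmoothNear h q)
    (h0 : h q = 0) (hu : fderiv ℝ h q (0, 1) ≠ 0) :
    ∃ v : E → ℝ, v q.1 = q.2 ∧ SmoothNear v q.1 ∧ ∀ᶠ z in 𝓝 q, (h z = 0 ↔ z.2 = v z.1) := by
  have hinv : ∀ z, fderiv ℝ h z (0, 1) ≠ 0 →
      (fderiv ℝ h z ∘L .inr ℝ E ℝ).IsInvertible := by
    intro z hz
    refine ⟨ContinuousLinearEquiv.unitsEquivAut ℝ (Units.mk0 _ hz), ?_⟩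
    ext
    simp
  have hn : (∞ : WithTop ℕ∞) ≠ 0 := by simp
  set v := hh.contDiffAt.implicitFunction hn (hinv q hu) with hv
  have hvq : v q.1 = q.2 := hh.contDiffAt.implicitFunction_apply_self hn _
  have hev : ∀ᶠ z in 𝓝 q, (h z = 0 ↔ z.2 = v z.1) := by
    filter_upwards [hh.contDiffAt.eventually_apply_eq_iff_implicitFunction hn (hinv q hu)] with z hz
    rw [← h0, hz, eq_comm]
  have hvs : ContDiffAt ℝ ∞ v q.1 := hh.contDiffAt.contDiffAt_implicitFunction hn _
  refine ⟨v, hvq, ?_, hev⟩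
  -- Smoothness of order `∞` at one point does not spread to a neighbourhood, since the
  -- neighbourhood may shrink with the order. So the implicit function theorem is applied again at
  -- each nearby point of the graph of `v`, and the function it yields there is identified with `v`.
  have hcont : ContinuousAt (fun b => (b, v b)) q.1 :=
    continuousAt_id.prodMk hvs.continuousAt
  have hq : (q.1, v q.1) = q := by rw [hvq]
  have hvc : ∀ᶠ b in 𝓝 q.1, ContinuousAt v b :=
    ((hvs.of_le (m := 1) (by exact_mod_cast le_top)).eventually (by simp)).mono
      fun _ hx => hx.continuousAt
  have hnz : ∀ᶠ z in 𝓝 q, fderiv ℝ h z (0, 1) ≠ 0 := by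
    have : ContinuousAt (fun z => fderiv ℝ h z (0, 1)) q :=
      (hh.contDiffAt.continuousAt_fderiv hn).clm_apply continuousAt_const
    exact this.eventually_ne hu
  have key := (hh.and (hnz.and hev.eventually_nhds))
  rw [← hq] at key
  filter_upwards [hcont.eventually key, hvc] with b hb hbc
  obtain ⟨h1, h2, h3⟩ := hb
  have h4 := h1.eventually_apply_eq_iff_implicitFunction hn (hinv _ h2)
  have hcb : ContinuousAt (fun b => (b, v b)) b := continuousAt_id.prodMk hbc
  refine (h1.contDiffAt_implicitFunction hn (hinv _ h2)).congr_of_eventuallyEq ?_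
  have hb0 : h (b, v b) = 0 := h3.self_of_nhds.2 rfl
  filter_upwards [hcb.eventually (h4.and h3)] with b' hb'
  rw [eq_comm, ← hb'.1, hb0, hb'.2]

end Calculus

/-! ## Transformation of graphs and of their jets -/

section Jets

variable {ι ι' ι'' : Type*} [Fintype ι] [Fintype ι'] [Fintype ι'']

/-- The quadratic form with coefficients `Q`. -/
def quad (Q : Sym2 ι → ℝ) (X Y : ι → ℝ) : ℝ := ∑ i, ∑ k, Q s(i, k) * X i * Y k

theorem quad_comm (Q : Sym2 ι → ℝ) (X Y : ι → ℝ) : quad Q X Y = quad Q Y X := by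
  unfold quad
  rw [Finset.sum_comm]
  refine Finset.sum_congr rfl fun i _ => Finset.sum_congr rfl fun k _ => ?_
  rw [Sym2.eq_swap]
  ring

theorem quad_add (Q R : Sym2 ι → ℝ) (X Y : ι → ℝ) :
    quad (Q + R) X Y = quad Q X Y + quad R X Y := by
  simp [quad, add_mul, Finset.sum_add_distrib]

theorem quad_smul (c : ℝ) (Q : Sym2 ι → ℝ) (X Y : ι → ℝ) :
    quad (c • Q) X Y = c * quad Q X Y := by
  simp [quad, Finset.mul_sum, mul_assoc]

theorem quad_single [DecidableEq ι] (Q : Sym2 ι → ℝ) (i k : ι) :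
    quad Q (Pi.single i 1) (Pi.single k 1) = Q s(i, k) := by
  simp [quad, Pi.single_apply]

theorem bilin_eq_sum [DecidableEq ι] (B : (ι → ℝ) →L[ℝ] (ι → ℝ) →L[ℝ] ℝ) (X Y : ι → ℝ) :
    B X Y = ∑ i, ∑ k, B (Pi.single i 1) (Pi.single k 1) * X i * Y k := by
  have h : ∀ Z : ι → ℝ, Z = ∑ i, Z i • (Pi.single i 1 : ι → ℝ) := fun Z => by
    ext k
    simp [Pi.single_apply]
  conv_lhs => rw [h X, h Y]
  simp only [map_sum, map_smul, _root_.sum_apply, _root_.smul_apply,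
    smul_eq_mul, Finset.mul_sum]
  rw [Finset.sum_comm]
  exact Finset.sum_congr rfl fun i _ => Finset.sum_congr rfl fun k _ => by ring

variable [DecidableEq ι] [DecidableEq ι'] [DecidableEq ι'']

theorem fderiv_eq_dotProduct (f : (ι → ℝ) → ℝ) (a w : ι → ℝ) :
    fderiv ℝ f a w = (jet1 f a).2.2 ⬝ᵥ w := by
  conv_lhs => rw [pi_eq_sum_univ' w]
  simp [dotProduct, jet1, lieD, coordField, map_sum, mul_comm]

theorem symD_coordField {f : (ι → ℝ) → ℝ} {a : ι → ℝ} (hf : ContDiffAt ℝ 2 f a) (i k : ι) :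
    symD coordField f a s(i, k) =
      fderiv ℝ (fderiv ℝ f) a (Pi.single i 1) (Pi.single k 1) := by
  have h : ∀ i : ι, HasFDerivAt (coordField i) (0 : (ι → ℝ) →L[ℝ] (ι → ℝ)) a :=
    fun i => hasFDerivAt_const _ _
  rw [symD_mk_eq hf (fun i => (h i).differentiableAt)]
  simp [(h _).fderiv, coordField]

theorem fderiv_fderiv_eq_quad {f : (ι → ℝ) → ℝ} {a : ι → ℝ} (hf : ContDiffAt ℝ 2 f a)
    (X Y : ι → ℝ) : fderiv ℝ (fderiv ℝ f) a X Y = quad (jet2 f a).2 X Y := by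
  rw [bilin_eq_sum]
  simp only [quad, jet2, symD_coordField hf]

/-- The function whose zero set is the graph of `f`. -/
def graphFn {E : Type*} (f : E → ℝ) (z : E × ℝ) : ℝ := z.2 - f z.1

theorem graphFn_eq_zero {E : Type*} {f : E → ℝ} {z : E × ℝ} : graphFn f z = 0 ↔ z.2 = f z.1 :=
  sub_eq_zero

theorem SmoothNear.graphFn {E : Type*} [NormedAddCommGroup E] [NormedSpace ℝ E]
    {f : E → ℝ} {z : E × ℝ} (hf : SmoothNear f z.1) : SmoothNear (graphFn f) z := by
  filter_upwards [continuousAt_fst.eventually hf] with x hx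
  exact contDiffAt_snd.sub (hx.comp x contDiffAt_fst)

theorem fderiv_graphFn {E : Type*} [NormedAddCommGroup E] [NormedSpace ℝ E]
    {f : E → ℝ} {z : E × ℝ} (hf : DifferentiableAt ℝ f z.1) :
    fderiv ℝ (graphFn f) z =
      ContinuousLinearMap.snd ℝ E ℝ - (fderiv ℝ f z.1).comp (ContinuousLinearMap.fst ℝ E ℝ) :=
  (hasFDerivAt_snd.sub (hf.hasFDerivAt.comp z hasFDerivAt_fst)).fderiv

theorem fderiv_fderiv_graphFn {E : Type*} [NormedAddCommGroup E] [NormedSpace ℝ E]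
    {f : E → ℝ} {z : E × ℝ} (hf : SmoothNear f z.1) (X Y : E × ℝ) :
    fderiv ℝ (fderiv ℝ (graphFn f)) z X Y = -fderiv ℝ (fderiv ℝ f) z.1 X.1 Y.1 := by
  have h1 : fderiv ℝ (graphFn f) =ᶠ[𝓝 z] fun z =>
      ContinuousLinearMap.snd ℝ E ℝ - (fderiv ℝ f z.1).comp (ContinuousLinearMap.fst ℝ E ℝ) := by
    filter_upwards [continuousAt_fst.eventually hf] with x hx
    exact fderiv_graphFn (hx.differentiableAt (by simp))
  have h2 : HasFDerivAt (fun z : E × ℝ => fderiv ℝ f z.1) _ z :=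
    (differentiableAt_fderiv_of_contDiffAt_two hf.two).hasFDerivAt.comp z hasFDerivAt_fst
  have h3 := (hasFDerivAt_const (ContinuousLinearMap.snd ℝ E ℝ) z).sub
    (h2.clm_comp (hasFDerivAt_const (ContinuousLinearMap.fst ℝ E ℝ) z))
  rw [h1.fderiv_eq]
  refine (congrArg (fun L => L X Y) h3.fderiv).trans ?_
  simp

/-- The derivative in the direction `X` at `q` of the function `u - f a`, where `(a, u) = ψ`, if
`p` is the gradient of `f`. -/
noncomputable def graphD (ψ : (ι' → ℝ) × ℝ → (ι → ℝ) × ℝ) (q : (ι' → ℝ) × ℝ) (p : ι → ℝ)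
    (X : (ι' → ℝ) × ℝ) : ℝ :=
  (fderiv ℝ ψ q X).2 - p ⬝ᵥ (fderiv ℝ ψ q X).1

/-- The second derivative in the directions `X`, `Y` at `q` of the function `u - f a`, where
`(a, u) = ψ`, if `p` and `Q` are the first and second derivatives of `f`. -/
noncomputable def graphDD (ψ : (ι' → ℝ) × ℝ → (ι → ℝ) × ℝ) (q : (ι' → ℝ) × ℝ) (p : ι → ℝ)
    (Q : Sym2 ι → ℝ) (X Y : (ι' → ℝ) × ℝ) : ℝ :=
  (fderiv ℝ (fderiv ℝ ψ) q X Y).2 - p ⬝ᵥ (fderiv ℝ (fderiv ℝ ψ) q X Y).1 -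
    quad Q (fderiv ℝ ψ q X).1 (fderiv ℝ ψ q Y).1

theorem graphD_add (ψ : (ι' → ℝ) × ℝ → (ι → ℝ) × ℝ) (q : (ι' → ℝ) × ℝ) (p : ι → ℝ)
    (X Y : (ι' → ℝ) × ℝ) : graphD ψ q p (X + Y) = graphD ψ q p X + graphD ψ q p Y := by
  simp only [graphD, map_add, Prod.snd_add, Prod.fst_add, dotProduct_add]
  ring

theorem graphD_smul (ψ : (ι' → ℝ) × ℝ → (ι → ℝ) × ℝ) (q : (ι' → ℝ) × ℝ) (p : ι → ℝ)
    (c : ℝ) (X : (ι' → ℝ) × ℝ) : graphD ψ q p (c • X) = c * graphD ψ q p X := by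
  simp only [graphD, map_smul, Prod.smul_snd, Prod.smul_fst, dotProduct_smul, smul_eq_mul]
  ring

theorem fderiv_graphFn_comp {f : (ι → ℝ) → ℝ} {ψ : (ι' → ℝ) × ℝ → (ι → ℝ) × ℝ}
    {q : (ι' → ℝ) × ℝ} (hψ : SmoothNear ψ q) (hf : SmoothNear f (ψ q).1) (X : (ι' → ℝ) × ℝ) :
    fderiv ℝ (graphFn f ∘ ψ) q X = graphD ψ q (jet1 f (ψ q).1).2.2 X := by
  rw [fderiv_comp q hf.graphFn.differentiableAt hψ.differentiableAt,
    fderiv_graphFn hf.differentiableAt]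
  simp [graphD, fderiv_eq_dotProduct]

theorem fderiv_fderiv_graphFn_comp {f : (ι → ℝ) → ℝ} {ψ : (ι' → ℝ) × ℝ → (ι → ℝ) × ℝ}
    {q : (ι' → ℝ) × ℝ} (hψ : SmoothNear ψ q) (hf : SmoothNear f (ψ q).1) (X Y : (ι' → ℝ) × ℝ) :
    fderiv ℝ (fderiv ℝ (graphFn f ∘ ψ)) q X Y =
      graphDD ψ q (jet1 f (ψ q).1).2.2 (jet2 f (ψ q).1).2 X Y := by
  rw [fderiv_fderiv_comp hf.graphFn.two hψ.two, fderiv_fderiv_graphFn hf,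
    fderiv_graphFn hf.differentiableAt, fderiv_fderiv_eq_quad hf.two]
  simp only [graphDD, ← fderiv_eq_dotProduct]
  simp
  ring

/-- The map of second-order jets of graphs that is induced by the diffeomorphism `φ`. -/
noncomputable def jetMap (φ : OpenPartialHomeomorph ((ι → ℝ) × ℝ) ((ι' → ℝ) × ℝ)) (j : Jet2 ι) :
    Jet2 ι' :=
  let q := φ (j.1.1, j.1.2.1)
  let D := graphD φ.symm q j.1.2.2
  -- Implicit differentiation: the vector `(eᵢ, vᵢ)` is tangent to the image graph, so `D`
  -- annihilates it. The value is meaningful only if `D (0, 1) ≠ 0`, i.e. for transverse jets.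
  let v : ι' → ℝ := fun i => -D (Pi.single i 1, 0) / D (0, 1)
  let T : ι' → (ι' → ℝ) × ℝ := fun i => (Pi.single i 1, v i)
  -- Differentiating a second time leaves `D (0, 1)` as the coefficient of the second derivative.
  -- Symmetrizing makes the formula descend to unordered pairs without any smoothness of `φ`.
  ((q.1, q.2, v), Sym2.lift ⟨fun i k =>
    -(graphDD φ.symm q j.1.2.2 j.2 (T i) (T k) + graphDD φ.symm q j.1.2.2 j.2 (T k) (T i)) / 2 /
      D (0, 1), fun _ _ => by simp only [add_comm]⟩)

/-- Graphs with the given first-order jet are mapped to graphs by `φ`. -/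
def IsTransverse (φ : OpenPartialHomeomorph ((ι → ℝ) × ℝ) ((ι' → ℝ) × ℝ)) (j : Jet1 ι) : Prop :=
  graphD φ.symm (φ (j.1, j.2.1)) j.2.2 (0, 1) ≠ 0

/-- `φ` is smooth together with its inverse. -/
structure IsDiffeo {E E' : Type*} [NormedAddCommGroup E] [NormedSpace ℝ E] [NormedAddCommGroup E']
    [NormedSpace ℝ E'] (φ : OpenPartialHomeomorph E E') : Prop where
  smooth : ContDiffOn ℝ ∞ φ φ.source
  smooth_symm : ContDiffOn ℝ ∞ φ.symm φ.target

/-- The germ of the graph of `f` at the point over `a` is mapped by `φ` onto the germ of the graph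
of `v` at the point over `b`. -/
structure MapsGerm {E E' : Type*} [TopologicalSpace E] [TopologicalSpace E']
    (φ : OpenPartialHomeomorph (E × ℝ) (E' × ℝ)) (f : E → ℝ) (a : E) (v : E' → ℝ) (b : E') :
    Prop where
  mem : (a, f a) ∈ φ.source
  map_eq : φ (a, f a) = (b, v b)
  iff : ∀ᶠ z in 𝓝 (a, f a), (z.2 = f z.1 ↔ (φ z).2 = v (φ z).1)

/-! ### Diffeomorphisms and germs of graphs. -/

section Diffeo

variable {E E' E'' : Type*} [NormedAddCommGroup E] [NormedSpace ℝ E] [NormedAddCommGroup E']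
    [NormedSpace ℝ E'] [NormedAddCommGroup E''] [NormedSpace ℝ E'']

theorem IsDiffeo.symm {φ : OpenPartialHomeomorph E E'} (h : IsDiffeo φ) : IsDiffeo φ.symm :=
  ⟨h.smooth_symm, by simpa using h.smooth⟩

theorem IsDiffeo.trans {φ : OpenPartialHomeomorph E E'} {χ : OpenPartialHomeomorph E' E''}
    (h : IsDiffeo φ) (h' : IsDiffeo χ) : IsDiffeo (φ.trans χ) where
  smooth := by
    rw [OpenPartialHomeomorph.coe_trans]
    exact h'.smooth.comp (h.smooth.mono (by simp)) (fun x hx => by simp at hx; exact hx.2)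
  smooth_symm := by
    rw [OpenPartialHomeomorph.coe_trans_symm]
    refine h.smooth_symm.comp (h'.smooth_symm.mono ?_) (fun x hx => ?_)
    · simp
    · simp at hx; exact hx.2

theorem IsDiffeo.smoothNear {φ : OpenPartialHomeomorph E E'} (h : IsDiffeo φ) {z : E}
    (hz : z ∈ φ.source) : SmoothNear φ z := h.smooth.smoothNear φ.open_source hz

theorem IsDiffeo.fderiv_symm_apply {φ : OpenPartialHomeomorph E E'} (h : IsDiffeo φ) {z : E}
    (hz : z ∈ φ.source) (X : E) : fderiv ℝ φ.symm (φ z) (fderiv ℝ φ z X) = X := by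
  have h1 := (h.symm.smoothNear (z := φ z) (φ.map_source hz)).differentiableAt
  have h2 := fderiv_comp z h1 (h.smoothNear hz).differentiableAt
  have h3 : φ.symm ∘ φ =ᶠ[𝓝 z] id := φ.eventually_left_inverse hz
  rw [h3.fderiv_eq, fderiv_id] at h2
  simpa using (congrArg (fun L => L X) h2).symm

theorem IsDiffeo.fderiv_apply_symm {φ : OpenPartialHomeomorph E E'} (h : IsDiffeo φ) {z : E}
    (hz : z ∈ φ.source) (X : E') : fderiv ℝ φ z (fderiv ℝ φ.symm (φ z) X) = X := by
  have := h.symm.fderiv_symm_apply (z := φ z) (φ.map_source hz) X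
  simpa [φ.left_inv hz] using this

theorem MapsGerm.symm {φ : OpenPartialHomeomorph (E × ℝ) (E' × ℝ)} {f : E → ℝ} {a : E}
    {v : E' → ℝ} {b : E'} (h : MapsGerm φ f a v b) : MapsGerm φ.symm v b f a := by
  have hb : (b, v b) ∈ φ.target := h.map_eq ▸ φ.map_source h.mem
  have hs : φ.symm (b, v b) = (a, f a) := by rw [← h.map_eq, φ.left_inv h.mem]
  refine ⟨hb, hs, ?_⟩
  have h1 : ContinuousAt φ.symm (b, v b) := φ.symm.continuousAt hb
  have h2 := h.iff
  rw [← hs] at h2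
  filter_upwards [h1.eventually h2, φ.open_target.mem_nhds hb] with z hz hzt
  rw [φ.right_inv hzt] at hz
  exact hz.symm

end Diffeo

/-- The way back from germs to graphs over open sets, as they occur in the hypotheses on `e`:
continuity of `φ.symm` along the graph of `v` provides the domain. -/
theorem MapsGerm.graphInImageAt {φ : OpenPartialHomeomorph ((ι → ℝ) × ℝ) ((ι' → ℝ) × ℝ)}
    {f : (ι → ℝ) → ℝ} {a : ι → ℝ} {v : (ι' → ℝ) → ℝ} {b : ι' → ℝ} (h : MapsGerm φ f a v b)
    {Ω : Set (ι → ℝ)} (hΩ : Ω ∈ 𝓝 a) (hv : SmoothNear v b) {Z : Set ((ι' → ℝ) × ℝ)}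
    (hZ : Z ∈ 𝓝 (b, v b)) :
    ∃ Ω', IsSmoothGraph Z v Ω' ∧ GraphInImageAt φ.source φ f Ω a v Ω' b := by
  have hs := h.symm
  have hc : ContinuousAt (fun b => (b, v b)) b :=
    continuousAt_id.prodMk hv.contDiffAt.continuousAt
  have h1 : ContinuousAt (fun b => φ.symm (b, v b)) b :=
    ContinuousAt.comp (f := fun b => (b, v b)) (φ.symm.continuousAt hs.mem) hc
  have h2 : ∀ᶠ b' in 𝓝 b, (φ.symm (b', v b')).1 ∈ Ω := by
    have : ContinuousAt (fun b => (φ.symm (b, v b)).1) b := h1.fst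
    refine this.eventually ?_
    change Ω ∈ 𝓝 (φ.symm (b, v b)).1
    rw [hs.map_eq]
    exact hΩ
  have hall := (h2.and (hc.eventually hs.iff)).and
    (hc.eventually ((φ.open_target.mem_nhds hs.mem)))
  obtain ⟨Ω', ho, hb, hsub, hsm⟩ := hv.exists_isOpen (hall.and (hc.eventually hZ))
  refine ⟨Ω', ⟨ho, hsm, fun x hx => (hsub hx).2⟩, ⟨?_, mem_of_mem_nhds hΩ, hb, h.mem, h.map_eq⟩⟩
  intro b' hb'
  obtain ⟨⟨⟨ha, hi⟩, ht⟩, -⟩ := hsub hb'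
  have he : f (φ.symm (b', v b')).1 = (φ.symm (b', v b')).2 := (hi.1 rfl).symm
  have hp : ((φ.symm (b', v b')).1, f (φ.symm (b', v b')).1) = φ.symm (b', v b') :=
    Prod.ext rfl he
  refine ⟨(φ.symm (b', v b')).1, ha, ?_, ?_⟩
  · rw [hp]; exact φ.map_target ht
  · rw [hp]; exact φ.right_inv ht


variable {φ : OpenPartialHomeomorph ((ι → ℝ) × ℝ) ((ι' → ℝ) × ℝ)} {f : (ι → ℝ) → ℝ} {a : ι → ℝ}
  {v : (ι' → ℝ) → ℝ} {b : ι' → ℝ}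

theorem isTransverse_jet1 {f : (ι → ℝ) → ℝ} {a : ι → ℝ} :
    IsTransverse φ (jet1 f a) ↔ graphD φ.symm (φ (a, f a)) (jet1 f a).2.2 (0, 1) ≠ 0 := Iff.rfl

theorem graphFn_comp_smoothNear (hφ : IsDiffeo φ) (hf : SmoothNear f a)
    (hs : (a, f a) ∈ φ.source) : SmoothNear (graphFn f ∘ φ.symm) (φ (a, f a)) := by
  refine SmoothNear.comp ?_ (hφ.symm.smoothNear (φ.map_source hs))
  rw [φ.left_inv hs]
  exact hf.graphFn

theorem fderiv_graphFn_comp_symm (hφ : IsDiffeo φ) (hf : SmoothNear f a)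
    (hs : (a, f a) ∈ φ.source) (X : (ι' → ℝ) × ℝ) :
    fderiv ℝ (graphFn f ∘ φ.symm) (φ (a, f a)) X =
      graphD φ.symm (φ (a, f a)) (jet1 f a).2.2 X := by
  have h := φ.left_inv hs
  rw [fderiv_graphFn_comp (hφ.symm.smoothNear (φ.map_source hs)) (by rwa [h]), h]

theorem fderiv_fderiv_graphFn_comp_symm (hφ : IsDiffeo φ) (hf : SmoothNear f a)
    (hs : (a, f a) ∈ φ.source) (X Y : (ι' → ℝ) × ℝ) :
    fderiv ℝ (fderiv ℝ (graphFn f ∘ φ.symm)) (φ (a, f a)) X Y =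
      graphDD φ.symm (φ (a, f a)) (jet1 f a).2.2 (jet2 f a).2 X Y := by
  have h := φ.left_inv hs
  rw [fderiv_fderiv_graphFn_comp (hφ.symm.smoothNear (φ.map_source hs)) (by rwa [h]), h]

/-- Two germs of graphs with `φ (graph f) ⊇ graph v` satisfy the first- and second-order chain
rules, and the first is transverse. -/
theorem derivatives_of_graphFn_eq_zero (hφ : IsDiffeo φ) (hf : SmoothNear f a)
    (hv : SmoothNear v b) (hs : (a, f a) ∈ φ.source) (he : φ (a, f a) = (b, v b))
    (h0 : ∀ᶠ b' in 𝓝 b, graphFn f (φ.symm (b', v b')) = 0) :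
    IsTransverse φ (jet1 f a) ∧
    (∀ X, graphD φ.symm (φ (a, f a)) (jet1 f a).2.2 (X, fderiv ℝ v b X) = 0) ∧
    ∀ X Y, graphDD φ.symm (φ (a, f a)) (jet1 f a).2.2 (jet2 f a).2 (X, fderiv ℝ v b X)
      (Y, fderiv ℝ v b Y) + fderiv ℝ (fderiv ℝ v) b X Y *
        graphD φ.symm (φ (a, f a)) (jet1 f a).2.2 (0, 1) = 0 := by
  set k : (ι' → ℝ) → (ι' → ℝ) × ℝ := fun b' => (b', v b') with hk
  have hkb : k b = φ (a, f a) := he.symm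
  have hsm := graphFn_comp_smoothNear hφ hf hs
  have hks : SmoothNear k b := by
    filter_upwards [hv] with x hx using contDiffAt_id.prodMk hx
  have hkd : ∀ᶠ x in 𝓝 b,
      fderiv ℝ k x = (ContinuousLinearMap.id ℝ (ι' → ℝ)).prod (fderiv ℝ v x) := by
    filter_upwards [hv] with x hx
    exact ((hasFDerivAt_id x).prodMk (hx.differentiableAt (by simp)).hasFDerivAt).fderiv
  have hkdd : ∀ X Y, fderiv ℝ (fderiv ℝ k) b X Y = (0, fderiv ℝ (fderiv ℝ v) b X Y) := by
    intro X Y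
    have e1 := differentiableAt_fderiv_of_contDiffAt_two hks.two
    have h1 : ∀ᶠ x in 𝓝 b, (fderiv ℝ k x Y).1 = Y := hkd.mono fun x hx => by rw [hx]; rfl
    have h2 : ∀ᶠ x in 𝓝 b, (fderiv ℝ k x Y).2 = fderiv ℝ v x Y :=
      hkd.mono fun x hx => by rw [hx]; rfl
    have e2 : HasFDerivAt (fun x => fderiv ℝ k x Y) ((fderiv ℝ (fderiv ℝ k) b).flip Y) b := by
      simpa using e1.hasFDerivAt.clm_apply (hasFDerivAt_const Y b)
    have e3 : HasFDerivAt (fun x => fderiv ℝ v x Y) ((fderiv ℝ (fderiv ℝ v) b).flip Y) b := by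
      simpa using (differentiableAt_fderiv_of_contDiffAt_two hv.two).hasFDerivAt.clm_apply
        (hasFDerivAt_const Y b)
    ext1
    · have := (e2.fst.congr_of_eventuallyEq (EventuallyEq.symm h1)).unique (hasFDerivAt_const Y b)
      simpa using congrArg (fun L => L X) this
    · have := (e2.snd.congr_of_eventuallyEq (EventuallyEq.symm h2)).unique e3
      simpa using congrArg (fun L => L X) this
  have hz : (graphFn f ∘ φ.symm) ∘ k =ᶠ[𝓝 b] fun _ => 0 := h0
  have hkD : ∀ X, fderiv ℝ k b X = (X, fderiv ℝ v b X) := fun X => by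
    rw [hkd.self_of_nhds]; rfl
  have hD : ∀ X, graphD φ.symm (φ (a, f a)) (jet1 f a).2.2 (X, fderiv ℝ v b X) = 0 := by
    intro X
    rw [← fderiv_graphFn_comp_symm hφ hf hs, ← hkD, ← hkb]
    have := fderiv_comp b (hkb ▸ hsm).differentiableAt hks.differentiableAt
    rw [hz.fderiv_eq] at this
    simpa using (congrArg (fun L => L X) this).symm
  refine ⟨?_, hD, ?_⟩
  -- `D` vanishes on the tangent plane of the graph of `v`. If it also vanished on `(0, 1)`, it
  -- would be zero; but on the `φ`-image of the original `u`-direction it equals `1`.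
  · intro hu
    have hX : ∀ X, graphD φ.symm (φ (a, f a)) (jet1 f a).2.2 X = 0 := by
      intro X
      have e : X = (X.1, fderiv ℝ v b X.1) +
          (X.2 - fderiv ℝ v b X.1) • ((0, 1) : (ι' → ℝ) × ℝ) := by
        ext <;> simp
      rw [e, graphD_add, hD, graphD_smul]
      have : graphD φ.symm (φ (a, f a)) (jet1 f a).2.2 (0, 1) = 0 := hu
      rw [this]
      simp
    have := hX (fderiv ℝ φ (a, f a) (0, 1))
    rw [graphD, hφ.fderiv_symm_apply hs] at this
    simp at this
  · intro X Y
    have := fderiv_fderiv_comp (hkb ▸ hsm).two hks.two X Y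
    rw [hz.fderiv.fderiv_eq, hkb, hkD, hkD, hkdd, fderiv_fderiv_graphFn_comp_symm hφ hf hs,
      fderiv_graphFn_comp_symm hφ hf hs] at this
    have e : ((0, fderiv ℝ (fderiv ℝ v) b X Y) : (ι' → ℝ) × ℝ) =
      (fderiv ℝ (fderiv ℝ v) b X Y) • ((0, 1) : (ι' → ℝ) × ℝ) := by simp
    rw [e, graphD_smul] at this
    rw [← this]
    simp

theorem MapsGerm.eventually_graphFn (h : MapsGerm φ f a v b) (hv : ContinuousAt v b) :
    ∀ᶠ b' in 𝓝 b, graphFn f (φ.symm (b', v b')) = 0 := by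
  have hc : ContinuousAt (fun b => (b, v b)) b := continuousAt_id.prodMk hv
  filter_upwards [hc.eventually h.symm.iff] with x hx
  exact graphFn_eq_zero.2 (hx.1 rfl)

theorem MapsGerm.isTransverse (h : MapsGerm φ f a v b) (hφ : IsDiffeo φ) (hf : SmoothNear f a)
    (hv : SmoothNear v b) : IsTransverse φ (jet1 f a) :=
  (derivatives_of_graphFn_eq_zero hφ hf hv h.mem h.map_eq
    (h.eventually_graphFn hv.contDiffAt.continuousAt)).1

/-- The function `(u - f) ∘ φ.symm` vanishes along the graph of `v`. Its first and second
derivatives along that graph are linear equations for the derivatives of `v`, solvable because the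
leading coefficient `D (0, 1)` is nonzero. -/
theorem MapsGerm.jet2_eq (h : MapsGerm φ f a v b) (hφ : IsDiffeo φ) (hf : SmoothNear f a)
    (hv : SmoothNear v b) : jet2 v b = jetMap φ (jet2 f a) := by
  obtain ⟨h1, h2, h3⟩ := derivatives_of_graphFn_eq_zero hφ hf hv h.mem h.map_eq
    (h.eventually_graphFn hv.contDiffAt.continuousAt)
  have hq : φ ((jet2 f a).1.1, (jet2 f a).1.2.1) = φ (a, f a) := rfl
  have hp : (jet2 f a).1.2.2 = (jet1 f a).2.2 := rfl
  rw [isTransverse_jet1] at h1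
  have hvi : ∀ i : ι', fderiv ℝ v b (Pi.single i 1) =
      -graphD φ.symm (φ (a, f a)) (jet1 f a).2.2 (Pi.single i 1, 0) /
        graphD φ.symm (φ (a, f a)) (jet1 f a).2.2 (0, 1) := by
    intro i
    have e : ((Pi.single i 1, fderiv ℝ v b (Pi.single i 1)) : (ι' → ℝ) × ℝ) =
      (Pi.single i 1, 0) + (fderiv ℝ v b (Pi.single i 1)) • ((0, 1) : (ι' → ℝ) × ℝ) := by simp
    have := h2 (Pi.single i 1)
    rw [e, graphD_add, graphD_smul] at this
    field_simp
    linarith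
  refine Prod.ext (Prod.ext ?_ (Prod.ext ?_ ?_)) ?_
  · simp only [jetMap, hq, h.map_eq]; rfl
  · simp only [jetMap, hq, h.map_eq]; rfl
  · funext i
    simp only [jetMap, hq, hp, ← hvi]
    rfl
  · funext s
    induction s using Sym2.ind with | _ i k => ?_
    simp only [jetMap, hq, hp, Sym2.lift_mk, ← hvi]
    have e1 := h3 (Pi.single i 1) (Pi.single k 1)
    have e2 := h3 (Pi.single k 1) (Pi.single i 1)
    rw [fderiv_fderiv_symm hv.two] at e2
    have e3 : (jet2 v b).2 s(i, k) = fderiv ℝ (fderiv ℝ v) b (Pi.single i 1) (Pi.single k 1) :=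
      symD_coordField hv.two i k
    rw [e3]
    field_simp
    linarith

/-- Transversality is exactly the condition of the implicit function theorem for `(u - f) ∘ φ.symm =
0`. -/
theorem exists_mapsGerm (hφ : IsDiffeo φ) (hf : SmoothNear f a) (hs : (a, f a) ∈ φ.source)
    (ht : IsTransverse φ (jet1 f a)) :
    ∃ v, SmoothNear v (φ (a, f a)).1 ∧ MapsGerm φ f a v (φ (a, f a)).1 := by
  obtain ⟨v, hvq, hvs, hv⟩ := exists_implicit_graph (graphFn_comp_smoothNear hφ hf hs)
    (by simp [φ.left_inv hs, graphFn]) (by rwa [fderiv_graphFn_comp_symm hφ hf hs])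
  refine ⟨v, hvs, hs, Prod.ext rfl hvq.symm, ?_⟩
  filter_upwards [(φ.continuousAt hs).eventually hv, φ.open_source.mem_nhds hs] with z hz hzs
  rw [← hz, ← graphFn_eq_zero]
  simp [φ.left_inv hzs]

/-- Containment of the second graph in the image of the first already forces equality of germs: it
implies transversality, so the image is itself the graph of some `v'`, and `v = v'` near `b`. -/
theorem GraphInImageAt.mapsGerm {Ω : Set (ι → ℝ)} {Ω' : Set (ι' → ℝ)}
    (h : GraphInImageAt φ.source φ f Ω a v Ω' b) (hφ : IsDiffeo φ) (hf : SmoothNear f a)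
    (hv : SmoothNear v b) (hΩ' : Ω' ∈ 𝓝 b) : MapsGerm φ f a v b := by
  have hs := h.mem_dom
  have h0 : ∀ᶠ b' in 𝓝 b, graphFn f (φ.symm (b', v b')) = 0 := by
    filter_upwards [hΩ'] with b' hb'
    obtain ⟨a', -, ha', he⟩ := h.graph b' hb'
    rw [← he, φ.left_inv ha']
    exact graphFn_eq_zero.2 rfl
  obtain ⟨v', hv's, hm⟩ := exists_mapsGerm hφ hf hs
    (derivatives_of_graphFn_eq_zero hφ hf hv hs h.map_eq h0).1
  have hb : (φ (a, f a)).1 = b := by rw [h.map_eq]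
  rw [hb] at hv's hm
  have hvv : ∀ᶠ b' in 𝓝 b, v b' = v' b' := by
    have hc : ContinuousAt (fun b => (b, v b)) b :=
      continuousAt_id.prodMk hv.contDiffAt.continuousAt
    have h1 := hm.symm.iff
    have h2 : v' b = v b := by
      have := hm.map_eq.symm.trans h.map_eq
      simpa using this
    rw [h2] at h1
    filter_upwards [h0, hc.eventually h1] with x hx hx'
    exact hx'.2 (graphFn_eq_zero.1 hx)
  refine ⟨hs, h.map_eq, ?_⟩
  have hc : ContinuousAt (fun z => (φ z).1) (a, f a) := (φ.continuousAt hs).fst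
  have h2 : ∀ᶠ z in 𝓝 (a, f a), v (φ z).1 = v' (φ z).1 := by
    refine hc.eventually (p := fun b' => v b' = v' b') ?_
    change ∀ᶠ b' in 𝓝 (φ (a, f a)).1, v b' = v' b'
    rwa [hb]
  filter_upwards [hm.iff, h2] with z hz hz'
  rw [hz, hz']

end Jets

/-! ## Smoothness of the transformation of jets -/

section JetSmooth

variable {ι ι' : Type*} [Fintype ι] [Fintype ι']

/-- The quadratic form with coefficients `Q` as a continuous bilinear form. -/
noncomputable def quadL (Q : Sym2 ι → ℝ) : (ι → ℝ) →L[ℝ] (ι → ℝ) →L[ℝ] ℝ :=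
  ∑ i, ∑ k, Q s(i, k) • (ContinuousLinearMap.proj (R := ℝ) (φ := fun _ : ι => ℝ) i).smulRight
    (ContinuousLinearMap.proj (R := ℝ) (φ := fun _ : ι => ℝ) k)

theorem quadL_apply (Q : Sym2 ι → ℝ) (X Y : ι → ℝ) : quadL Q X Y = quad Q X Y := by
  simp [quadL, quad, mul_assoc]

/-- The linear form with coefficients `p`. -/
noncomputable def dotL (p : ι → ℝ) : (ι → ℝ) →L[ℝ] ℝ :=
  ∑ i, p i • (ContinuousLinearMap.proj (R := ℝ) (φ := fun _ : ι => ℝ) i)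

theorem dotL_apply (p : ι → ℝ) (X : ι → ℝ) : dotL p X = p ⬝ᵥ X := by
  simp [dotL, dotProduct]

variable [DecidableEq ι] [DecidableEq ι']

/-- The quadratic Taylor polynomial. It turns identities between jets into statements about graphs.
-/
theorem exists_jet2_eq (j : Jet2 ι) : ∃ f : (ι → ℝ) → ℝ, ContDiff ℝ ∞ f ∧ jet2 f j.1.1 = j := by
  obtain ⟨⟨a, u, p⟩, Q⟩ := j
  set f : (ι → ℝ) → ℝ := fun x => u + dotL p (x - a) + (1 / 2) * quadL Q (x - a) (x - a) with hf
  have hsm : ContDiff ℝ ∞ f := by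
    have h : ContDiff ℝ ∞ fun x : ι → ℝ => x - a := contDiff_id.sub contDiff_const
    exact (contDiff_const.add ((dotL p).contDiff.comp h)).add
      (contDiff_const.mul (((quadL Q).contDiff.comp h).clm_apply h))
  have h1 : fderiv ℝ f = fun x => dotL p + quadL Q (x - a) := by
    funext x
    have h : HasFDerivAt (fun x : ι → ℝ => x - a) (ContinuousLinearMap.id ℝ (ι → ℝ)) x :=
      (hasFDerivAt_id x).sub_const a
    have h2 := ((hasFDerivAt_const u x).add ((dotL p).hasFDerivAt.comp x h)).add
      ((((quadL Q).hasFDerivAt.comp x h).clm_apply h).const_mul (1 / 2 : ℝ))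
    refine (h2.fderiv :).trans ?_
    ext w
    simp [quadL_apply, quad_comm Q w]
    ring
  have h2 : fderiv ℝ (fderiv ℝ f) a = quadL Q := by
    rw [h1]
    have h : HasFDerivAt (fun x : ι → ℝ => x - a) (ContinuousLinearMap.id ℝ (ι → ℝ)) a :=
      (hasFDerivAt_id a).sub_const a
    refine ((((quadL Q).hasFDerivAt.comp a h).const_add (dotL p)).fderiv :).trans ?_
    ext w
    simp
  refine ⟨f, hsm, Prod.ext (Prod.ext rfl (Prod.ext ?_ ?_)) ?_⟩
  · simp [jet2, jet1, hf]
  · funext i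
    simp [jet2, jet1, lieD, coordField, h1, dotL_apply]
  · funext s
    induction s using Sym2.ind with | _ i k => ?_
    simp only [jet2]
    rw [symD_coordField (hsm.smoothNear a).two, h2, quadL_apply, quad_single]

section Param

variable {K : Type*} [NormedAddCommGroup K] [NormedSpace ℝ K] {x : K}

theorem ContDiffAt.dotProduct' {p w : K → ι → ℝ} (hp : ContDiffAt ℝ ∞ p x)
    (hw : ContDiffAt ℝ ∞ w x) : ContDiffAt ℝ ∞ (fun y => p y ⬝ᵥ w y) x := by
  unfold dotProduct
  exact ContDiffAt.sum fun i _ => (contDiffAt_pi.1 hp i).mul (contDiffAt_pi.1 hw i)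

theorem ContDiffAt.quad {Q : K → Sym2 ι → ℝ} {X Y : K → ι → ℝ} (hQ : ContDiffAt ℝ ∞ Q x)
    (hX : ContDiffAt ℝ ∞ X x) (hY : ContDiffAt ℝ ∞ Y x) :
    ContDiffAt ℝ ∞ (fun y => _root_.quad (Q y) (X y) (Y y)) x := by
  unfold _root_.quad
  exact ContDiffAt.sum fun i _ => ContDiffAt.sum fun k _ =>
    ((contDiffAt_pi.1 hQ _).mul (contDiffAt_pi.1 hX i)).mul (contDiffAt_pi.1 hY k)

theorem contDiffAt_sym2 {C : K → Sym2 ι → ℝ} (h : ∀ i k, ContDiffAt ℝ ∞ (fun y => C y s(i, k)) x) :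
    ContDiffAt ℝ ∞ C x :=
  contDiffAt_pi.2 fun s => by induction s using Sym2.ind with | _ i k => exact h i k

theorem SmoothNear.fderiv {E F : Type*} [NormedAddCommGroup E] [NormedSpace ℝ E]
    [NormedAddCommGroup F] [NormedSpace ℝ F] {f : E → F} {a : E} (h : SmoothNear f a) :
    SmoothNear (fderiv ℝ f) a :=
  h.mono fun _ hx => hx.fderiv_right (by simp)

variable {ψ : (ι' → ℝ) × ℝ → (ι → ℝ) × ℝ} {q : K → (ι' → ℝ) × ℝ} {p : K → ι → ℝ}
    {Q : K → Sym2 ι → ℝ} {X Y : K → (ι' → ℝ) × ℝ}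

theorem ContDiffAt.graphD (hψ : SmoothNear ψ (q x)) (hq : ContDiffAt ℝ ∞ q x)
    (hp : ContDiffAt ℝ ∞ p x) (hX : ContDiffAt ℝ ∞ X x) :
    ContDiffAt ℝ ∞ (fun y => graphD ψ (q y) (p y) (X y)) x := by
  have h := (hψ.fderiv.contDiffAt.comp x hq).clm_apply hX
  exact h.snd.sub (hp.dotProduct' h.fst)

theorem ContDiffAt.graphDD (hψ : SmoothNear ψ (q x)) (hq : ContDiffAt ℝ ∞ q x)
    (hp : ContDiffAt ℝ ∞ p x) (hQ : ContDiffAt ℝ ∞ Q x) (hX : ContDiffAt ℝ ∞ X x)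
    (hY : ContDiffAt ℝ ∞ Y x) :
    ContDiffAt ℝ ∞ (fun y => graphDD ψ (q y) (p y) (Q y) (X y) (Y y)) x := by
  have h := ((hψ.fderiv.fderiv.contDiffAt.comp x hq).clm_apply hX).clm_apply hY
  have h1 := (hψ.fderiv.contDiffAt.comp x hq).clm_apply hX
  have h2 := (hψ.fderiv.contDiffAt.comp x hq).clm_apply hY
  exact (h.snd.sub (hp.dotProduct' h.fst)).sub (hQ.quad h1.fst h2.fst)

end Param

variable {φ : OpenPartialHomeomorph ((ι → ℝ) × ℝ) ((ι' → ℝ) × ℝ)}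

theorem contDiffAt_transversality (hφ : IsDiffeo φ) {j : Jet1 ι} (hj : (j.1, j.2.1) ∈ φ.source) :
    ContDiffAt ℝ ∞ (fun j : Jet1 ι => graphD φ.symm (φ (j.1, j.2.1)) j.2.2 (0, 1)) j := by
  have hq : ContDiffAt ℝ ∞ (fun j : Jet1 ι => φ (j.1, j.2.1)) j :=
    ContDiffAt.comp (f := fun j : Jet1 ι => (j.1, j.2.1)) j (hφ.smoothNear hj).contDiffAt
      (contDiffAt_fst.prodMk contDiffAt_snd.fst)
  exact ContDiffAt.graphD (hφ.symm.smoothNear (φ.map_source hj)) hq contDiffAt_snd.snd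
    contDiffAt_const

theorem contDiffAt_jetMap (hφ : IsDiffeo φ) {j : Jet2 ι} (hj : (j.1.1, j.1.2.1) ∈ φ.source)
    (ht : IsTransverse φ j.1) : ContDiffAt ℝ ∞ (jetMap φ) j := by
  have hψ := hφ.symm.smoothNear (φ.map_source hj)
  have hq : ContDiffAt ℝ ∞ (fun j : Jet2 ι => φ (j.1.1, j.1.2.1)) j :=
    ContDiffAt.comp (f := fun j : Jet2 ι => (j.1.1, j.1.2.1)) j (hφ.smoothNear hj).contDiffAt
      (contDiffAt_fst.fst.prodMk contDiffAt_fst.snd.fst)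
  have hp : ContDiffAt ℝ ∞ (fun j : Jet2 ι => j.1.2.2) j := contDiffAt_fst.snd.snd
  have hQ : ContDiffAt ℝ ∞ (fun j : Jet2 ι => j.2) j := contDiffAt_snd
  have hD : ∀ X, ContDiffAt ℝ ∞ (fun j : Jet2 ι =>
      graphD φ.symm (φ (j.1.1, j.1.2.1)) j.1.2.2 X) j := fun X =>
    ContDiffAt.graphD hψ hq hp contDiffAt_const
  have hv : ∀ i : ι', ContDiffAt ℝ ∞ (fun j : Jet2 ι =>
      -graphD φ.symm (φ (j.1.1, j.1.2.1)) j.1.2.2 (Pi.single i 1, 0) /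
        graphD φ.symm (φ (j.1.1, j.1.2.1)) j.1.2.2 (0, 1)) j := fun i =>
    (hD _).neg.div (hD _) ht
  have hT := fun i : ι' => (contDiffAt_const (c := (Pi.single i 1 : ι' → ℝ))).prodMk (hv i)
  have hDD := fun i k : ι' => ContDiffAt.graphDD
    (q := fun j : Jet2 ι => φ (j.1.1, j.1.2.1)) hψ hq hp hQ (hT i) (hT k)
  refine (hq.fst.prodMk (hq.snd.prodMk (contDiffAt_pi.2 hv))).prodMk (contDiffAt_sym2 fun i k => ?_)
  exact (((hDD i k).add (hDD k i)).neg.div_const 2).div (hD _) ht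

/-- The action of `φ` on first-order jets. -/
theorem jetMap_fst (j : Jet1 ι) (Q : Sym2 ι → ℝ) :
    (jetMap φ (j, Q)).1 = (jetMap φ (j, 0)).1 := rfl

/-- The second derivatives `Q` enter only through `graphDD`, where they occur linearly with
coefficients depending on the first-order jet. This is why linearity in the highest derivatives
survives the change of coordinates. -/
theorem exists_linear_jetMap (φ : OpenPartialHomeomorph ((ι → ℝ) × ℝ) ((ι' → ℝ) × ℝ)) (j : Jet1 ι) :
    ∃ L : (Sym2 ι → ℝ) →ₗ[ℝ] (Sym2 ι' → ℝ),
      ∀ Q, (jetMap φ (j, Q)).2 = L Q + (jetMap φ (j, 0)).2 := by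
  refine ⟨⟨⟨fun Q => (jetMap φ (j, Q)).2 - (jetMap φ (j, 0)).2, ?_⟩, ?_⟩,
    fun Q => (sub_add_cancel _ _).symm⟩
  · intro Q R
    funext s
    induction s using Sym2.ind with | _ i k => ?_
    simp only [jetMap, Pi.sub_apply, Pi.add_apply, Sym2.lift_mk, graphDD, quad_add]
    simp [quad]
    ring
  · intro c Q
    funext s
    induction s using Sym2.ind with | _ i k => ?_
    simp only [jetMap, Pi.sub_apply, Pi.smul_apply, Sym2.lift_mk, graphDD, quad_smul]
    simp [quad]
    ring

/-- A transverse jet is the jet of a graph that is mapped to a graph. -/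
theorem exists_mapsGerm_of_jet (hφ : IsDiffeo φ) {j : Jet2 ι} (hj : (j.1.1, j.1.2.1) ∈ φ.source)
    (ht : IsTransverse φ j.1) : ∃ f v, SmoothNear f j.1.1 ∧ SmoothNear v (jetMap φ j).1.1 ∧
      jet2 f j.1.1 = j ∧ jet2 v (jetMap φ j).1.1 = jetMap φ j ∧
      MapsGerm φ f j.1.1 v (jetMap φ j).1.1 := by
  obtain ⟨f, hf, hfj⟩ := exists_jet2_eq j
  have h1 : jet1 f j.1.1 = j.1 := congrArg Prod.fst hfj
  have hu : f j.1.1 = j.1.2.1 := congrArg (fun j => j.2.1) h1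
  obtain ⟨v, hv, hm⟩ := exists_mapsGerm hφ (hf.smoothNear j.1.1) (by rwa [hu]) (by rwa [h1])
  rw [hu] at hv hm
  have := hm.jet2_eq hφ (hf.smoothNear _) hv
  rw [hfj] at this
  exact ⟨f, v, hf.smoothNear _, hv, hfj, this, hm⟩

/-- No calculation with the formula: a graph realizing `j` is mapped to a graph, and `φ.symm` maps
that germ back. -/
theorem jetMap_symm_jetMap (hφ : IsDiffeo φ) {j : Jet2 ι} (hj : (j.1.1, j.1.2.1) ∈ φ.source)
    (ht : IsTransverse φ j.1) : jetMap φ.symm (jetMap φ j) = j := by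
  obtain ⟨f, v, hf, hv, hfj, hvj, hm⟩ := exists_mapsGerm_of_jet hφ hj ht
  rw [← hvj, ← hm.symm.jet2_eq hφ.symm hv hf, hfj]

theorem isTransverse_symm_jetMap (hφ : IsDiffeo φ) {j : Jet2 ι}
    (hj : (j.1.1, j.1.2.1) ∈ φ.source) (ht : IsTransverse φ j.1) :
    IsTransverse φ.symm (jetMap φ j).1 := by
  obtain ⟨f, v, hf, hv, hfj, hvj, hm⟩ := exists_mapsGerm_of_jet hφ hj ht
  rw [← hvj]
  exact hm.symm.isTransverse hφ.symm hv hf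

end JetSmooth

/-! ## Jets with respect to a frame of vector fields -/

section Frames

variable {ι κ : Type*} [Fintype ι] [Fintype κ]

/-- The pull-back of the quadratic form `Q` under the linear map with rows `A`. -/
def quadPull (Q : Sym2 ι → ℝ) (A : Matrix κ ι ℝ) : Sym2 κ → ℝ :=
  Sym2.lift ⟨fun i k => quad Q (A i) (A k), fun _ _ => quad_comm _ _ _⟩

theorem quad_quadPull (Q : Sym2 ι → ℝ) (A : Matrix κ ι ℝ) (X Y : κ → ℝ) :
    quad (quadPull Q A) X Y = quad Q (Matrix.vecMul X A) (Matrix.vecMul Y A) := by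
  have h : ∀ Z : κ → ℝ, Matrix.vecMul Z A = ∑ i, Z i • A i := fun Z => by
    ext k
    simp [Matrix.vecMul, dotProduct]
  rw [h, h]
  simp only [← quadL_apply Q, map_sum, map_smul, _root_.sum_apply, _root_.smul_apply, smul_eq_mul,
    Finset.mul_sum]
  rw [quad, Finset.sum_comm]
  simp only [quadPull, Sym2.lift_mk, quadL_apply]
  exact Finset.sum_congr rfl fun i _ => Finset.sum_congr rfl fun k _ => by ring

variable [DecidableEq ι]

theorem quadPull_quadPull (Q : Sym2 ι → ℝ) (A B : Matrix ι ι ℝ) (h : B * A = 1) :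
    quadPull (quadPull Q A) B = Q := by
  funext s
  induction s using Sym2.ind with | _ i k => ?_
  have e : ∀ i, Matrix.vecMul (B i) A = Pi.single i 1 := fun i => by
    ext k
    have := congrFun (congrFun h i) k
    rw [Matrix.mul_apply] at this
    rw [Matrix.vecMul, dotProduct, this, Matrix.one_apply, Pi.single_apply]
    simp only [eq_comm]
  change quad (quadPull Q A) (B i) (B k) = _
  rw [quad_quadPull, e, e, quad_single]

/-- The first-order term of the symmetrized second derivatives along the fields `V`. -/
noncomputable def frameCorrection (V : κ → (ι → ℝ) → (ι → ℝ)) (a p : ι → ℝ) : Sym2 κ → ℝ :=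
  Sym2.lift ⟨fun i k => p ⬝ᵥ (fderiv ℝ (V k) a (V i a) + fderiv ℝ (V i) a (V k a)) / 2,
    fun _ _ => by simp only [add_comm]⟩

/-- The matrix of the components of the fields `V` at `a`. -/
def frameMatrix (V : ι → (ι → ℝ) → (ι → ℝ)) (a : ι → ℝ) : Matrix ι ι ℝ := Matrix.of fun i => V i a

/-- The second-order jet in terms of derivatives along the vector fields `V`. -/
noncomputable def frameJet (V : ι → (ι → ℝ) → (ι → ℝ)) (f : (ι → ℝ) → ℝ) (a : ι → ℝ) : Jet2 ι :=
  ((a, f a, fun i => lieD (V i) f a), symD V f a)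

/-- The change from coordinate derivatives to derivatives along the frame `V`. -/
noncomputable def toFrame (V : ι → (ι → ℝ) → (ι → ℝ)) (j : Jet2 ι) : Jet2 ι :=
  ((j.1.1, j.1.2.1, (frameMatrix V j.1.1).mulVec j.1.2.2),
    quadPull j.2 (frameMatrix V j.1.1) + frameCorrection V j.1.1 j.1.2.2)

/-- The change from derivatives along the frame `V` to coordinate derivatives. -/
noncomputable def ofFrame (V : ι → (ι → ℝ) → (ι → ℝ)) (j : Jet2 ι) : Jet2 ι :=
  ((j.1.1, j.1.2.1, (frameMatrix V j.1.1)⁻¹.mulVec j.1.2.2),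
    quadPull (j.2 - frameCorrection V j.1.1 ((frameMatrix V j.1.1)⁻¹.mulVec j.1.2.2))
      (frameMatrix V j.1.1)⁻¹)

variable {V : ι → (ι → ℝ) → (ι → ℝ)}

theorem frameJet_eq_toFrame {f : (ι → ℝ) → ℝ} {a : ι → ℝ} (hf : ContDiffAt ℝ 2 f a)
    (hV : ∀ i, DifferentiableAt ℝ (V i) a) : frameJet V f a = toFrame V (jet2 f a) := by
  refine Prod.ext (Prod.ext rfl (Prod.ext rfl ?_)) ?_
  · funext i
    change fderiv ℝ f a (V i a) = _
    rw [fderiv_eq_dotProduct, dotProduct_comm]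
    rfl
  · funext s
    induction s using Sym2.ind with | _ i k => ?_
    change symD V f a s(i, k) = quad (jet2 f a).2 (V i a) (V k a) + (jet1 f a).2.2 ⬝ᵥ _ / 2
    rw [symD_mk_eq hf hV, fderiv_eq_dotProduct, fderiv_fderiv_eq_quad hf]
    rfl

theorem ofFrame_toFrame {j : Jet2 ι} (h : IsUnit (frameMatrix V j.1.1).det) :
    ofFrame V (toFrame V j) = j := by
  have e : (frameMatrix V j.1.1)⁻¹.mulVec ((frameMatrix V j.1.1).mulVec j.1.2.2) = j.1.2.2 := by
    rw [Matrix.mulVec_mulVec, Matrix.nonsing_inv_mul _ h, Matrix.one_mulVec]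
  refine Prod.ext (Prod.ext rfl (Prod.ext rfl ?_)) ?_
  · exact e
  · simp only [ofFrame, toFrame, e, add_sub_cancel_right]
    exact quadPull_quadPull _ _ _ (Matrix.nonsing_inv_mul _ h)

theorem toFrame_ofFrame {j : Jet2 ι} (h : IsUnit (frameMatrix V j.1.1).det) :
    toFrame V (ofFrame V j) = j := by
  refine Prod.ext (Prod.ext rfl (Prod.ext rfl ?_)) ?_
  · simp only [ofFrame, toFrame]
    rw [Matrix.mulVec_mulVec, Matrix.mul_nonsing_inv _ h, Matrix.one_mulVec]
  · simp only [ofFrame, toFrame]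
    rw [quadPull_quadPull _ _ _ (Matrix.mul_nonsing_inv _ h), sub_add_cancel]

section Smooth

variable {K : Type*} [NormedAddCommGroup K] [NormedSpace ℝ K] {x : K}

theorem contDiffAt_det {M : K → Matrix ι ι ℝ} (h : ∀ i k, ContDiffAt ℝ ∞ (fun y => M y i k) x) :
    ContDiffAt ℝ ∞ (fun y => (M y).det) x := by
  simp only [Matrix.det_apply]
  exact ContDiffAt.sum fun σ _ => (contDiffAt_prod fun i _ => h _ _).const_smul _

theorem contDiffAt_matrix_inv {M : K → Matrix ι ι ℝ}
    (h : ∀ i k, ContDiffAt ℝ ∞ (fun y => M y i k) x) (hx : IsUnit (M x).det) (i k : ι) :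
    ContDiffAt ℝ ∞ (fun y => (M y)⁻¹ i k) x := by
  simp only [Matrix.inv_def, Matrix.smul_apply, Ring.inverse_eq_inv', smul_eq_mul,
    Matrix.adjugate_apply]
  refine ((contDiffAt_det h).inv hx.ne_zero).mul (contDiffAt_det fun r s => ?_)
  by_cases hr : r = k
  · subst hr
    simpa using contDiffAt_const
  · simpa [Matrix.updateRow_ne hr] using h r s

theorem contDiffAt_frameCorrection {a : K → ι → ℝ} {p : K → ι → ℝ}
    (hV : ∀ i, SmoothNear (V i) (a x)) (ha : ContDiffAt ℝ ∞ a x) (hp : ContDiffAt ℝ ∞ p x) :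
    ContDiffAt ℝ ∞ (fun y => frameCorrection V (a y) (p y)) x := by
  have h : ∀ i, ContDiffAt ℝ ∞ (fun y => V i (a y)) x := fun i => (hV i).contDiffAt.comp x ha
  have h' : ∀ i, ContDiffAt ℝ ∞ (fun y => fderiv ℝ (V i) (a y)) x :=
    fun i => (hV i).fderiv.contDiffAt.comp x ha
  exact contDiffAt_sym2 fun i k => (hp.dotProduct'
    (((h' k).clm_apply (h i)).add ((h' i).clm_apply (h k)))).div_const 2

theorem contDiffAt_frameMatrix {a : K → ι → ℝ} (hV : ∀ i, SmoothNear (V i) (a x))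
    (ha : ContDiffAt ℝ ∞ a x) (i k : ι) : ContDiffAt ℝ ∞ (fun y => frameMatrix V (a y) i k) x :=
  contDiffAt_pi.1 ((hV i).contDiffAt.comp x ha) k

theorem contDiffAt_toFrame {j : Jet2 ι} (hV : ∀ i, SmoothNear (V i) j.1.1) :
    ContDiffAt ℝ ∞ (toFrame V) j := by
  have ha : ContDiffAt ℝ ∞ (fun j : Jet2 ι => j.1.1) j := contDiffAt_fst.fst
  have hp : ContDiffAt ℝ ∞ (fun j : Jet2 ι => j.1.2.2) j := contDiffAt_fst.snd.snd
  have hM := contDiffAt_frameMatrix (x := j) hV ha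
  have hr : ∀ i, ContDiffAt ℝ ∞ (fun j : Jet2 ι => frameMatrix V j.1.1 i) j :=
    fun i => contDiffAt_pi.2 (hM i)
  refine (ha.prodMk (contDiffAt_fst.snd.fst.prodMk (contDiffAt_pi.2 fun i =>
    (hr i).dotProduct' hp))).prodMk ((contDiffAt_sym2 fun i k => ?_).add
      (contDiffAt_frameCorrection (x := j) hV ha hp))
  exact contDiffAt_snd.quad (hr i) (hr k)

theorem contDiffAt_ofFrame {j : Jet2 ι} (hV : ∀ i, SmoothNear (V i) j.1.1)
    (h : IsUnit (frameMatrix V j.1.1).det) : ContDiffAt ℝ ∞ (ofFrame V) j := by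
  have ha : ContDiffAt ℝ ∞ (fun j : Jet2 ι => j.1.1) j := contDiffAt_fst.fst
  have hP : ContDiffAt ℝ ∞ (fun j : Jet2 ι => j.1.2.2) j := contDiffAt_fst.snd.snd
  have hM := contDiffAt_matrix_inv (contDiffAt_frameMatrix (x := j) hV ha) h
  have hr : ∀ i, ContDiffAt ℝ ∞ (fun j : Jet2 ι => (frameMatrix V j.1.1)⁻¹ i) j :=
    fun i => contDiffAt_pi.2 (hM i)
  have hp : ContDiffAt ℝ ∞
      (fun j : Jet2 ι => (frameMatrix V j.1.1)⁻¹.mulVec j.1.2.2) j :=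
    contDiffAt_pi.2 fun i => (hr i).dotProduct' hP
  refine (ha.prodMk (contDiffAt_fst.snd.fst.prodMk hp)).prodMk (contDiffAt_sym2 fun i k => ?_)
  exact (contDiffAt_snd.sub (contDiffAt_frameCorrection (x := j) hV ha hp)).quad (hr i) (hr k)

end Smooth

theorem exists_linear_ofFrame (V : ι → (ι → ℝ) → (ι → ℝ)) (j : Jet1 ι) :
    ∃ L : (Sym2 ι → ℝ) →ₗ[ℝ] (Sym2 ι → ℝ),
      ∀ Q, (ofFrame V (j, Q)).2 = L Q + (ofFrame V (j, 0)).2 := by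
  refine ⟨⟨⟨fun Q => quadPull Q (frameMatrix V j.1)⁻¹, ?_⟩, ?_⟩, ?_⟩
  · intro Q R
    funext s
    induction s using Sym2.ind with | _ i k => exact quad_add _ _ _ _
  · intro c Q
    funext s
    induction s using Sym2.ind with | _ i k => exact quad_smul _ _ _ _
  · intro Q
    funext s
    induction s using Sym2.ind with | _ i k => ?_
    change quad (Q - _) _ _ = quad Q _ _ + quad (0 - _) _ _
    rw [← quad_add]
    congr 1
    funext s
    simp [sub_eq_add_neg]

/-- Derivatives along a frame that is invariant under the map `ρ` are invariant. -/
theorem frameJet_comp_eq {ρ : (ι → ℝ) → (ι → ℝ)} {a : ι → ℝ} {v v' : (ι → ℝ) → ℝ}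
    (hρ : ContinuousAt ρ a) (hρd : ∀ᶠ x in 𝓝 a, DifferentiableAt ℝ ρ x)
    (hinv : ∀ᶠ x in 𝓝 a, ∀ i, fderiv ℝ ρ x (V i x) = V i (ρ x))
    (hV : ∀ i, SmoothNear (V i) (ρ a))
    (hv' : SmoothNear v' (ρ a)) (h : ∀ᶠ x in 𝓝 a, v' (ρ x) = v x) :
    (frameJet V v a).1.2 = (frameJet V v' (ρ a)).1.2 ∧
      ∀ i k, lieD (V i) (lieD (V k) v) a = lieD (V i) (lieD (V k) v') (ρ a) := by
  -- Invariance of the frame means that `V i` commutes with composition by `ρ`. Used once it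
  -- transports first derivatives; applied to its own output it transports second ones, hence the
  -- conclusion on a neighbourhood.
  have key : ∀ {w w' : (ι → ℝ) → ℝ}, SmoothNear w' (ρ a) → (∀ᶠ x in 𝓝 a, w' (ρ x) = w x) →
      ∀ i, ∀ᶠ x in 𝓝 a, lieD (V i) w' (ρ x) = lieD (V i) w x := by
    intro w w' hw' hww i
    filter_upwards [hww.eventually_nhds, hρ.eventually hw', hρd, hinv] with x h1 h2 h3 h4
    have e : w =ᶠ[𝓝 x] w' ∘ ρ := h1.mono fun y hy => hy.symm
    unfold lieD
    rw [e.fderiv_eq, fderiv_comp x (h2.differentiableAt (by simp)) h3, ← h4]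
    rfl
  refine ⟨Prod.ext h.self_of_nhds.symm (funext fun i => (key hv' h i).self_of_nhds.symm),
    fun i k => ?_⟩
  have hs : SmoothNear (lieD (V k) v') (ρ a) := by
    filter_upwards [hv'.fderiv, hV k] with x h1 h2 using h1.clm_apply h2
  exact (key hs (key hv' h k) i).self_of_nhds.symm

end Frames

/-! ## Invariant vector fields in a chart -/

section Group

variable {n : ℕ} {G : Type*} [Group G] [TopologicalSpace G] [ChartedSpace (Fin n → ℝ) G]
  {E F : Type*} [NormedAddCommGroup E] [NormedSpace ℝ E] [NormedAddCommGroup F] [NormedSpace ℝ F]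

/-- The derivative at the identity of the map `h` in the direction `w`. -/
noncomputable def derivOne (h : G → E) (w : GroupLieAlgebra 𝓘(ℝ, Fin n → ℝ) G) : E :=
  mfderiv 𝓘(ℝ, Fin n → ℝ) 𝓘(ℝ, E) h (1 : G) w

theorem derivOne_comp {k : E → F} {h : G → E} (hk : DifferentiableAt ℝ k (h 1))
    (hh : MDifferentiableAt 𝓘(ℝ, Fin n → ℝ) 𝓘(ℝ, E) h (1 : G))
    (w : GroupLieAlgebra 𝓘(ℝ, Fin n → ℝ) G) :
    derivOne (fun g => k (h g)) w = fderiv ℝ k (h 1) (derivOne h w) := by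
  have := mfderiv_comp (1 : G) hk.mdifferentiableAt hh
  rw [mfderiv_eq_fderiv] at this
  exact congrArg (fun L => L w) this

theorem derivOne_congr {h h' : G → E} (he : h =ᶠ[𝓝 1] h')
    (w : GroupLieAlgebra 𝓘(ℝ, Fin n → ℝ) G) : derivOne h w = derivOne h' w := by
  unfold derivOne
  rw [he.mfderiv_eq]
  rfl

theorem derivOne_const (c : E) (w : GroupLieAlgebra 𝓘(ℝ, Fin n → ℝ) G) :
    derivOne (fun _ : G => c) w = 0 := by
  unfold derivOne
  rw [mfderiv_const]
  rfl

/-- By the chain rule only the value and the velocity of `θ` at `1` matter. In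
`derivOne_backTranslate` this replaces the unknown motion by a translation with the same velocity.
-/
theorem derivOne_prod_congr {N : E × G → F} {θ θ' : G → E} (h1 : θ 1 = θ' 1)
    (hN : MDifferentiableAt (𝓘(ℝ, E).prod 𝓘(ℝ, Fin n → ℝ)) 𝓘(ℝ, F) N (θ 1, 1))
    (hθ : MDifferentiableAt 𝓘(ℝ, Fin n → ℝ) 𝓘(ℝ, E) θ (1 : G))
    (hθ' : MDifferentiableAt 𝓘(ℝ, Fin n → ℝ) 𝓘(ℝ, E) θ' (1 : G))
    (w : GroupLieAlgebra 𝓘(ℝ, Fin n → ℝ) G) (hw : derivOne θ w = derivOne θ' w) :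
    derivOne (fun s => N (θ s, s)) w = derivOne (fun s => N (θ' s, s)) w := by
  have key : ∀ {θ : G → E}, MDifferentiableAt (𝓘(ℝ, E).prod 𝓘(ℝ, Fin n → ℝ)) 𝓘(ℝ, F) N (θ 1, 1) →
      MDifferentiableAt 𝓘(ℝ, Fin n → ℝ) 𝓘(ℝ, E) θ (1 : G) →
      derivOne (fun s => N (θ s, s)) w = mfderiv (𝓘(ℝ, E).prod 𝓘(ℝ, Fin n → ℝ)) 𝓘(ℝ, F) N (θ 1, 1)
        ((derivOne θ w, w) : E × (Fin n → ℝ)) := by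
    intro θ hN hθ
    have hp : MDifferentiableAt 𝓘(ℝ, Fin n → ℝ) (𝓘(ℝ, E).prod 𝓘(ℝ, Fin n → ℝ))
        (fun s : G => (θ s, s)) 1 := hθ.prodMk mdifferentiableAt_id
    have := mfderiv_comp (f := fun s : G => (θ s, s)) (1 : G) hN hp
    have e : mfderiv 𝓘(ℝ, Fin n → ℝ) (𝓘(ℝ, E).prod 𝓘(ℝ, Fin n → ℝ)) (fun s : G => (θ s, s)) 1 =
        (mfderiv 𝓘(ℝ, Fin n → ℝ) 𝓘(ℝ, E) θ 1).prod
          (mfderiv 𝓘(ℝ, Fin n → ℝ) 𝓘(ℝ, Fin n → ℝ) (id : G → G) 1) :=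
      hθ.mfderiv_prod mdifferentiableAt_id
    rw [e, mfderiv_id] at this
    exact congrArg (fun L => L w) this
  rw [key hN hθ, key (h1 ▸ hN) hθ', hw, h1]

variable [LieGroup 𝓘(ℝ, Fin n → ℝ) ∞ G]

variable {κ : OpenPartialHomeomorph G (Fin n → ℝ)}

theorem contMDiffAt_chart (hκ : κ ∈ IsManifold.maximalAtlas 𝓘(ℝ, Fin n → ℝ) ∞ G) {g : G}
    (hg : g ∈ κ.source) : ContMDiffAt 𝓘(ℝ, Fin n → ℝ) 𝓘(ℝ, Fin n → ℝ) ∞ κ g :=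
  contMDiffAt_of_mem_maximalAtlas hκ hg

theorem contMDiffAt_chart_symm (hκ : κ ∈ IsManifold.maximalAtlas 𝓘(ℝ, Fin n → ℝ) ∞ G)
    {x : Fin n → ℝ} (hx : x ∈ κ.target) :
    ContMDiffAt 𝓘(ℝ, Fin n → ℝ) 𝓘(ℝ, Fin n → ℝ) ∞ κ.symm x :=
  contMDiffAt_symm_of_mem_maximalAtlas hκ hx

theorem contMDiffAt_left_chart (hκ : κ ∈ IsManifold.maximalAtlas 𝓘(ℝ, Fin n → ℝ) ∞ G) {g s : G}
    (hg : g * s ∈ κ.source) :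
    ContMDiffAt 𝓘(ℝ, Fin n → ℝ) 𝓘(ℝ, Fin n → ℝ) ∞ (fun s => κ (g * s)) s :=
  (contMDiffAt_chart hκ hg).comp s (contMDiff_mul_left (a := g)).contMDiffAt

theorem contMDiffAt_right_chart (hκ : κ ∈ IsManifold.maximalAtlas 𝓘(ℝ, Fin n → ℝ) ∞ G) {g s : G}
    (hg : s * g ∈ κ.source) :
    ContMDiffAt 𝓘(ℝ, Fin n → ℝ) 𝓘(ℝ, Fin n → ℝ) ∞ (fun s => κ (s * g)) s :=
  (contMDiffAt_chart hκ hg).comp s (contMDiff_mul_right (a := g)).contMDiffAt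

/-- The left-invariant field at `g` is the velocity of `s ↦ g s`, hence it generates right
translations. In this form all later uses reduce to the group law and the chain rule. -/
theorem leftComp_eq (hκ : κ ∈ IsManifold.maximalAtlas 𝓘(ℝ, Fin n → ℝ) ∞ G) {x : Fin n → ℝ}
    (hx : x ∈ κ.target) (w : GroupLieAlgebra 𝓘(ℝ, Fin n → ℝ) G) :
    leftComp κ w x = derivOne (fun s => κ (κ.symm x * s)) w := by
  have h1 : MDifferentiableAt 𝓘(ℝ, Fin n → ℝ) 𝓘(ℝ, Fin n → ℝ) κ (κ.symm x * 1) := by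
    rw [mul_one]
    exact (contMDiffAt_chart hκ (κ.map_target hx)).mdifferentiableAt (by simp)
  have h2 : MDifferentiableAt 𝓘(ℝ, Fin n → ℝ) 𝓘(ℝ, Fin n → ℝ) (fun s => κ.symm x * s) (1 : G) :=
    (contMDiff_mul_left (n := ∞) (a := κ.symm x)).contMDiffAt.mdifferentiableAt (by simp)
  have := mfderiv_comp (1 : G) h1 h2
  rw [mul_one] at this
  exact (congrArg (fun L => L w) this).symm

theorem rightComp_eq (hκ : κ ∈ IsManifold.maximalAtlas 𝓘(ℝ, Fin n → ℝ) ∞ G) {x : Fin n → ℝ}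
    (hx : x ∈ κ.target) (w : GroupLieAlgebra 𝓘(ℝ, Fin n → ℝ) G) :
    rightComp κ w x = derivOne (fun s => κ (s * κ.symm x)) w := by
  have h1 : MDifferentiableAt 𝓘(ℝ, Fin n → ℝ) 𝓘(ℝ, Fin n → ℝ) κ (1 * κ.symm x) := by
    rw [one_mul]
    exact (contMDiffAt_chart hκ (κ.map_target hx)).mdifferentiableAt (by simp)
  have h2 : MDifferentiableAt 𝓘(ℝ, Fin n → ℝ) 𝓘(ℝ, Fin n → ℝ) (fun s => s * κ.symm x) (1 : G) :=
    (contMDiff_mul_right (n := ∞) (a := κ.symm x)).contMDiffAt.mdifferentiableAt (by simp)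
  have := mfderiv_comp (1 : G) h1 h2
  rw [one_mul] at this
  exact (congrArg (fun L => L w) this).symm

/-- A diffeomorphism germ `P` from the identity of the group to a vector space, with smooth left
inverse, has injective derivative. -/
theorem eq_zero_of_derivOne_eq_zero {P : G → E} {Q : E → G}
    (hP : MDifferentiableAt 𝓘(ℝ, Fin n → ℝ) 𝓘(ℝ, E) P (1 : G))
    (hQ : MDifferentiableAt 𝓘(ℝ, E) 𝓘(ℝ, Fin n → ℝ) Q (P 1)) (h : Q ∘ P =ᶠ[𝓝 1] id)
    {w : GroupLieAlgebra 𝓘(ℝ, Fin n → ℝ) G} (hw : derivOne P w = 0) : w = 0 := by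
  have := mfderiv_comp (1 : G) hQ hP
  rw [h.mfderiv_eq, mfderiv_id] at this
  have h2 := congrArg (fun L => L w) this
  have h3 : mfderiv 𝓘(ℝ, Fin n → ℝ) 𝓘(ℝ, E) P (1 : G) w = 0 := hw
  simp only [ContinuousLinearMap.comp_apply, h3, map_zero] at h2
  exact h2

theorem leftComp_eq_zero (hκ : κ ∈ IsManifold.maximalAtlas 𝓘(ℝ, Fin n → ℝ) ∞ G) {x : Fin n → ℝ}
    (hx : x ∈ κ.target) {w : GroupLieAlgebra 𝓘(ℝ, Fin n → ℝ) G} (hw : leftComp κ w x = 0) :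
    w = 0 := by
  rw [leftComp_eq hκ hx] at hw
  have hs : κ.symm x * 1 ∈ κ.source := by simpa using κ.map_target hx
  have hc : ContMDiffAt 𝓘(ℝ, Fin n → ℝ) 𝓘(ℝ, Fin n → ℝ) ∞ (fun y => (κ.symm x)⁻¹ * κ.symm y)
      (κ (κ.symm x * 1)) :=
    (contMDiff_mul_left (a := (κ.symm x)⁻¹)).contMDiffAt.comp _
      (contMDiffAt_chart_symm hκ (κ.map_source hs))
  refine eq_zero_of_derivOne_eq_zero (Q := fun y => (κ.symm x)⁻¹ * κ.symm y)
    ((contMDiffAt_left_chart hκ hs).mdifferentiableAt (by simp))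
    (hc.mdifferentiableAt (by simp)) ?_ hw
  have : ∀ᶠ s in 𝓝 (1 : G), κ.symm x * s ∈ κ.source :=
    (contMDiff_mul_left (I := 𝓘(ℝ, Fin n → ℝ)) (n := ∞) (a := κ.symm x)).continuous.continuousAt.eventually
      (κ.open_source.mem_nhds hs)
  filter_upwards [this] with s hs
  simp [κ.left_inv hs]

theorem rightComp_eq_zero (hκ : κ ∈ IsManifold.maximalAtlas 𝓘(ℝ, Fin n → ℝ) ∞ G) {x : Fin n → ℝ}
    (hx : x ∈ κ.target) {w : GroupLieAlgebra 𝓘(ℝ, Fin n → ℝ) G} (hw : rightComp κ w x = 0) :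
    w = 0 := by
  rw [rightComp_eq hκ hx] at hw
  have hs : 1 * κ.symm x ∈ κ.source := by simpa using κ.map_target hx
  have hc : ContMDiffAt 𝓘(ℝ, Fin n → ℝ) 𝓘(ℝ, Fin n → ℝ) ∞ (fun y => κ.symm y * (κ.symm x)⁻¹)
      (κ (1 * κ.symm x)) :=
    (contMDiff_mul_right (a := (κ.symm x)⁻¹)).contMDiffAt.comp _
      (contMDiffAt_chart_symm hκ (κ.map_source hs))
  refine eq_zero_of_derivOne_eq_zero (Q := fun y => κ.symm y * (κ.symm x)⁻¹)
    ((contMDiffAt_right_chart hκ hs).mdifferentiableAt (by simp))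
    (hc.mdifferentiableAt (by simp)) ?_ hw
  have : ∀ᶠ s in 𝓝 (1 : G), s * κ.symm x ∈ κ.source :=
    (contMDiff_mul_right (I := 𝓘(ℝ, Fin n → ℝ)) (n := ∞) (a := κ.symm x)).continuous.continuousAt.eventually
      (κ.open_source.mem_nhds hs)
  filter_upwards [this] with s hs
  simp [κ.left_inv hs]

/-- The components of the left-invariant fields, as a linear map. -/
noncomputable def leftCompL (κ : OpenPartialHomeomorph G (Fin n → ℝ)) (x : Fin n → ℝ) :
    (Fin n → ℝ) →ₗ[ℝ] (Fin n → ℝ) :=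
  ((mfderiv 𝓘(ℝ, Fin n → ℝ) 𝓘(ℝ, Fin n → ℝ) κ (κ.symm x)).comp
    (mfderiv 𝓘(ℝ, Fin n → ℝ) 𝓘(ℝ, Fin n → ℝ) (fun a : G => κ.symm x * a) (1 : G))).toLinearMap

theorem leftComp_surjective (hκ : κ ∈ IsManifold.maximalAtlas 𝓘(ℝ, Fin n → ℝ) ∞ G)
    {x : Fin n → ℝ} (hx : x ∈ κ.target) (y : Fin n → ℝ) :
    ∃ w : GroupLieAlgebra 𝓘(ℝ, Fin n → ℝ) G, leftComp κ w x = y := by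
  have hinj : Function.Injective (leftCompL κ x) :=
    (injective_iff_map_eq_zero _).2 fun w hw => leftComp_eq_zero hκ hx hw
  exact (LinearMap.injective_iff_surjective.1 hinj) y

theorem derivOne_eq_fderiv (hκ : κ ∈ IsManifold.maximalAtlas 𝓘(ℝ, Fin n → ℝ) ∞ G)
    (h1 : (1 : G) ∈ κ.source) {P : G → E}
    (hP : MDifferentiableAt 𝓘(ℝ, Fin n → ℝ) 𝓘(ℝ, E) P (1 : G))
    (w : GroupLieAlgebra 𝓘(ℝ, Fin n → ℝ) G) :
    derivOne P w = fderiv ℝ (P ∘ κ.symm) (κ 1) (derivOne κ w) := by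
  have hd : MDifferentiableAt 𝓘(ℝ, Fin n → ℝ) 𝓘(ℝ, E) (P ∘ κ.symm) (κ 1) := by
    refine MDifferentiableAt.comp (κ 1) ?_
      ((contMDiffAt_chart_symm hκ (κ.map_source h1)).mdifferentiableAt (by simp))
    rwa [κ.left_inv h1]
  rw [← derivOne_comp (k := P ∘ κ.symm) hd.differentiableAt
    ((contMDiffAt_chart hκ h1).mdifferentiableAt (by simp))]
  refine derivOne_congr ?_ w
  filter_upwards [κ.open_source.mem_nhds h1] with s hs
  simp [κ.left_inv hs]

/-- In a chart at the identity the derivative is a partial derivative, at a fixed point, of a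
function jointly smooth in the parameter and the chart variable. Generators and right-invariant
fields are both of this kind. -/
theorem smoothNear_derivOne {X : Type*} [NormedAddCommGroup X] [NormedSpace ℝ X] {H : X → G → E}
    {x₀ : X} (hH : ∀ᶠ x in 𝓝 x₀, ContMDiffAt (𝓘(ℝ, X).prod 𝓘(ℝ, Fin n → ℝ)) 𝓘(ℝ, E) ∞
      (fun p : X × G => H p.1 p.2) (x, 1)) (w : GroupLieAlgebra 𝓘(ℝ, Fin n → ℝ) G) :
    SmoothNear (fun x => derivOne (H x) w) x₀ := by
  set κ := chartAt (Fin n → ℝ) (1 : G)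
  have hκ : κ ∈ IsManifold.maximalAtlas 𝓘(ℝ, Fin n → ℝ) ∞ G := IsManifold.chart_mem_maximalAtlas 1
  have h1 : (1 : G) ∈ κ.source := mem_chart_source _ _
  have hd : ∀ᶠ x in 𝓝 x₀, derivOne (H x) w = fderiv ℝ (H x ∘ κ.symm) (κ 1) (derivOne κ w) := by
    filter_upwards [hH] with x hx
    have : ContMDiffAt 𝓘(ℝ, Fin n → ℝ) 𝓘(ℝ, E) ∞ (H x) (1 : G) :=
      ContMDiffAt.comp (f := fun g : G => (x, g)) (1 : G) hx (contMDiffAt_const.prodMk contMDiffAt_id)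
    exact derivOne_eq_fderiv hκ h1 (this.mdifferentiableAt (by simp)) w
  have hs : SmoothNear (fun x => fderiv ℝ (H x ∘ κ.symm) (κ 1) (derivOne κ w)) x₀ := by
    filter_upwards [hH] with x hx
    have hjoint : ContMDiffAt 𝓘(ℝ, X × (Fin n → ℝ)) 𝓘(ℝ, E) ∞
        (fun p : X × (Fin n → ℝ) => H p.1 (κ.symm p.2)) (x, κ 1) := by
      have e : ContMDiffAt 𝓘(ℝ, X × (Fin n → ℝ)) (𝓘(ℝ, X).prod 𝓘(ℝ, Fin n → ℝ)) ∞
          (fun p : X × (Fin n → ℝ) => (p.1, κ.symm p.2)) (x, κ 1) :=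
        contDiffAt_fst.contMDiffAt.prodMk
          (ContMDiffAt.comp (x, κ 1) (contMDiffAt_chart_symm hκ (κ.map_source h1))
            contDiffAt_snd.contMDiffAt)
      refine ContMDiffAt.comp (g := fun p : X × G => H p.1 p.2) (x, κ 1) ?_ e
      simpa [κ.left_inv h1] using hx
    exact (ContDiffAt.fderiv (f := fun x y => H x (κ.symm y)) (g := fun _ => κ 1) (m := ∞)
      hjoint.contDiffAt contDiffAt_const (by simp)).clm_apply contDiffAt_const
  exact hs.congr hd

theorem rightComp_smoothNear (hκ : κ ∈ IsManifold.maximalAtlas 𝓘(ℝ, Fin n → ℝ) ∞ G)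
    {x : Fin n → ℝ} (hx : x ∈ κ.target) (w : GroupLieAlgebra 𝓘(ℝ, Fin n → ℝ) G) :
    SmoothNear (rightComp κ w) x := by
  have hn := κ.open_target.mem_nhds hx
  refine (smoothNear_derivOne (H := fun x s => κ (s * κ.symm x)) (w := w) ?_).congr
    (by filter_upwards [hn] with y hy using rightComp_eq hκ hy w)
  filter_upwards [hn] with y hy
  have h1 : ContMDiffAt (𝓘(ℝ, Fin n → ℝ).prod 𝓘(ℝ, Fin n → ℝ)) 𝓘(ℝ, Fin n → ℝ) ∞
      (fun p : (Fin n → ℝ) × G => p.2 * κ.symm p.1) (y, 1) :=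
    contMDiffAt_snd.mul (ContMDiffAt.comp (y, (1 : G)) (contMDiffAt_chart_symm hκ hy)
      contMDiffAt_fst)
  refine ContMDiffAt.comp (g := κ) (f := fun p : (Fin n → ℝ) × G => p.2 * κ.symm p.1) (y, (1 : G))
    (contMDiffAt_chart hκ ?_) h1
  simpa using κ.map_target hy

/-- The right translation by `h` in the chart `κ`. -/
noncomputable def rightTranslation (κ : OpenPartialHomeomorph G (Fin n → ℝ)) (h : G)
    (x : Fin n → ℝ) : Fin n → ℝ := κ (κ.symm x * h)

theorem rightTranslation_smoothNear (hκ : κ ∈ IsManifold.maximalAtlas 𝓘(ℝ, Fin n → ℝ) ∞ G)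
    {x : Fin n → ℝ} (hx : x ∈ κ.target) {h : G} (hh : κ.symm x * h ∈ κ.source) :
    SmoothNear (rightTranslation κ h) x := by
  have hc : ContinuousAt (fun y => κ.symm y * h) x :=
    ((contMDiff_mul_right (I := 𝓘(ℝ, Fin n → ℝ)) (n := ∞) (a := h)).continuous.continuousAt).comp
      (κ.symm.continuousAt hx)
  filter_upwards [κ.open_target.mem_nhds hx, hc.eventually (κ.open_source.mem_nhds hh)] with y hy hyh
  exact (ContMDiffAt.comp y (contMDiffAt_right_chart hκ hyh)
    (contMDiffAt_chart_symm hκ hy)).contDiffAt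

/-- Associativity, `(s g) h = s (g h)`, differentiated at `s = 1`. -/
theorem fderiv_rightTranslation (hκ : κ ∈ IsManifold.maximalAtlas 𝓘(ℝ, Fin n → ℝ) ∞ G)
    {x : Fin n → ℝ} (hx : x ∈ κ.target) {h : G} (hh : κ.symm x * h ∈ κ.source)
    (w : GroupLieAlgebra 𝓘(ℝ, Fin n → ℝ) G) :
    fderiv ℝ (rightTranslation κ h) x (rightComp κ w x) =
      rightComp κ w (rightTranslation κ h x) := by
  have hs : κ.symm x ∈ κ.source := κ.map_target hx
  have hs1 : 1 * κ.symm x ∈ κ.source := by simpa using hs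
  rw [rightComp_eq hκ hx]
  refine Eq.trans ?_ (rightComp_eq hκ (κ.map_source hh) w).symm
  have e : κ (1 * κ.symm x) = x := by rw [one_mul, κ.right_inv hx]
  have := derivOne_comp (k := rightTranslation κ h) (h := fun s => κ (s * κ.symm x))
    (by rw [e]; exact (rightTranslation_smoothNear hκ hx hh).differentiableAt)
    ((contMDiffAt_right_chart hκ hs1).mdifferentiableAt (by simp)) w
  rw [e] at this
  rw [← this]
  refine derivOne_congr ?_ w
  have hc : ContinuousAt (fun s => s * κ.symm x) (1 : G) :=
    (contMDiff_mul_right (I := 𝓘(ℝ, Fin n → ℝ)) (n := ∞) (a := κ.symm x)).continuous.continuousAt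
  filter_upwards [hc.eventually (κ.open_source.mem_nhds hs1)] with s hs'
  simp only [rightTranslation]
  rw [κ.left_inv hs', κ.left_inv hh, mul_assoc]

/-- The components of the right-invariant fields, as a linear map. -/
noncomputable def rightCompL (κ : OpenPartialHomeomorph G (Fin n → ℝ)) (x : Fin n → ℝ) :
    GroupLieAlgebra 𝓘(ℝ, Fin n → ℝ) G →ₗ[ℝ] (Fin n → ℝ) :=
  ((mfderiv 𝓘(ℝ, Fin n → ℝ) 𝓘(ℝ, Fin n → ℝ) κ (κ.symm x) : (Fin n → ℝ) →L[ℝ] (Fin n → ℝ)).comp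
    (mfderiv 𝓘(ℝ, Fin n → ℝ) 𝓘(ℝ, Fin n → ℝ) (fun a : G => a * κ.symm x) (1 : G) :
      (Fin n → ℝ) →L[ℝ] (Fin n → ℝ))).toLinearMap

theorem linearIndependent_rightComp (hκ : κ ∈ IsManifold.maximalAtlas 𝓘(ℝ, Fin n → ℝ) ∞ G)
    (β : Module.Basis (Fin n) ℝ (GroupLieAlgebra 𝓘(ℝ, Fin n → ℝ) G)) {x : Fin n → ℝ}
    (hx : x ∈ κ.target) : LinearIndependent ℝ fun i => rightComp κ (β i) x := by
  have hinj : Function.Injective (rightCompL (G := G) κ x) :=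
    (injective_iff_map_eq_zero _).2 fun w hw => rightComp_eq_zero hκ hx hw
  exact β.linearIndependent.map' (rightCompL κ x) (LinearMap.ker_eq_bot.2 hinj)

/-! ## The invariants as derivatives along a frame -/

/-- The frame of the right-invariant fields and the fields `∂/∂y`. -/
noncomputable def adaptedFrame {l : ℕ} (κ : OpenPartialHomeomorph G (Fin n → ℝ))
    (β : Module.Basis (Fin n) ℝ (GroupLieAlgebra 𝓘(ℝ, Fin n → ℝ) G)) :
    Fin n ⊕ Fin l → (Fin n ⊕ Fin l → ℝ) → (Fin n ⊕ Fin l → ℝ) :=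
  Sum.elim (etaField κ β) yField

variable {l : ℕ} {β : Module.Basis (Fin n) ℝ (GroupLieAlgebra 𝓘(ℝ, Fin n → ℝ) G)}

/-- The projection `(x, y) ↦ x` as a linear map. -/
def xPartL (n l : ℕ) : (Fin n ⊕ Fin l → ℝ) →L[ℝ] (Fin n → ℝ) :=
  ContinuousLinearMap.pi fun i => ContinuousLinearMap.proj (Sum.inl i)

/-- The inclusion `x ↦ (x, 0)` as a linear map. -/
def xInclL (n l : ℕ) : (Fin n → ℝ) →L[ℝ] (Fin n ⊕ Fin l → ℝ) :=
  ContinuousLinearMap.pi (Sum.elim (fun i => ContinuousLinearMap.proj i) fun _ => 0)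

theorem xPartL_apply (p : Fin n ⊕ Fin l → ℝ) : xPartL n l p = xPart p := rfl

theorem xInclL_apply (x : Fin n → ℝ) : xInclL n l x = Sum.elim x 0 := by
  funext s
  cases s <;> rfl

theorem etaField_eq (i : Fin n) : (etaField κ β i : (Fin n ⊕ Fin l → ℝ) → _) =
    fun p => xInclL n l (rightComp κ (β i) (xPartL n l p)) := by
  funext p
  rw [xInclL_apply]
  rfl

theorem adaptedFrame_smoothNear (hκ : κ ∈ IsManifold.maximalAtlas 𝓘(ℝ, Fin n → ℝ) ∞ G)
    {p : Fin n ⊕ Fin l → ℝ} (hp : xPart p ∈ κ.target) (s : Fin n ⊕ Fin l) :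
    SmoothNear (adaptedFrame κ β s) p := by
  cases s with
  | inl i =>
    change SmoothNear (etaField κ β i) p
    rw [etaField_eq]
    exact ((xInclL n l).contDiff.smoothNear _).comp
      ((rightComp_smoothNear hκ hp (β i)).comp ((xPartL n l).contDiff.smoothNear p))
  | inr μ => exact contDiff_const.smoothNear p

theorem isUnit_det_adaptedFrame (hκ : κ ∈ IsManifold.maximalAtlas 𝓘(ℝ, Fin n → ℝ) ∞ G)
    {p : Fin n ⊕ Fin l → ℝ} (hp : xPart p ∈ κ.target) :
    IsUnit (frameMatrix (adaptedFrame κ β) p).det := by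
  have h1 : frameMatrix (adaptedFrame κ β) p = Matrix.fromBlocks
      (Matrix.of fun i => rightComp κ (β i) (xPart p)) 0 0 (1 : Matrix (Fin l) (Fin l) ℝ) := by
    ext s t
    cases s <;> cases t <;>
      simp [frameMatrix, adaptedFrame, etaField, yField, coordField, Pi.single_apply,
        Matrix.one_apply, eq_comm]
  rw [h1, Matrix.det_fromBlocks_zero₂₁, Matrix.det_one, mul_one]
  exact (Matrix.isUnit_iff_isUnit_det _).1
    (Matrix.linearIndependent_rows_iff_isUnit.1 (linearIndependent_rightComp hκ β hp))

/-- The rearrangement of the invariants and of `x` as a second-order jet. -/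
def packJet (x : Fin n → ℝ) (t : Inv2 n l) : Jet2 (Fin n ⊕ Fin l) :=
  ((Sum.elim x t.1.1, t.1.2.1, Sum.elim t.1.2.2.2 t.1.2.2.1), Sym2.lift ⟨fun r s => match r, s with
    | Sum.inl i, Sum.inl k => t.2.2.1 s(i, k)
    | Sum.inl i, Sum.inr μ => t.2.2.2 i μ
    | Sum.inr μ, Sum.inl i => t.2.2.2 i μ
    | Sum.inr μ, Sum.inr ν => t.2.1 s(μ, ν), by
      rintro (i | i) (k | k) <;> simp [Sym2.eq_swap]⟩)

/-- The inverse of `packJet`, forgetting `x`. -/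
def unpackJet (j : Jet2 (Fin n ⊕ Fin l)) : Inv2 n l :=
  ((yPart j.1.1, j.1.2.1, fun μ => j.1.2.2 (Sum.inr μ), fun i => j.1.2.2 (Sum.inl i)),
    fun s => j.2 (s.map Sum.inr), fun s => j.2 (s.map Sum.inl),
    fun i μ => j.2 s(Sum.inl i, Sum.inr μ))

theorem unpackJet_packJet (x : Fin n → ℝ) (t : Inv2 n l) : unpackJet (packJet x t) = t := by
  refine Prod.ext rfl (Prod.ext ?_ (Prod.ext ?_ rfl))
  · funext s
    induction s using Sym2.ind with | _ i k => rfl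
  · funext s
    induction s using Sym2.ind with | _ i k => rfl

theorem packJet_unpackJet (j : Jet2 (Fin n ⊕ Fin l)) : packJet (xPart j.1.1) (unpackJet j) = j := by
  refine Prod.ext (Prod.ext ?_ (Prod.ext rfl ?_)) ?_
  · funext s
    cases s <;> rfl
  · funext s
    cases s <;> rfl
  · funext s
    induction s using Sym2.ind with | _ i k => ?_
    cases i <;> cases k <;> simp [packJet, unpackJet, Sym2.eq_swap]

theorem contDiff_packJet : ContDiff ℝ ∞ fun p : (Fin n → ℝ) × Inv2 n l => packJet p.1 p.2 := by
  refine ContDiff.prodMk (ContDiff.prodMk ?_ (ContDiff.prodMk (by fun_prop) ?_)) ?_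
  · refine contDiff_pi.2 fun s => ?_
    cases s
    · exact contDiff_pi.1 contDiff_fst _
    · exact contDiff_pi.1 contDiff_snd.fst.fst _
  · refine contDiff_pi.2 fun s => ?_
    cases s
    · exact contDiff_pi.1 contDiff_snd.fst.snd.snd.snd _
    · exact contDiff_pi.1 contDiff_snd.fst.snd.snd.fst _
  · refine contDiff_pi.2 fun s => ?_
    induction s using Sym2.ind with | _ i k => ?_
    have h : ∀ i μ, ContDiff ℝ ∞ fun p : (Fin n → ℝ) × Inv2 n l => p.2.2.2.2 i μ := fun i μ =>
      contDiff_pi.1 (contDiff_pi.1 contDiff_snd.snd.snd.snd i) μ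
    rcases i with i | i <;> rcases k with k | k
    · exact contDiff_pi.1 contDiff_snd.snd.snd.fst _
    · exact h i k
    · exact h k i
    · exact contDiff_pi.1 contDiff_snd.snd.fst _

theorem contDiff_unpackJet : ContDiff ℝ ∞ (unpackJet : Jet2 (Fin n ⊕ Fin l) → Inv2 n l) := by
  refine ContDiff.prodMk (ContDiff.prodMk ?_ (ContDiff.prodMk (by fun_prop) (ContDiff.prodMk ?_ ?_)))
    (ContDiff.prodMk ?_ (ContDiff.prodMk ?_ ?_))
  · exact contDiff_pi.2 fun _ => contDiff_pi.1 contDiff_fst.fst _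
  · exact contDiff_pi.2 fun _ => contDiff_pi.1 contDiff_fst.snd.snd _
  · exact contDiff_pi.2 fun _ => contDiff_pi.1 contDiff_fst.snd.snd _
  · exact contDiff_pi.2 fun _ => contDiff_pi.1 contDiff_snd _
  · exact contDiff_pi.2 fun _ => contDiff_pi.1 contDiff_snd _
  · exact contDiff_pi.2 fun _ => contDiff_pi.2 fun _ => contDiff_pi.1 contDiff_snd _

/-- The fields `∂/∂y` commute with the right-invariant fields. -/
theorem lieD_etaField_yField (hκ : κ ∈ IsManifold.maximalAtlas 𝓘(ℝ, Fin n → ℝ) ∞ G)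
    {p : Fin n ⊕ Fin l → ℝ} (hp : xPart p ∈ κ.target) {v : (Fin n ⊕ Fin l → ℝ) → ℝ}
    (hv : ContDiffAt ℝ 2 v p) (i : Fin n) (μ : Fin l) :
    lieD (etaField κ β i) (lieD (yField μ) v) p = lieD (yField μ) (lieD (etaField κ β i) v) p := by
  have h1 : SmoothNear (etaField κ β i) p :=
    adaptedFrame_smoothNear (β := β) hκ hp (Sum.inl i)
  have h2 : HasFDerivAt (yField (n := n) μ) (0 : (Fin n ⊕ Fin l → ℝ) →L[ℝ] _) p :=
    hasFDerivAt_const _ _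
  rw [lieD_lieD hv h2.differentiableAt, lieD_lieD hv h1.differentiableAt, h2.fderiv,
    fderiv_fderiv_symm hv]
  have h3 : fderiv ℝ (etaField κ β i) p (yField μ p) = 0 := by
    rw [etaField_eq]
    have h4 := ((xInclL n l).hasFDerivAt.comp p
      ((rightComp_smoothNear hκ hp (β i)).differentiableAt.hasFDerivAt.comp p
        (xPartL n l).hasFDerivAt)).fderiv
    have h5 : xPartL n l (yField μ p) = 0 := by
      funext k
      simp [xPartL, yField, coordField]
    refine (congrArg (fun L => L (yField μ p)) h4).trans ?_
    simp [h5]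
  rw [h3]
  simp

/-- The mixed invariants are not symmetrized in `inv2`, but are in the frame jet. The two agree
because `∂/∂y` commutes with the right-invariant fields. -/
theorem inv2_eq_unpackJet (hκ : κ ∈ IsManifold.maximalAtlas 𝓘(ℝ, Fin n → ℝ) ∞ G)
    {p : Fin n ⊕ Fin l → ℝ} (hp : xPart p ∈ κ.target) {v : (Fin n ⊕ Fin l → ℝ) → ℝ}
    (hv : ContDiffAt ℝ 2 v p) :
    inv2 κ β v p = unpackJet (toFrame (adaptedFrame κ β) (jet2 v p)) := by
  rw [← frameJet_eq_toFrame hv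
    (fun s => (adaptedFrame_smoothNear (β := β) hκ hp s).differentiableAt)]
  refine Prod.ext rfl (Prod.ext ?_ (Prod.ext ?_ ?_))
  · funext s
    induction s using Sym2.ind with | _ i k => rfl
  · funext s
    induction s using Sym2.ind with | _ i k => rfl
  · funext i μ
    change _ = (lieD (etaField κ β i) (lieD (yField μ) v) p +
      lieD (yField μ) (lieD (etaField κ β i) v) p) / 2
    rw [lieD_etaField_yField hκ hp hv]
    simp [inv2]

/-- The right translation by `h` in the chart `κ`, acting on the independent variables `(x, y)`. -/
noncomputable def translateX (κ : OpenPartialHomeomorph G (Fin n → ℝ)) (h : G)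
    (p : Fin n ⊕ Fin l → ℝ) : Fin n ⊕ Fin l → ℝ :=
  Sum.elim (rightTranslation κ h (xPart p)) (yPart p)

theorem translateX_eq (h : G) (p : Fin n ⊕ Fin l → ℝ) : translateX κ h p =
    xInclL n l (rightTranslation κ h (xPartL n l p)) + (p - xInclL n l (xPartL n l p)) := by
  funext s
  cases s <;> simp [xInclL_apply, translateX, xPartL_apply, xPart, yPart]

theorem translateX_smoothNear (hκ : κ ∈ IsManifold.maximalAtlas 𝓘(ℝ, Fin n → ℝ) ∞ G) {h : G}
    {b : Fin n ⊕ Fin l → ℝ} (hb : xPart b ∈ κ.target) (hh : κ.symm (xPart b) * h ∈ κ.source) :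
    SmoothNear (translateX κ h) b := by
  have h1 := ((xInclL n l).contDiff.smoothNear _).comp
      ((rightTranslation_smoothNear hκ hb hh).comp ((xPartL n l).contDiff.smoothNear b))
  have h2 : ContDiff ℝ ∞ fun p => p - xInclL n l (xPartL n l p) :=
    contDiff_id.sub ((xInclL n l).contDiff.comp (xPartL n l).contDiff)
  filter_upwards [h1] with p hp
  rw [show translateX κ h = _ from funext (translateX_eq h)]
  exact hp.add h2.contDiffAt

theorem fderiv_translateX (hκ : κ ∈ IsManifold.maximalAtlas 𝓘(ℝ, Fin n → ℝ) ∞ G) {h : G}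
    {b : Fin n ⊕ Fin l → ℝ} (hb : xPart b ∈ κ.target) (hh : κ.symm (xPart b) * h ∈ κ.source)
    (X : Fin n ⊕ Fin l → ℝ) : fderiv ℝ (translateX κ h) b X =
      Sum.elim (fderiv ℝ (rightTranslation κ h) (xPart b) (xPart X)) (yPart X) := by
  have h1 : HasFDerivAt (rightTranslation κ h) _ (xPartL n l b) :=
    (rightTranslation_smoothNear hκ hb hh).differentiableAt.hasFDerivAt
  have h2 := ((xInclL n l).hasFDerivAt.comp b (h1.comp b (xPartL n l).hasFDerivAt)).add
    ((hasFDerivAt_id b).sub ((xInclL n l).hasFDerivAt.comp b (xPartL n l).hasFDerivAt))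
  rw [show translateX κ h = _ from funext (translateX_eq h)]
  refine (congrArg (fun L => L X) h2.fderiv).trans ?_
  funext s
  cases s <;> simp [xInclL_apply, xPartL_apply, xPart, yPart]

/-- Right translation of `x` preserves the right-invariant fields and does not touch `y`, so the
whole adapted frame is invariant and `frameJet_comp_eq` applies. -/
theorem inv2_eq_of_translateX (hκ : κ ∈ IsManifold.maximalAtlas 𝓘(ℝ, Fin n → ℝ) ∞ G) {h : G}
    {b : Fin n ⊕ Fin l → ℝ} (hb : xPart b ∈ κ.target) (hh : κ.symm (xPart b) * h ∈ κ.source)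
    {v v' : (Fin n ⊕ Fin l → ℝ) → ℝ} (hv' : SmoothNear v' (translateX κ h b))
    (hvv : ∀ᶠ x in 𝓝 b, v' (translateX κ h x) = v x) :
    inv2 κ β v b = inv2 κ β v' (translateX κ h b) := by
  have hs := translateX_smoothNear hκ hb hh
  have hc : ContinuousAt (xPart : (Fin n ⊕ Fin l → ℝ) → _) b := (xPartL n l).continuous.continuousAt
  have hr : ContinuousAt (fun y => κ.symm y * h) (xPart b) :=
    ((contMDiff_mul_right (I := 𝓘(ℝ, Fin n → ℝ)) (n := ∞) (a := h)).continuous.continuousAt).comp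
      (κ.symm.continuousAt hb)
  have hx : xPart (translateX κ h b) ∈ κ.target := κ.map_source hh
  have hinv : ∀ᶠ x in 𝓝 b, ∀ s, fderiv ℝ (translateX κ h) x (adaptedFrame κ β s x) =
      adaptedFrame κ β s (translateX κ h x) := by
    filter_upwards [hc.eventually ((κ.open_target.mem_nhds hb)),
      hc.eventually (hr.eventually (κ.open_source.mem_nhds hh))] with x hx hxh s
    rw [fderiv_translateX hκ hx hxh]
    cases s with
    | inl i =>
      have e : adaptedFrame κ β (Sum.inl i) x = Sum.elim (rightComp κ (β i) (xPart x)) 0 := rfl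
      have e' : xPart (adaptedFrame κ β (Sum.inl i) x) = rightComp κ (β i) (xPart x) := rfl
      rw [e', fderiv_rightTranslation hκ hx hxh]
      rfl
    | inr μ =>
      have e' : xPart (adaptedFrame κ β (Sum.inr μ) x) = 0 := by
        funext k
        simp [adaptedFrame, yField, coordField, xPart]
      rw [e', map_zero]
      funext s
      cases s <;> simp [adaptedFrame, yField, coordField, yPart]
  obtain ⟨h1, h2⟩ := frameJet_comp_eq hs.contDiffAt.continuousAt
    (hs.mono fun x hx => hx.differentiableAt (by simp)) hinv
    (fun s => adaptedFrame_smoothNear hκ hx s) hv' hvv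
  have h3 : ∀ s, lieD (adaptedFrame κ β s) v b =
    lieD (adaptedFrame κ β s) v' (translateX κ h b) := fun s => congrFun (congrArg Prod.snd h1) s
  refine Prod.ext (Prod.ext rfl (Prod.ext hvv.self_of_nhds.symm
    (Prod.ext (funext fun μ => h3 (Sum.inr μ)) (funext fun i => h3 (Sum.inl i)))))
    (Prod.ext ?_ (Prod.ext ?_ (funext fun i => funext fun μ => h2 (Sum.inr μ) (Sum.inl i))))
  · funext s
    induction s using Sym2.ind with | _ i k => ?_
    have e1 := h2 (Sum.inr i) (Sum.inr k)
    have e2 := h2 (Sum.inr k) (Sum.inr i)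
    exact congrArg (· / 2) (congrArg₂ (· + ·) e1 e2)
  · funext s
    induction s using Sym2.ind with | _ i k => ?_
    have e1 := h2 (Sum.inl i) (Sum.inl k)
    have e2 := h2 (Sum.inl k) (Sum.inl i)
    exact congrArg (· / 2) (congrArg₂ (· + ·) e1 e2)

end Group

/-! ## Local actions -/

namespace LocalAction

variable {n l : ℕ} {G : Type*} [Group G] [TopologicalSpace G] [ChartedSpace (Fin n → ℝ) G]
  [LieGroup 𝓘(ℝ, Fin n → ℝ) ∞ G]
  {E : Type*} [NormedAddCommGroup E] [NormedSpace ℝ E] {Z : Set E} (A : LocalAction n G Z)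

theorem contMDiffAt_act {z : E} {g : G} (h : (z, g) ∈ A.dom) :
    ContMDiffAt (𝓘(ℝ, E).prod 𝓘(ℝ, Fin n → ℝ)) 𝓘(ℝ, E) ∞
      (fun p : E × G => A.act p.1 p.2) (z, g) :=
  A.smooth.contMDiffAt (A.isOpen_dom.mem_nhds h)

theorem contMDiffAt_act_left {z : E} {g : G} (h : (z, g) ∈ A.dom) :
    ContMDiffAt 𝓘(ℝ, Fin n → ℝ) 𝓘(ℝ, E) ∞ (fun g => A.act z g) g :=
  ContMDiffAt.comp (f := fun g : G => (z, g)) g (A.contMDiffAt_act h)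
    (contMDiffAt_const.prodMk contMDiffAt_id)

theorem contDiffAt_act_right {z : E} {g : G} (h : (z, g) ∈ A.dom) :
    ContDiffAt ℝ ∞ (fun z => A.act z g) z :=
  (ContMDiffAt.comp (f := fun z : E => (z, g)) z (A.contMDiffAt_act h)
    (contMDiffAt_id.prodMk contMDiffAt_const)).contDiffAt

theorem isOpen_domAt (g : G) : IsOpen (A.domAt g) :=
  A.isOpen_dom.preimage (continuous_id.prodMk continuous_const)

theorem act_act_inv {z : E} {g : G} (h : (z, g) ∈ A.dom) : A.act (A.act z g) g⁻¹ = z := by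
  have hz := A.mem_space z g h
  have h1 := A.one_mem z hz
  rw [A.act_mul z g g⁻¹ h (A.inv_mem z g h) (by simpa using h1), mul_inv_cancel, A.act_one z hz]

/-- The transformation by `g`. -/
def transform (g : G) : OpenPartialHomeomorph E E where
  toFun z := A.act z g
  invFun z := A.act z g⁻¹
  source := A.domAt g
  target := A.domAt g⁻¹
  map_source' z hz := A.inv_mem z g hz
  map_target' z hz := by
    have := A.inv_mem z g⁻¹ hz
    rwa [inv_inv] at this
  left_inv' z hz := A.act_act_inv hz
  right_inv' z hz := by simpa using A.act_act_inv hz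
  open_source := A.isOpen_domAt g
  open_target := A.isOpen_domAt g⁻¹
  continuousOn_toFun z hz := (A.contDiffAt_act_right hz).continuousAt.continuousWithinAt
  continuousOn_invFun z hz := (A.contDiffAt_act_right hz).continuousAt.continuousWithinAt

theorem isDiffeo_transform (g : G) : IsDiffeo (A.transform g) where
  smooth _ hz := (A.contDiffAt_act_right hz).contDiffWithinAt
  smooth_symm _ hz := (A.contDiffAt_act_right hz).contDiffWithinAt

/-- Since `z·(g s) = (z·g)·s` for `s` near `1`, the orbit map sends left-invariant fields to
generators. -/
theorem derivOne_act {z : E} {g : G} (h : (z, g) ∈ A.dom)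
    (w : GroupLieAlgebra 𝓘(ℝ, Fin n → ℝ) G) :
    derivOne (fun s => A.act z (g * s)) w = A.generator w (A.act z g) := by
  have := topologicalGroup_of_lieGroup 𝓘(ℝ, Fin n → ℝ) ∞ (G := G)
  refine derivOne_congr ?_ w
  have h1 : ∀ᶠ s in 𝓝 (1 : G), (z, g * s) ∈ A.dom := by
    have hc : ContinuousAt (fun s : G => (z, g * s)) 1 :=
      continuousAt_const.prodMk (continuous_const_mul g).continuousAt
    exact hc.eventually (A.isOpen_dom.mem_nhds (by simpa using h))
  have h2 : ∀ᶠ s in 𝓝 (1 : G), (A.act z g, s) ∈ A.dom := by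
    have hc : ContinuousAt (fun s : G => (A.act z g, s)) 1 :=
      continuousAt_const.prodMk continuousAt_id
    exact hc.eventually (A.isOpen_dom.mem_nhds (A.one_mem _ (A.act_mem z g h)))
  filter_upwards [h1, h2] with s hs1 hs2
  exact (A.act_mul z g s h hs2 hs1).symm

theorem generator_smoothNear {z : E} (hz : z ∈ Z) (w : GroupLieAlgebra 𝓘(ℝ, Fin n → ℝ) G) :
    SmoothNear (A.generator w) z :=
  smoothNear_derivOne (H := fun z g => A.act z g) (by
    filter_upwards [A.isOpen_space.mem_nhds hz] with y hy
    exact A.contMDiffAt_act (A.one_mem y hy)) w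

/-- Let `γ` be a local integral curve of the left-invariant field of `w` with `γ 0 = 1`. Then `t ↦
z·γ(t)` is an integral curve of the generator starting at a zero of it, so it is constant by
uniqueness. Thus `γ` stays in the isotropy group of `z`, which is discrete, so `γ` is constant and
its velocity `w` is zero. -/
theorem eq_zero_of_generator_eq_zero (hfree : A.IsFree) {z : E} (hz : z ∈ Z)
    {w : GroupLieAlgebra 𝓘(ℝ, Fin n → ℝ) G} (hw : A.generator w z = 0) : w = 0 := by
  have : LieGroup 𝓘(ℝ, Fin n → ℝ) (minSmoothness ℝ 3) G := by
    rw [minSmoothness_of_isRCLikeNormedField]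
    infer_instance
  have hv : ContMDiffAt 𝓘(ℝ, Fin n → ℝ) (𝓘(ℝ, Fin n → ℝ).tangent) 1
      (fun g : G => (mulInvariantVectorField w g : TangentBundle 𝓘(ℝ, Fin n → ℝ) G)) 1 :=
    (contMDiff_mulInvariantVectorField w).contMDiffAt.of_le (by
      rw [minSmoothness_of_isRCLikeNormedField]
      norm_num)
  have hsmul : ∀ v : Fin n → ℝ, ((1 : ℝ →L[ℝ] ℝ).smulRight v) 1 = v := by simp
  obtain ⟨γ, hγ0, hγ⟩ := exists_isMIntegralCurveAt_of_contMDiffAt_boundaryless 0 hv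
  have hγ0' := hγ.self_of_nhds
  have hγc : ContinuousAt γ 0 := hγ0'.continuousAt
  have hdom : ∀ᶠ t in 𝓝 (0 : ℝ), (z, γ t) ∈ A.dom := by
    have hc : ContinuousAt (fun t => (z, γ t)) 0 := continuousAt_const.prodMk hγc
    exact hc.eventually (A.isOpen_dom.mem_nhds (by simpa [hγ0] using A.one_mem z hz))
  have hδ : ∀ᶠ t in 𝓝 (0 : ℝ), HasDerivAt (fun t => A.act z (γ t))
      (A.generator w (A.act z (γ t))) t := by
    filter_upwards [hγ, hdom] with t ht htd
    let L : (Fin n → ℝ) →L[ℝ] E :=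
      mfderiv 𝓘(ℝ, Fin n → ℝ) 𝓘(ℝ, E) (fun g => A.act z g) (γ t)
    let M : ℝ →L[ℝ] (Fin n → ℝ) :=
      (1 : ℝ →L[ℝ] ℝ).smulRight (mulInvariantVectorField w (γ t) : Fin n → ℝ)
    have h1 : HasMFDerivAt 𝓘(ℝ, ℝ) 𝓘(ℝ, E) (fun t => A.act z (γ t)) t (L.comp M) :=
      ((A.contMDiffAt_act_left htd).mdifferentiableAt (by simp)).hasMFDerivAt.comp t ht
    have h2 : HasFDerivAt (fun t => A.act z (γ t)) (L.comp M) t :=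
      hasMFDerivAt_iff_hasFDerivAt.1 h1
    refine h2.hasDerivAt.congr_deriv ?_
    rw [← A.derivOne_act htd]
    have e1 : MDifferentiableAt 𝓘(ℝ, Fin n → ℝ) 𝓘(ℝ, E) (fun g => A.act z g) (γ t * 1) := by
      rw [mul_one]
      exact (A.contMDiffAt_act_left htd).mdifferentiableAt (by simp)
    have e2 : MDifferentiableAt 𝓘(ℝ, Fin n → ℝ) 𝓘(ℝ, Fin n → ℝ) (fun s => γ t * s) (1 : G) :=
      (contMDiff_mul_left (n := ∞) (a := γ t)).contMDiffAt.mdifferentiableAt (by simp)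
    have e3 := mfderiv_comp (1 : G) e1 e2
    rw [mul_one] at e3
    refine Eq.trans ?_ (congrArg (fun L => L w) e3).symm
    exact congrArg L (hsmul _)
  -- Uniqueness needs the generator to be Lipschitz near `z`, which follows from its being `C¹`.
  obtain ⟨K, s, hs, hK⟩ := ((A.generator_smoothNear hz w).contDiffAt.of_le
    (m := 1) (by simp)).exists_lipschitzOnWith
  have hcδ : ContinuousAt (fun t => A.act z (γ t)) 0 := hδ.self_of_nhds.continuousAt
  have h0 : A.act z (γ 0) = z := by rw [hγ0, A.act_one z hz]
  have heq : (fun t => A.act z (γ t)) =ᶠ[𝓝 0] fun _ => z := by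
    refine ODE_solution_unique_of_eventually (v := fun _ => A.generator w) (s := fun _ => s)
      (K := K) (Eventually.of_forall fun _ => hK) ?_ ?_ h0
    · exact hδ.and (hcδ.eventually (show s ∈ 𝓝 (A.act z (γ 0)) by rw [h0]; exact hs))
    · exact Eventually.of_forall fun t => ⟨by rw [hw]; exact hasDerivAt_const _ _,
        mem_of_mem_nhds hs⟩
  have hγ1 : γ =ᶠ[𝓝 0] fun _ => (1 : G) := by
    have hf := hfree z hz
    rw [← hγ0] at hf
    filter_upwards [heq, hγc.eventually hf] with t h1 h2
    have h3 := h2 h1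
    rw [h3, hγ0]
  have h4 := hγ0'.mfderiv
  rw [hγ1.mfderiv_eq, mfderiv_const] at h4
  have h5 := congrArg (fun L : ℝ →L[ℝ] (Fin n → ℝ) => L 1) h4
  have h6 : mulInvariantVectorField w (γ 0) = 0 := (hsmul _).symm.trans h5.symm
  rw [hγ0] at h6
  have h1 : (1 : G) ∈ (chartAt (Fin n → ℝ) (1 : G)).source := mem_chart_source _ _
  refine leftComp_eq_zero (IsManifold.chart_mem_maximalAtlas (1 : G))
    ((chartAt (Fin n → ℝ) (1 : G)).map_source h1) ?_
  unfold leftComp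
  rw [OpenPartialHomeomorph.left_inv _ h1, h6]
  exact map_zero _

variable {A} {κ : OpenPartialHomeomorph G (Fin n → ℝ)}
  {φ : OpenPartialHomeomorph E ((Fin n ⊕ Fin l → ℝ) × ℝ)}

theorem _root_.IsAdaptedChart.isDiffeo (hφ : IsAdaptedChart A κ φ) : IsDiffeo φ :=
  ⟨hφ.smooth, hφ.smooth_symm⟩

theorem contMDiffAt_translateX (hκ : κ ∈ IsManifold.maximalAtlas 𝓘(ℝ, Fin n → ℝ) ∞ G)
    {p : (Fin n ⊕ Fin l → ℝ) × ℝ} {h : G} (hp : xPart p.1 ∈ κ.target)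
    (hh : κ.symm (xPart p.1) * h ∈ κ.source) :
    ContMDiffAt (𝓘(ℝ, (Fin n ⊕ Fin l → ℝ) × ℝ).prod 𝓘(ℝ, Fin n → ℝ))
      𝓘(ℝ, (Fin n ⊕ Fin l → ℝ) × ℝ) ∞
      (fun q : ((Fin n ⊕ Fin l → ℝ) × ℝ) × G => (translateX κ q.2 q.1.1, q.1.2)) (p, h) := by
  let L : (Fin n ⊕ Fin l → ℝ) × ℝ →L[ℝ] (Fin n → ℝ) :=
    (xPartL n l).comp (ContinuousLinearMap.fst ℝ _ _)
  have h1 : ContMDiffAt (𝓘(ℝ, (Fin n ⊕ Fin l → ℝ) × ℝ).prod 𝓘(ℝ, Fin n → ℝ))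
      𝓘(ℝ, Fin n → ℝ) ∞ (fun q : ((Fin n ⊕ Fin l → ℝ) × ℝ) × G => L q.1) (p, h) :=
    ContMDiffAt.comp (p, h) L.contDiff.contMDiff.contMDiffAt contMDiffAt_fst
  have h2 : ContMDiffAt (𝓘(ℝ, (Fin n ⊕ Fin l → ℝ) × ℝ).prod 𝓘(ℝ, Fin n → ℝ))
      𝓘(ℝ, Fin n → ℝ) ∞ (fun q : ((Fin n ⊕ Fin l → ℝ) × ℝ) × G => κ (κ.symm (L q.1) * q.2))
      (p, h) := by
    refine ContMDiffAt.comp (g := κ) (f := fun q : ((Fin n ⊕ Fin l → ℝ) × ℝ) × G =>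
      κ.symm (L q.1) * q.2) (p, h) (contMDiffAt_chart hκ hh) ?_
    exact (ContMDiffAt.comp (g := κ.symm) (f := fun q : ((Fin n ⊕ Fin l → ℝ) × ℝ) × G => L q.1)
      (p, h) (contMDiffAt_chart_symm hκ hp) h1).mul contMDiffAt_snd
  have h3 : ContDiff ℝ ∞ fun r : (Fin n → ℝ) × ((Fin n ⊕ Fin l → ℝ) × ℝ) =>
      ((xInclL n l r.1 + (r.2.1 - xInclL n l (xPartL n l r.2.1)), r.2.2) :
        (Fin n ⊕ Fin l → ℝ) × ℝ) := by
    fun_prop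
  have h4 := ContMDiffAt.comp (p, h) h3.contMDiff.contMDiffAt (h2.prodMk_space contMDiffAt_fst)
  refine h4.congr_of_eventuallyEq (Eventually.of_forall fun q => ?_)
  simp only [translateX_eq, Function.comp]
  rfl

end LocalAction

/-! ## The action in adapted coordinates -/

namespace LocalAction

variable {n l : ℕ} {G : Type*} [Group G] [TopologicalSpace G] [ChartedSpace (Fin n → ℝ) G]
  [LieGroup 𝓘(ℝ, Fin n → ℝ) ∞ G]
  {E : Type*} [NormedAddCommGroup E] [NormedSpace ℝ E] {Z : Set E} {A : LocalAction n G Z}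
  {κ : OpenPartialHomeomorph G (Fin n → ℝ)}
  {φ : OpenPartialHomeomorph E ((Fin n ⊕ Fin l → ℝ) × ℝ)}

/-- The coordinates of `z · g`, translated back by `g⁻¹`. -/
noncomputable def backTranslate (A : LocalAction n G Z) (κ : OpenPartialHomeomorph G (Fin n → ℝ))
    (φ : OpenPartialHomeomorph E ((Fin n ⊕ Fin l → ℝ) × ℝ)) (z : E) (g : G) :
    (Fin n ⊕ Fin l → ℝ) × ℝ :=
  (translateX κ g⁻¹ (φ (A.act z g)).1, (φ (A.act z g)).2)

theorem contMDiffAt_chart_act (hφ : IsAdaptedChart A κ φ) {z : E} {g : G} (h : (z, g) ∈ A.dom)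
    (hs : A.act z g ∈ φ.source) :
    ContMDiffAt 𝓘(ℝ, Fin n → ℝ) 𝓘(ℝ, (Fin n ⊕ Fin l → ℝ) × ℝ) ∞ (fun g => φ (A.act z g)) g :=
  ContMDiffAt.comp (g := φ) g (hφ.isDiffeo.smoothNear hs).contDiffAt.contMDiffAt
    (A.contMDiffAt_act_left h)

theorem contMDiffAt_backTranslate (hφ : IsAdaptedChart A κ φ) {z : E} {g : G} (h : (z, g) ∈ A.dom)
    (hs : A.act z g ∈ φ.source) (hg : κ.symm (xPart (φ (A.act z g)).1) * g⁻¹ ∈ κ.source) :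
    ContMDiffAt 𝓘(ℝ, Fin n → ℝ) 𝓘(ℝ, (Fin n ⊕ Fin l → ℝ) × ℝ) ∞ (backTranslate A κ φ z) g := by
  have h1 : ContMDiffAt 𝓘(ℝ, Fin n → ℝ) 𝓘(ℝ, Fin n → ℝ) ∞ (fun g : G => g⁻¹) g :=
    (contMDiff_inv 𝓘(ℝ, Fin n → ℝ) ∞).contMDiffAt
  exact ContMDiffAt.comp (f := fun g => (φ (A.act z g), g⁻¹)) g
    (contMDiffAt_translateX hφ.chart_mem (hφ.x_mem _ hs) hg)
    ((contMDiffAt_chart_act hφ h hs).prodMk h1)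

/-- With `p = φ (z·g)`, the curve `s ↦ φ (z·(g s))` has at `s = 1` the velocity of the
left-invariant field, which is also that of the translation of `p` by `s`. After this replacement
the expression is constant, because `(x s)(s⁻¹ g⁻¹) = x g⁻¹`. -/
theorem derivOne_backTranslate (hφ : IsAdaptedChart A κ φ) {z : E} {g : G} (h : (z, g) ∈ A.dom)
    (hs : A.act z g ∈ φ.source) (hg : κ.symm (xPart (φ (A.act z g)).1) * g⁻¹ ∈ κ.source)
    (w : GroupLieAlgebra 𝓘(ℝ, Fin n → ℝ) G) :
    derivOne (fun s => backTranslate A κ φ z (g * s)) w = 0 := by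
  have := topologicalGroup_of_lieGroup 𝓘(ℝ, Fin n → ℝ) ∞ (G := G)
  set p := φ (A.act z g) with hp
  have hx : xPart p.1 ∈ κ.target := hφ.x_mem _ hs
  have hxs : κ.symm (xPart p.1) * 1 ∈ κ.source := by simpa using κ.map_target hx
  let N : ((Fin n ⊕ Fin l → ℝ) × ℝ) × G → (Fin n ⊕ Fin l → ℝ) × ℝ :=
    fun q => (translateX κ (q.2⁻¹ * g⁻¹) q.1.1, q.1.2)
  let θ : G → (Fin n ⊕ Fin l → ℝ) × ℝ := fun s => φ (A.act z (g * s))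
  let θ' : G → (Fin n ⊕ Fin l → ℝ) × ℝ := fun s => (translateX κ s p.1, p.2)
  have hθ1 : θ 1 = p := by simp [θ, hp]
  have hθ'1 : θ' 1 = p := by
    refine Prod.ext ?_ rfl
    simp only [θ', translateX, rightTranslation, mul_one]
    rw [κ.right_inv hx]
    funext s
    cases s <;> rfl
  have hmul : ContMDiffAt 𝓘(ℝ, Fin n → ℝ) 𝓘(ℝ, Fin n → ℝ) ∞ (fun s => g * s) (1 : G) :=
    (contMDiff_mul_left (a := g)).contMDiffAt
  have hθ : MDifferentiableAt 𝓘(ℝ, Fin n → ℝ) 𝓘(ℝ, (Fin n ⊕ Fin l → ℝ) × ℝ) θ 1 := by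
    refine (ContMDiffAt.comp (g := fun g => φ (A.act z g)) (f := fun s => g * s) (1 : G)
      (contMDiffAt_chart_act hφ ?_ ?_) hmul).mdifferentiableAt (by simp)
    · simpa using h
    · simpa using hs
  have hθ' : MDifferentiableAt 𝓘(ℝ, Fin n → ℝ) 𝓘(ℝ, (Fin n ⊕ Fin l → ℝ) × ℝ) θ' 1 :=
    (ContMDiffAt.comp (f := fun s : G => (p, s)) (1 : G)
      (contMDiffAt_translateX hφ.chart_mem hx hxs)
      (contMDiffAt_const.prodMk contMDiffAt_id)).mdifferentiableAt (by simp)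
  have hN : MDifferentiableAt (𝓘(ℝ, (Fin n ⊕ Fin l → ℝ) × ℝ).prod 𝓘(ℝ, Fin n → ℝ))
      𝓘(ℝ, (Fin n ⊕ Fin l → ℝ) × ℝ) N (θ 1, 1) := by
    rw [hθ1]
    have e : ContMDiffAt (𝓘(ℝ, (Fin n ⊕ Fin l → ℝ) × ℝ).prod 𝓘(ℝ, Fin n → ℝ))
        (𝓘(ℝ, (Fin n ⊕ Fin l → ℝ) × ℝ).prod 𝓘(ℝ, Fin n → ℝ)) ∞
        (fun q : ((Fin n ⊕ Fin l → ℝ) × ℝ) × G => (q.1, q.2⁻¹ * g⁻¹)) (p, 1) :=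
      contMDiffAt_fst.prodMk (contMDiffAt_snd.inv.mul contMDiffAt_const)
    refine (ContMDiffAt.comp (p, (1 : G)) (contMDiffAt_translateX hφ.chart_mem hx ?_)
      e).mdifferentiableAt (by simp)
    simpa using hg
  have hd : derivOne θ w = derivOne θ' w := by
    have e1 : derivOne θ w = fderiv ℝ φ (A.act z g) (A.generator w (A.act z g)) := by
      rw [← A.derivOne_act h]
      have := derivOne_comp (k := φ) (h := fun s => A.act z (g * s)) (w := w)
        (by rw [mul_one]; exact (hφ.isDiffeo.smoothNear hs).differentiableAt)
        ((ContMDiffAt.comp (g := fun g => A.act z g) (f := fun s => g * s) (1 : G)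
          (A.contMDiffAt_act_left (by simpa using h)) hmul).mdifferentiableAt (by simp))
      rw [mul_one] at this
      exact this
    let L : (Fin n → ℝ) → (Fin n ⊕ Fin l → ℝ) × ℝ := fun x =>
      (xInclL n l x + (p.1 - xInclL n l (xPartL n l p.1)), p.2)
    have hL : ∀ x, HasFDerivAt L ((xInclL n l).prod 0) x := fun x =>
      ((xInclL n l).hasFDerivAt.add_const _).prodMk (hasFDerivAt_const _ _)
    have e2 : derivOne θ' w = ((xInclL n l).prod 0) (leftComp κ w (xPart p.1)) := by
      rw [leftComp_eq hφ.chart_mem hx]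
      have := derivOne_comp (k := L) (h := fun s => κ (κ.symm (xPart p.1) * s)) (w := w)
        (hL _).differentiableAt
        ((contMDiffAt_left_chart hφ.chart_mem hxs).mdifferentiableAt (by simp))
      rw [(hL _).fderiv] at this
      rw [← this]
      congr 1
      funext s
      simp only [θ', L, translateX_eq]
      rfl
    rw [e1, e2, hφ.generator_eq _ hs]
    simp [xInclL_apply, hp]
  have hkey := derivOne_prod_congr (hθ1.trans hθ'1.symm) hN hθ hθ' w hd
  have e3 : (fun s => backTranslate A κ φ z (g * s)) = fun s => N (θ s, s) := by
    funext s
    simp [N, θ, backTranslate]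
  rw [e3, hkey, ← derivOne_const (G := G) (translateX κ g⁻¹ p.1, p.2) w]
  refine derivOne_congr ?_ w
  have hev : ∀ᶠ s in 𝓝 (1 : G), κ.symm (xPart p.1) * s ∈ κ.source :=
    (continuous_const_mul (κ.symm (xPart p.1))).continuousAt.eventually
      (κ.open_source.mem_nhds hxs)
  filter_upwards [hev] with s hs'
  refine Prod.ext ?_ rfl
  change Sum.elim (κ (κ.symm (κ (κ.symm (xPart p.1) * s)) * (s⁻¹ * g⁻¹))) (yPart p.1) =
    Sum.elim (κ (κ.symm (xPart p.1) * g⁻¹)) (yPart p.1)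
  rw [κ.left_inv hs']
  congr 2
  group

/-- Near the identity, the group acts in adapted coordinates by right translations of `x`. -/
theorem eventually_chart_act_eq (hφ : IsAdaptedChart A κ φ) {z : E} (hz : z ∈ φ.source) :
    ∀ᶠ r : G × E in 𝓝 (1, z), (r.2, r.1) ∈ A.dom ∧ r.2 ∈ φ.source ∧
      A.act r.2 r.1 ∈ φ.source ∧ κ.symm (xPart (φ r.2).1) * r.1 ∈ κ.source ∧
      φ (A.act r.2 r.1) = (translateX κ r.1 (φ r.2).1, (φ r.2).2) := by
  have := topologicalGroup_of_lieGroup 𝓘(ℝ, Fin n → ℝ) ∞ (G := G)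
  have hzZ := hφ.source_subset hz
  have hdom := A.one_mem z hzZ
  have c1 : ContinuousAt (fun r : G × E => A.act r.2 r.1) (1, z) :=
    ContinuousAt.comp (g := fun p : E × G => A.act p.1 p.2) (f := fun r : G × E => (r.2, r.1))
      (A.contMDiffAt_act hdom).continuousAt (by fun_prop)
  have hz1 : A.act z 1 ∈ φ.source := by rwa [A.act_one z hzZ]
  have hx : xPart (φ z).1 ∈ κ.target := hφ.x_mem z hz
  have hk : ContinuousAt (fun q : (Fin n ⊕ Fin l → ℝ) × ℝ => κ.symm (xPart q.1)) (φ z) :=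
    ContinuousAt.comp (g := κ.symm) (f := fun q : (Fin n ⊕ Fin l → ℝ) × ℝ => xPart q.1)
      (κ.symm.continuousAt hx) ((xPartL n l).continuous.comp continuous_fst).continuousAt
  have hφc := φ.continuousAt hz
  have c2 : ContinuousAt (fun r : G × E => φ (A.act r.2 r.1)) (1, z) :=
    ContinuousAt.comp (g := φ) (φ.continuousAt hz1) c1
  have c3 : ContinuousAt (fun r : G × E => κ.symm (xPart (φ (A.act r.2 r.1)).1) * r.1⁻¹) (1, z) := by
    refine ContinuousAt.mul (ContinuousAt.comp
      (g := fun q : (Fin n ⊕ Fin l → ℝ) × ℝ => κ.symm (xPart q.1)) ?_ c2)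
      continuousAt_fst.inv
    simpa only [A.act_one z hzZ] using hk
  have c4 : ContinuousAt (fun r : G × E => κ.symm (xPart (φ r.2).1) * r.1) (1, z) := by
    refine ContinuousAt.mul (ContinuousAt.comp
      (g := fun q : (Fin n ⊕ Fin l → ℝ) × ℝ => κ.symm (xPart q.1)) (f := fun r : G × E => φ r.2)
      hk ?_) continuousAt_fst
    exact ContinuousAt.comp (g := φ) (f := fun r : G × E => r.2) hφc continuousAt_snd
  have hgood : ∀ᶠ r : G × E in 𝓝 (1, z), (r.2, r.1) ∈ A.dom ∧ r.2 ∈ φ.source ∧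
      A.act r.2 r.1 ∈ φ.source ∧ κ.symm (xPart (φ r.2).1) * r.1 ∈ κ.source ∧
      κ.symm (xPart (φ (A.act r.2 r.1)).1) * r.1⁻¹ ∈ κ.source := by
    have d1 : ContinuousAt (fun r : G × E => (r.2, r.1)) (1, z) := by fun_prop
    have hks := κ.map_target hx
    filter_upwards [d1.eventually (A.isOpen_dom.mem_nhds hdom),
      continuousAt_snd.eventually (φ.open_source.mem_nhds hz),
      c1.eventually (φ.open_source.mem_nhds hz1),
      c4.eventually (κ.open_source.mem_nhds (by simpa using hks)),
      c3.eventually (κ.open_source.mem_nhds (by simpa [A.act_one z hzZ] using hks))]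
      with r h1 h2 h3 h4 h5 using ⟨h1, h2, h3, h4, h5⟩
  -- A product neighbourhood lets one ball of group elements serve for all points near `z`. The ball
  -- is taken in a chart at `1`, where it is convex and vanishing derivative implies constancy.
  obtain ⟨U, hU, W, hW, hUW⟩ := mem_nhds_prod_iff.1 hgood
  set κ₁ := chartAt (Fin n → ℝ) (1 : G)
  have hκ₁ : κ₁ ∈ IsManifold.maximalAtlas 𝓘(ℝ, Fin n → ℝ) ∞ G :=
    IsManifold.chart_mem_maximalAtlas 1
  have h1 : (1 : G) ∈ κ₁.source := mem_chart_source _ _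
  have hB : ∀ᶠ y in 𝓝 (κ₁ 1), y ∈ κ₁.target ∧ κ₁.symm y ∈ U := by
    refine Filter.Eventually.and (κ₁.open_target.mem_nhds (κ₁.map_source h1)) ?_
    refine (κ₁.symm.continuousAt (κ₁.map_source h1)).eventually ?_
    change U ∈ 𝓝 (κ₁.symm (κ₁ 1))
    rwa [κ₁.left_inv h1]
  obtain ⟨ε, hε, hball⟩ := Metric.eventually_nhds_iff_ball.1 hB
  have hU' : ∀ᶠ g in 𝓝 (1 : G), g ∈ κ₁.source ∧ κ₁ g ∈ Metric.ball (κ₁ 1) ε :=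
    Filter.Eventually.and (κ₁.open_source.mem_nhds h1)
      ((κ₁.continuousAt h1).eventually (Metric.ball_mem_nhds _ hε))
  -- The derivative vanishes along every left-invariant field, and these span all directions. So the
  -- value is that at `g = 1`, which is `φ z'`.
  have hconst : ∀ z' ∈ W, ∀ g, g ∈ κ₁.source → κ₁ g ∈ Metric.ball (κ₁ 1) ε →
      backTranslate A κ φ z' g = φ z' := by
    intro z' hz' g hg hgB
    have hg' : ∀ y ∈ Metric.ball (κ₁ 1) ε, ContMDiffAt 𝓘(ℝ, Fin n → ℝ)
        𝓘(ℝ, (Fin n ⊕ Fin l → ℝ) × ℝ) ∞ (backTranslate A κ φ z') (κ₁.symm y) := by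
      intro y hy
      obtain ⟨e1, e2, e3, e4, e5⟩ := hUW (mk_mem_prod (hball y hy).2 hz')
      exact contMDiffAt_backTranslate hφ e1 e3 e5
    have hdiff : ∀ y ∈ Metric.ball (κ₁ 1) ε,
        DifferentiableAt ℝ (backTranslate A κ φ z' ∘ κ₁.symm) y := by
      intro y hy
      have := ContMDiffAt.comp y (hg' y hy) (contMDiffAt_chart_symm hκ₁ (hball y hy).1)
      exact this.contDiffAt.differentiableAt (by simp)
    have hzero : ∀ y ∈ Metric.ball (κ₁ 1) ε,
        fderiv ℝ (backTranslate A κ φ z' ∘ κ₁.symm) y = 0 := by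
      intro y hy
      obtain ⟨e1, e2, e3, e4, e5⟩ := hUW (mk_mem_prod (hball y hy).2 hz')
      ext1 X
      obtain ⟨w, rfl⟩ := leftComp_surjective hκ₁ (hball y hy).1 X
      have hys : κ₁.symm y * 1 ∈ κ₁.source := by simpa using κ₁.map_target (hball y hy).1
      have e : κ₁ (κ₁.symm y * 1) = y := by rw [mul_one, κ₁.right_inv (hball y hy).1]
      have h2 := derivOne_comp (k := backTranslate A κ φ z' ∘ κ₁.symm)
        (h := fun s => κ₁ (κ₁.symm y * s)) (w := w) (by rw [e]; exact hdiff y hy)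
        ((contMDiffAt_left_chart hκ₁ hys).mdifferentiableAt (by simp))
      rw [e, ← leftComp_eq hκ₁ (hball y hy).1] at h2
      rw [← h2]
      refine Eq.trans ?_ (derivOne_backTranslate hφ e1 e3 e5 w)
      refine derivOne_congr ?_ w
      have hev : ∀ᶠ s in 𝓝 (1 : G), κ₁.symm y * s ∈ κ₁.source :=
        (continuous_const_mul (κ₁.symm y)).continuousAt.eventually (κ₁.open_source.mem_nhds hys)
      filter_upwards [hev] with s hs
      simp [κ₁.left_inv hs]
    have hc := Metric.isOpen_ball.is_const_of_fderiv_eq_zero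
      ((convex_ball (κ₁ 1) ε).isPreconnected)
      (fun y hy => (hdiff y hy).differentiableWithinAt) (fun y hy => hzero y hy) hgB
      (Metric.mem_ball_self hε)
    simp only [Function.comp, κ₁.left_inv hg, κ₁.left_inv h1] at hc
    rw [hc]
    obtain ⟨e1, e2, e3, e4, e5⟩ := hUW (mk_mem_prod (mem_of_mem_nhds hU) hz')
    have hz'Z := hφ.source_subset e2
    refine Prod.ext ?_ ?_
    · simp only [backTranslate, A.act_one z' hz'Z, translateX, rightTranslation, inv_one, mul_one]
      rw [κ.right_inv (hφ.x_mem z' e2)]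
      funext s
      cases s <;> rfl
    · simp only [backTranslate, A.act_one z' hz'Z]
  rw [nhds_prod_eq]
  filter_upwards [prod_mem_prod (hU'.and hU) hW] with r hr
  obtain ⟨⟨⟨hr1, hr2⟩, hr3⟩, hr4⟩ := hr
  obtain ⟨e1, e2, e3, e4, e5⟩ := hUW (mk_mem_prod hr3 hr4)
  refine ⟨e1, e2, e3, e4, ?_⟩
  have hb := hconst r.2 hr4 r.1 hr1 hr2
  rw [← hb]
  refine Prod.ext ?_ rfl
  change _ = Sum.elim (κ (κ.symm (κ (κ.symm (xPart (φ (A.act r.2 r.1)).1) * r.1⁻¹)) * r.1))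
    (yPart (φ (A.act r.2 r.1)).1)
  rw [κ.left_inv e5, inv_mul_cancel_right, κ.right_inv (hφ.x_mem _ e3)]
  funext s
  cases s <;> rfl

end LocalAction

/-! ## Existence of adapted coordinates -/

/-- A vector space is not the union of two proper subspaces, here `V` and the kernel of `m`. -/
theorem exists_notMem_and_apply_ne_zero {E : Type*} [AddCommGroup E] [Module ℝ E]
    {V : Submodule ℝ E} (hV : V ≠ ⊤) {m : E →ₗ[ℝ] ℝ} (hm : m ≠ 0) : ∃ e, e ∉ V ∧ m e ≠ 0 := by
  obtain ⟨a, ha⟩ : ∃ a, a ∉ V := by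
    by_contra! h
    exact hV (eq_top_iff.2 fun x _ => h x)
  obtain ⟨b, hb⟩ : ∃ b, m b ≠ 0 := by
    by_contra! h
    exact hm (LinearMap.ext h)
  by_cases h1 : m a = 0
  · by_cases h2 : b ∈ V
    · refine ⟨a + b, fun h => ha ?_, by simpa [h1] using hb⟩
      simpa using V.sub_mem h h2
    · exact ⟨b, h2, hb⟩
  · exact ⟨a, ha, h1⟩

/-- A subspace of dimension `n` in a space of dimension `n + l + 1` has a complement spanned by `l`
vectors and a vector on which a given linear form does not vanish. -/
theorem exists_complement {n l : ℕ} {E : Type*} [AddCommGroup E] [Module ℝ E]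
    [FiniteDimensional ℝ E] (hE : Module.finrank ℝ E = n + l + 1) {V : Submodule ℝ E}
    (hV : Module.finrank ℝ V = n) {m : E →ₗ[ℝ] ℝ} (hm : m ≠ 0) :
    ∃ (J : (Fin l → ℝ) →ₗ[ℝ] E) (e : E), m e ≠ 0 ∧
      ∀ v ∈ V, ∀ (y : Fin l → ℝ) (u : ℝ), v + J y + u • e = 0 → v = 0 ∧ y = 0 ∧ u = 0 := by
  have hVt : V ≠ ⊤ := by
    rintro rfl
    rw [finrank_top] at hV
    omega
  obtain ⟨e, he, hme⟩ := exists_notMem_and_apply_ne_zero hVt hm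
  have hdisj : Disjoint V (Submodule.span ℝ {e}) := by
    rw [Submodule.disjoint_span_singleton]
    intro h
    exact absurd h he
  have hV' : Module.finrank ℝ (V ⊔ Submodule.span ℝ {e} : Submodule ℝ E) = n + 1 := by
    have h1 := Submodule.finrank_sup_add_finrank_inf_eq V (Submodule.span ℝ {e})
    rw [hdisj.eq_bot, finrank_bot, hV, finrank_span_singleton (fun h => he (by
      rw [h]; exact V.zero_mem))] at h1
    simpa using h1
  obtain ⟨C, hC⟩ := Submodule.exists_isCompl (V ⊔ Submodule.span ℝ {e})
  have hCl : Module.finrank ℝ (Fin l → ℝ) = Module.finrank ℝ C := by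
    have := Submodule.finrank_add_eq_of_isCompl hC
    rw [Module.finrank_fin_fun]
    omega
  refine ⟨C.subtype ∘ₗ (LinearEquiv.ofFinrankEq _ _ hCl).toLinearMap, e, hme, ?_⟩
  intro v hv y u h
  set c : C := LinearEquiv.ofFinrankEq _ _ hCl y with hc
  have h' : v + u • e + (c : E) = 0 := by
    rw [← h]
    simp [hc]
    abel
  have hmem : v + u • e ∈ V ⊔ Submodule.span ℝ {e} :=
    Submodule.add_mem_sup hv (Submodule.smul_mem _ _ (Submodule.mem_span_singleton_self e))
  have hc0 : (c : E) = 0 := by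
    have h2 : (c : E) = -(v + u • e) := (neg_eq_of_add_eq_zero_right h').symm
    exact (Submodule.disjoint_def.1 hC.disjoint) _ (h2 ▸ Submodule.neg_mem _ hmem) c.2
  rw [hc0, add_zero] at h'
  have hu : u = 0 := by
    by_contra hu
    apply he
    have : e = -(u⁻¹ • v) := by
      have h3 : u • e = -v := (neg_eq_of_add_eq_zero_right h').symm
      rw [← inv_smul_smul₀ hu e, h3, smul_neg]
    rw [this]
    exact V.neg_mem (V.smul_mem _ hv)
  refine ⟨by simpa [hu] using h', ?_, hu⟩
  have : c = 0 := Subtype.ext hc0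
  rw [hc] at this
  simpa using this

namespace LocalAction

variable {n l : ℕ} {G : Type*} [Group G] [TopologicalSpace G] [ChartedSpace (Fin n → ℝ) G]
  [LieGroup 𝓘(ℝ, Fin n → ℝ) ∞ G]
  {E : Type*} [NormedAddCommGroup E] [NormedSpace ℝ E] {Z : Set E} {A : LocalAction n G Z}

/-- The generators at `z` as a linear map. -/
noncomputable def generatorL (A : LocalAction n G Z) (z : E) : (Fin n → ℝ) →ₗ[ℝ] E :=
  ContinuousLinearMap.toLinearMap
    (mfderiv 𝓘(ℝ, Fin n → ℝ) 𝓘(ℝ, E) (fun g => A.act z g) (1 : G) : (Fin n → ℝ) →L[ℝ] E)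

/-- The map `(x, y, u) ↦ (z₀ + J y + u e) · g(x)`. -/
def sliceMap (A : LocalAction n G Z) (κ : OpenPartialHomeomorph G (Fin n → ℝ)) (z₀ : E)
    (J : (Fin l → ℝ) →L[ℝ] E) (e : E) (q : (Fin n ⊕ Fin l → ℝ) × ℝ) : E :=
  A.act (z₀ + J (yPart q.1) + q.2 • e) (κ.symm (xPart q.1))

variable {κ : OpenPartialHomeomorph G (Fin n → ℝ)} {z₀ e : E} {J : (Fin l → ℝ) →L[ℝ] E}

/-- The projection `(x, y) ↦ y` as a linear map. -/
def yPartL (n l : ℕ) : (Fin n ⊕ Fin l → ℝ) →L[ℝ] (Fin l → ℝ) :=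
  ContinuousLinearMap.pi fun i => ContinuousLinearMap.proj (Sum.inr i)

theorem contDiffAt_sliceMap (hκ : κ ∈ IsManifold.maximalAtlas 𝓘(ℝ, Fin n → ℝ) ∞ G)
    {q : (Fin n ⊕ Fin l → ℝ) × ℝ} (hx : xPart q.1 ∈ κ.target)
    (hd : (z₀ + J (yPart q.1) + q.2 • e, κ.symm (xPart q.1)) ∈ A.dom) :
    ContDiffAt ℝ ∞ (sliceMap A κ z₀ J e) q := by
  have h1 : ContDiff ℝ ∞ fun q : (Fin n ⊕ Fin l → ℝ) × ℝ =>
      z₀ + J (yPartL n l q.1) + q.2 • e := by fun_prop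
  have h2 : ContDiff ℝ ∞ fun q : (Fin n ⊕ Fin l → ℝ) × ℝ => xPartL n l q.1 := by fun_prop
  refine ContMDiffAt.contDiffAt (ContMDiffAt.comp
    (f := fun q : (Fin n ⊕ Fin l → ℝ) × ℝ => (z₀ + J (yPart q.1) + q.2 • e, κ.symm (xPart q.1))) q
    (A.contMDiffAt_act hd) (h1.contMDiff.contMDiffAt.prodMk ?_))
  exact ContMDiffAt.comp (f := fun q : (Fin n ⊕ Fin l → ℝ) × ℝ => xPartL n l q.1) q
    (contMDiffAt_chart_symm hκ hx) h2.contMDiff.contMDiffAt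

/-- For fixed `y` and `u` the slice map is an orbit map in the chart `κ`, so it carries
left-invariant fields to generators. Its local inverse is therefore adapted. -/
theorem fderiv_sliceMap (hκ : κ ∈ IsManifold.maximalAtlas 𝓘(ℝ, Fin n → ℝ) ∞ G)
    {q : (Fin n ⊕ Fin l → ℝ) × ℝ} (hx : xPart q.1 ∈ κ.target)
    (hd : (z₀ + J (yPart q.1) + q.2 • e, κ.symm (xPart q.1)) ∈ A.dom)
    (w : GroupLieAlgebra 𝓘(ℝ, Fin n → ℝ) G) :
    fderiv ℝ (sliceMap A κ z₀ J e) q (Sum.elim (leftComp κ w (xPart q.1)) 0, 0) =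
      A.generator w (sliceMap A κ z₀ J e q) := by
  have := topologicalGroup_of_lieGroup 𝓘(ℝ, Fin n → ℝ) ∞ (G := G)
  have hxs : κ.symm (xPart q.1) * 1 ∈ κ.source := by simpa using κ.map_target hx
  let L : (Fin n → ℝ) → (Fin n ⊕ Fin l → ℝ) × ℝ := fun x =>
    (xInclL n l x + (q.1 - xInclL n l (xPartL n l q.1)), q.2)
  have hL : ∀ x, HasFDerivAt L ((xInclL n l).prod 0) x := fun x =>
    ((xInclL n l).hasFDerivAt.add_const _).prodMk (hasFDerivAt_const _ _)
  have hL1 : L (xPart q.1) = q := by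
    simp [L, xPartL_apply]
  have hxL : ∀ x, xPart (L x).1 = x := fun x => by
    funext i
    simp [L, xPart, xInclL_apply, xPartL_apply]
  have hyL : ∀ x, yPart (L x).1 = yPart q.1 := fun x => by
    funext i
    simp [L, yPart, xInclL_apply]
  have e1 : κ (κ.symm (xPart q.1) * 1) = xPart q.1 := by rw [mul_one, κ.right_inv hx]
  have h2 : HasFDerivAt (sliceMap A κ z₀ J e ∘ L)
      ((fderiv ℝ (sliceMap A κ z₀ J e) q).comp ((xInclL n l).prod 0)) (xPart q.1) := by
    refine HasFDerivAt.comp (xPart q.1) ?_ (hL _)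
    rw [hL1]
    exact ((contDiffAt_sliceMap hκ hx hd).differentiableAt (by simp)).hasFDerivAt
  have h3 := derivOne_comp (k := sliceMap A κ z₀ J e ∘ L)
    (h := fun s => κ (κ.symm (xPart q.1) * s)) (w := w) (by rw [e1]; exact h2.differentiableAt)
    ((contMDiffAt_left_chart hκ hxs).mdifferentiableAt (by simp))
  rw [e1, ← leftComp_eq hκ hx, h2.fderiv] at h3
  have h4 : fderiv ℝ (sliceMap A κ z₀ J e) q (Sum.elim (leftComp κ w (xPart q.1)) 0, 0) =
      ((fderiv ℝ (sliceMap A κ z₀ J e) q).comp ((xInclL n l).prod 0)) (leftComp κ w (xPart q.1)) := by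
    simp [xInclL_apply]
  rw [h4, ← h3]
  refine Eq.trans ?_ (A.derivOne_act hd w)
  refine derivOne_congr ?_ w
  have hev : ∀ᶠ s in 𝓝 (1 : G), κ.symm (xPart q.1) * s ∈ κ.source :=
    (continuous_const_mul (κ.symm (xPart q.1))).continuousAt.eventually
      (κ.open_source.mem_nhds hxs)
  filter_upwards [hev] with s hs
  simp only [Function.comp, sliceMap, hxL, hyL, κ.left_inv hs]
  rfl

/-- The inverse function theorem for the slice map: at the base point the `x`-directions go to the
generators, independent by freeness, and the `y`- and `u`-directions go to a complement of their
span. The form `m` will be `du - p·da` for a given first-order jet, so the last condition keeps the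
`u`-axis off its tangent plane. -/
theorem exists_isAdaptedChart [FiniteDimensional ℝ E] (hE : Module.finrank ℝ E = n + l + 1)
    (hfree : A.IsFree) {z₀ : E} (hz₀ : z₀ ∈ Z) {m : E →ₗ[ℝ] ℝ} (hm : m ≠ 0) :
    ∃ (κ : OpenPartialHomeomorph G (Fin n → ℝ))
      (φ : OpenPartialHomeomorph E ((Fin n ⊕ Fin l → ℝ) × ℝ)),
      IsAdaptedChart A κ φ ∧ z₀ ∈ φ.source ∧ m (fderiv ℝ φ.symm (φ z₀) (0, 1)) ≠ 0 := by
  have : CompleteSpace E := FiniteDimensional.complete ℝ E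
  have hinj : Function.Injective (A.generatorL z₀) :=
    (injective_iff_map_eq_zero _).2 fun w hw => A.eq_zero_of_generator_eq_zero hfree hz₀ hw
  have hV : Module.finrank ℝ (LinearMap.range (A.generatorL z₀)) = n := by
    rw [LinearMap.finrank_range_of_inj hinj, Module.finrank_fin_fun]
  obtain ⟨J', e, hme, hJe⟩ := exists_complement hE hV hm
  let J : (Fin l → ℝ) →L[ℝ] E := J'.toContinuousLinearMap
  set κ := chartAt (Fin n → ℝ) (1 : G)
  have hκ : κ ∈ IsManifold.maximalAtlas 𝓘(ℝ, Fin n → ℝ) ∞ G := IsManifold.chart_mem_maximalAtlas 1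
  have h1 : (1 : G) ∈ κ.source := mem_chart_source _ _
  set Ψ := sliceMap A κ z₀ J e with hΨ
  let q₀ : (Fin n ⊕ Fin l → ℝ) × ℝ := (Sum.elim (κ 1) 0, 0)
  have hq₀x : xPart q₀.1 = κ 1 := rfl
  have hq₀y : yPart q₀.1 = 0 := rfl
  have hx₀ : xPart q₀.1 ∈ κ.target := κ.map_source h1
  have hd₀ : (z₀ + J (yPart q₀.1) + q₀.2 • e, κ.symm (xPart q₀.1)) ∈ A.dom := by
    rw [hq₀x, hq₀y, κ.left_inv h1, map_zero, add_zero, zero_smul, add_zero]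
    exact A.one_mem z₀ hz₀
  have hΨ₀ : Ψ q₀ = z₀ := by
    simp only [hΨ, sliceMap]
    rw [hq₀x, hq₀y, κ.left_inv h1, map_zero, add_zero, zero_smul, add_zero, A.act_one z₀ hz₀]
  have hs₀ := contDiffAt_sliceMap hκ hx₀ hd₀
  -- With `x` fixed at the coordinates of `1` the group does not move the slice, so the map is
  -- affine in `(y, u)`.
  have hyu : ∀ y u, fderiv ℝ Ψ q₀ (Sum.elim (0 : Fin n → ℝ) y, u) = J y + u • e := by
    intro y u
    let S : ℝ → (Fin n ⊕ Fin l → ℝ) × ℝ := fun t => q₀ + t • (Sum.elim (0 : Fin n → ℝ) y, u)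
    have hS : HasDerivAt S (Sum.elim (0 : Fin n → ℝ) y, u) 0 := by
      simpa [S] using ((hasDerivAt_id (0 : ℝ)).smul_const
        ((Sum.elim (0 : Fin n → ℝ) y, u) : (Fin n ⊕ Fin l → ℝ) × ℝ)).const_add q₀
    have hS0 : S 0 = q₀ := by simp [S]
    have h2 : HasDerivAt (Ψ ∘ S) (fderiv ℝ Ψ q₀ (Sum.elim (0 : Fin n → ℝ) y, u)) 0 := by
      refine HasFDerivAt.comp_hasDerivAt 0 ?_ hS
      rw [hS0]
      exact (hs₀.differentiableAt (by simp)).hasFDerivAt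
    have h3 : HasDerivAt (fun t : ℝ => z₀ + t • (J y + u • e)) (J y + u • e) 0 := by
      simpa using ((hasDerivAt_id (0 : ℝ)).smul_const (J y + u • e)).const_add z₀
    refine h2.unique (h3.congr_of_eventuallyEq ?_)
    have hc : ContinuousAt (fun t : ℝ => z₀ + t • (J y + u • e)) 0 := h3.continuousAt
    have hZ : ∀ᶠ t : ℝ in 𝓝 0, z₀ + t • (J y + u • e) ∈ Z :=
      hc.eventually (A.isOpen_space.mem_nhds (by simpa using hz₀))
    filter_upwards [hZ] with t ht
    have e1 : xPart (S t).1 = κ 1 := by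
      funext i
      simp [S, xPart, q₀]
    have e2 : yPart (S t).1 = t • y := by
      funext i
      simp [S, yPart, q₀]
    have e3 : (S t).2 = t * u := by simp [S, q₀]
    simp only [Function.comp, hΨ, sliceMap]
    rw [e1, e2, e3, κ.left_inv h1, map_smul, mul_smul, add_assoc, ← smul_add, A.act_one _ ht]
  have hTinj : Function.Injective (fderiv ℝ Ψ q₀) := by
    refine (injective_iff_map_eq_zero _).2 ?_
    rintro ⟨p, u⟩ hp
    obtain ⟨w, hw⟩ := leftComp_surjective hκ hx₀ (xPart p)
    have hsum : ((p, u) : (Fin n ⊕ Fin l → ℝ) × ℝ) =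
        (Sum.elim (leftComp κ w (xPart q₀.1)) 0, 0) + (Sum.elim (0 : Fin n → ℝ) (yPart p), u) := by
      rw [hw]
      refine Prod.ext ?_ (by simp)
      funext s
      cases s <;> simp [xPart, yPart]
    rw [hsum, map_add, fderiv_sliceMap hκ hx₀ hd₀, hyu, ← hΨ, hΨ₀, ← add_assoc] at hp
    obtain ⟨a1, a2, a3⟩ := hJe _ ⟨w, rfl⟩ _ _ hp
    have a4 : w = 0 := A.eq_zero_of_generator_eq_zero hfree hz₀ a1
    rw [hsum, a2, a3, a4]
    have a5 : leftComp κ (0 : GroupLieAlgebra 𝓘(ℝ, Fin n → ℝ) G) (xPart q₀.1) = 0 :=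
      (leftCompL κ (xPart q₀.1)).map_zero
    rw [a5]
    refine Prod.ext ?_ (by simp)
    funext s
    cases s <;> simp
  have hfin : Module.finrank ℝ ((Fin n ⊕ Fin l → ℝ) × ℝ) = Module.finrank ℝ E := by
    rw [hE]
    simp
  have hTbij : Function.Bijective (fderiv ℝ Ψ q₀).toLinearMap :=
    ⟨hTinj, (LinearMap.injective_iff_surjective_of_finrank_eq_finrank hfin).1 hTinj⟩
  let T : ((Fin n ⊕ Fin l → ℝ) × ℝ) ≃L[ℝ] E :=
    (LinearEquiv.ofBijective _ hTbij).toContinuousLinearEquiv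
  have hT : HasFDerivAt Ψ (T : _ →L[ℝ] E) q₀ :=
    (hs₀.differentiableAt (by simp)).hasFDerivAt.congr_fderiv (by ext X; rfl; rfl)
  let R := hs₀.toOpenPartialHomeomorph Ψ hT (by simp)
  have hRΨ : ∀ q, R q = Ψ q := fun q => rfl
  have hq₀R : q₀ ∈ R.source := hs₀.mem_toOpenPartialHomeomorph_source hT (by simp)
  -- Invertibility of the derivative is required at all nearby points, so that after restriction the
  -- inverse is smooth on the entire domain.
  have hgood : ∀ᶠ q in 𝓝 q₀, xPart q.1 ∈ κ.target ∧
      (z₀ + J (yPart q.1) + q.2 • e, κ.symm (xPart q.1)) ∈ A.dom ∧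
      ∃ T' : ((Fin n ⊕ Fin l → ℝ) × ℝ) ≃L[ℝ] E, (T' : _ →L[ℝ] E) = fderiv ℝ Ψ q := by
    have c1 : ContinuousAt (fun q : (Fin n ⊕ Fin l → ℝ) × ℝ => xPart q.1) q₀ :=
      ((xPartL n l).continuous.comp continuous_fst).continuousAt
    have c2 : ContinuousAt (fun q : (Fin n ⊕ Fin l → ℝ) × ℝ =>
        (z₀ + J (yPart q.1) + q.2 • e, κ.symm (xPart q.1))) q₀ := by
      have c3 : Continuous fun q : (Fin n ⊕ Fin l → ℝ) × ℝ =>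
        z₀ + J (yPartL n l q.1) + q.2 • e := by fun_prop
      exact c3.continuousAt.prodMk (ContinuousAt.comp
        (f := fun q : (Fin n ⊕ Fin l → ℝ) × ℝ => xPart q.1) (κ.symm.continuousAt hx₀) c1)
    have c4 : ContinuousAt (fderiv ℝ Ψ) q₀ := hs₀.continuousAt_fderiv (by simp)
    refine (c1.eventually (κ.open_target.mem_nhds hx₀)).and
      ((c2.eventually (A.isOpen_dom.mem_nhds hd₀)).and (c4.eventually
        (p := fun L => ∃ T' : ((Fin n ⊕ Fin l → ℝ) × ℝ) ≃L[ℝ] E, (T' : _ →L[ℝ] E) = L) ?_))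
    have hn := ContinuousLinearEquiv.nhds T
    have : (T : _ →L[ℝ] E) = fderiv ℝ Ψ q₀ := by ext X <;> rfl
    rw [this] at hn
    exact hn
  obtain ⟨U, hU, hUo, hq₀U⟩ := eventually_nhds_iff.1 hgood
  let φ := (R.restrOpen U hUo).symm
  have hφs : φ.symm = R.restrOpen U hUo := by simp [φ]
  have hφt : ∀ q, q ∈ φ.target → q ∈ R.source ∧ q ∈ U := by
    intro q hq
    simpa [φ] using hq
  have hφsm : ∀ q, φ.symm q = Ψ q := fun q => by rw [hφs]; rfl
  have hφq : ∀ z ∈ φ.source, Ψ (φ z) = z := fun z hz => by rw [← hφsm]; exact φ.left_inv hz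
  have hdif : IsDiffeo φ := by
    constructor
    · intro z hz
      have ht := hφt _ (φ.map_source hz)
      obtain ⟨b1, b2, T', hT'⟩ := hU _ ht.2
      have hzR : z ∈ R.target := by
        rw [← hφq z hz]
        exact R.map_source ht.1
      have hsy : R.symm z = φ z := rfl
      have hcd := contDiffAt_sliceMap (z₀ := z₀) (J := J) (e := e) hκ b1 b2
      have : ContDiffAt ℝ ∞ R.symm z := by
        refine R.contDiffAt_symm (f₀' := T') hzR ?_ ?_
        · rw [hsy, hT']
          exact (hcd.differentiableAt (by simp)).hasFDerivAt
        · rw [hsy]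
          exact hcd
      exact this.contDiffWithinAt
    · intro q hq
      obtain ⟨b1, b2, -⟩ := hU _ (hφt q hq).2
      have : (φ.symm : _ → E) = Ψ := funext hφsm
      rw [this]
      exact (contDiffAt_sliceMap hκ b1 b2).contDiffWithinAt
  have hΨeq : (φ.symm : _ → E) = Ψ := funext hφsm
  have hq₀t : q₀ ∈ φ.target := by simp [φ, hq₀R, hq₀U]
  have hz₀s : z₀ ∈ φ.source := by
    rw [← hΨ₀, ← hφsm]
    exact φ.map_target hq₀t
  have hφz₀ : φ z₀ = q₀ := by
    rw [← hΨ₀, ← hφsm]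
    exact φ.right_inv hq₀t
  refine ⟨κ, φ, ⟨hκ, ?_, hdif.smooth, hdif.smooth_symm, ?_, ?_⟩, hz₀s, ?_⟩
  · intro z hz
    obtain ⟨b1, b2, -⟩ := hU _ (hφt _ (φ.map_source hz)).2
    rw [← hφq z hz]
    exact A.act_mem _ _ b2
  · intro z hz
    exact (hU _ (hφt _ (φ.map_source hz)).2).1
  · intro z hz w
    obtain ⟨b1, b2, -⟩ := hU _ (hφt _ (φ.map_source hz)).2
    have b3 := fderiv_sliceMap (z₀ := z₀) (J := J) (e := e) hκ b1 b2 w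
    rw [← hΨ, hφq z hz] at b3
    rw [← b3]
    have := hdif.fderiv_apply_symm hz (Sum.elim (leftComp κ w (xPart (φ z).1)) 0, 0)
    rwa [hΨeq] at this
  · rw [hΨeq, hφz₀]
    have : ((0, 1) : (Fin n ⊕ Fin l → ℝ) × ℝ) = (Sum.elim (0 : Fin n → ℝ) (0 : Fin l → ℝ), 1) := by
      refine Prod.ext ?_ rfl
      funext s
      cases s <;> rfl
    rw [this, hyu]
    simpa using hme

end LocalAction

/-! ## Invariant equations -/

theorem IsSmoothGraph.smoothNear {ι : Type*} [Fintype ι] {Z : Set ((ι → ℝ) × ℝ)}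
    {f : (ι → ℝ) → ℝ} {Ω : Set (ι → ℝ)} (h : IsSmoothGraph Z f Ω) {a : ι → ℝ} (ha : a ∈ Ω) :
    SmoothNear f a :=
  h.smooth.smoothNear h.isOpen ha

theorem SmoothNear.exists_isSmoothGraph {ι : Type*} [Fintype ι] {Z : Set ((ι → ℝ) × ℝ)}
    {f : (ι → ℝ) → ℝ} {a : ι → ℝ} (h : SmoothNear f a) (hZ : Z ∈ 𝓝 (a, f a)) :
    ∃ Ω, IsSmoothGraph Z f Ω ∧ a ∈ Ω := by
  have hc : ContinuousAt (fun a => (a, f a)) a :=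
    continuousAt_id.prodMk h.contDiffAt.continuousAt
  obtain ⟨s, h1, h2, h3, h4⟩ := h.exists_isOpen (hc.eventually hZ)
  exact ⟨s, ⟨h1, h4, fun x hx => h3 hx⟩, h2⟩

namespace LocalAction

variable {n l : ℕ} {G : Type*} [Group G] [TopologicalSpace G] [ChartedSpace (Fin n → ℝ) G]
  [LieGroup 𝓘(ℝ, Fin n → ℝ) ∞ G] {ι : Type*} [Fintype ι] [DecidableEq ι]
  {Z : Set ((ι → ℝ) × ℝ)} {A : LocalAction n G Z} {e : Jet2 ι → ℝ}

/-- A jet satisfying the equation is also the jet of a solution `f₁`. The image of `f₁` is a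
solution, and its second-order jet coincides with that of the image of `f`, because `jetMap` depends
only on the jet. -/
theorem PreservesSolutions.preservesEquation (h : A.PreservesSolutions e)
    (hs : LocallySolvable Z e) : A.PreservesEquation e := by
  intro g f Ω a v Ω' b hf hv hG he
  have hΩ' := hv.isOpen.mem_nhds hG.mem_target
  have hfs := hf.smoothNear hG.mem_source
  have hvs := hv.smoothNear hG.mem_target
  have hm : MapsGerm (A.transform g) f a v b :=
    GraphInImageAt.mapsGerm (φ := A.transform g) hG (A.isDiffeo_transform g) hfs hvs hΩ'
  obtain ⟨f₁, Ω₁, hsol, ha, hj⟩ := hs (jet2 f a) (hf.mem a hG.mem_source) he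
  have ha' : a ∈ Ω₁ := ha
  have hj' : jet2 f₁ a = jet2 f a := hj
  have hj1 : jet1 f₁ a = jet1 f a := congrArg Prod.fst hj'
  have hu : f₁ a = f a := congrArg (fun j => j.2.1) hj1
  have hf₁ := hsol.toIsSmoothGraph.smoothNear ha'
  have hsrc : (a, f₁ a) ∈ (A.transform g).source := by rw [hu]; exact hm.mem
  obtain ⟨v₁, hv₁, hm₁⟩ := exists_mapsGerm (A.isDiffeo_transform g) hf₁ hsrc
    (by rw [hj1]; exact hm.isTransverse (A.isDiffeo_transform g) hfs hvs)
  have hb : (A.transform g (a, f₁ a)).1 = b := by rw [hu, hm.map_eq]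
  rw [hb] at hv₁ hm₁
  have hZ : Z ∈ 𝓝 (b, v₁ b) := by
    rw [← hm₁.map_eq]
    exact A.isOpen_space.mem_nhds (A.act_mem _ _ hm₁.mem)
  obtain ⟨Ω₁', hg₁, hG₁⟩ := hm₁.graphInImageAt (hsol.isOpen.mem_nhds ha') hv₁ hZ
  have := (h g f₁ Ω₁ v₁ Ω₁' hsol hg₁ hG₁.graph).eq_zero b hG₁.mem_target
  rwa [hm₁.jet2_eq (A.isDiffeo_transform g) hf₁ hv₁, hj',
    ← hm.jet2_eq (A.isDiffeo_transform g) hfs hvs] at this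

theorem PreservesEquation.of_mapsGerm (h : A.PreservesEquation e) {g : G} {f : (ι → ℝ) → ℝ}
    {a : ι → ℝ} {v : (ι → ℝ) → ℝ} {b : ι → ℝ} (hm : MapsGerm (A.transform g) f a v b)
    (hf : SmoothNear f a) (hv : SmoothNear v b) (he : e (jet2 f a) = 0) : e (jet2 v b) = 0 := by
  obtain ⟨Ω, hΩ, ha⟩ := hf.exists_isSmoothGraph
    (A.isOpen_space.mem_nhds (A.mem_space _ _ hm.mem))
  have hZ : Z ∈ 𝓝 (b, v b) := by
    rw [← hm.map_eq]
    exact A.isOpen_space.mem_nhds (A.act_mem _ _ hm.mem)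
  obtain ⟨Ω', hΩ', hG⟩ := hm.graphInImageAt (hΩ.isOpen.mem_nhds ha) hv hZ
  exact h g f Ω a v Ω' b hΩ hΩ' hG he

theorem PreservesEquation.iff_of_mapsGerm (h : A.PreservesEquation e) {g : G} {f : (ι → ℝ) → ℝ}
    {a : ι → ℝ} {v : (ι → ℝ) → ℝ} {b : ι → ℝ} (hm : MapsGerm (A.transform g) f a v b)
    (hf : SmoothNear f a) (hv : SmoothNear v b) : e (jet2 f a) = 0 ↔ e (jet2 v b) = 0 :=
  -- The inverse of `A.transform g` has the same map and domain as `A.transform g⁻¹`.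
  ⟨h.of_mapsGerm hm hf hv, h.of_mapsGerm (g := g⁻¹) ⟨hm.symm.mem, hm.symm.map_eq, hm.symm.iff⟩
    hv hf⟩

/-! ### Invariants, and the equation expressed in them. -/

variable {κ : OpenPartialHomeomorph G (Fin n → ℝ)}
  {φ : OpenPartialHomeomorph ((ι → ℝ) × ℝ) ((Fin n ⊕ Fin l → ℝ) × ℝ)}
  {β : Module.Basis (Fin n) ℝ (GroupLieAlgebra 𝓘(ℝ, Fin n → ℝ) G)}

/-- The arguments of `F` are differential invariants. -/
theorem eventually_inv2_eq (hφ : IsAdaptedChart A κ φ) {z : (ι → ℝ) × ℝ} (hz : z ∈ φ.source) :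
    ∀ᶠ g in 𝓝 (1 : G),
      ∀ (v : (Fin n ⊕ Fin l → ℝ) → ℝ) (Ω : Set (Fin n ⊕ Fin l → ℝ)) (b : Fin n ⊕ Fin l → ℝ)
        (v' : (Fin n ⊕ Fin l → ℝ) → ℝ) (Ω' : Set (Fin n ⊕ Fin l → ℝ))
        (b' : Fin n ⊕ Fin l → ℝ),
        IsSmoothGraph univ v Ω → IsSmoothGraph univ v' Ω' → φ z = (b, v b) →
        GraphInImageAt
          {q | q ∈ φ.target ∧ φ.symm q ∈ A.domAt g ∧ A.act (φ.symm q) g ∈ φ.source}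
          (fun q => φ (A.act (φ.symm q) g)) v Ω b v' Ω' b' →
        inv2 κ β v b = inv2 κ β v' b' := by
  have hev := eventually_chart_act_eq hφ hz
  rw [nhds_prod_eq] at hev
  -- For each `g` near `1` the translation formula holds on a whole neighbourhood of `z`, as needed
  -- for comparing derivatives.
  filter_upwards [hev.curry] with g hg v Ω b v' Ω' b' hv hv' hzb hG
  have hdif := hφ.isDiffeo
  have hT : IsDiffeo (φ.symm.trans ((A.transform g).trans φ)) :=
    hdif.symm.trans ((A.isDiffeo_transform g).trans hdif)
  have hvs := hv.smoothNear hG.mem_source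
  have hvs' := hv'.smoothNear hG.mem_target
  have hm : MapsGerm (φ.symm.trans ((A.transform g).trans φ)) v b v' b' := by
    refine GraphInImageAt.mapsGerm (Ω := Ω) ?_ hT hvs hvs'
      (hv'.isOpen.mem_nhds hG.mem_target)
    have hsrc : (φ.symm.trans ((A.transform g).trans φ)).source =
      {q | q ∈ φ.target ∧ φ.symm q ∈ A.domAt g ∧ A.act (φ.symm q) g ∈ φ.source} := by
      ext q
      simp [transform]
      tauto
    rw [hsrc]
    exact hG
  have hbt : (b, v b) ∈ φ.target := hzb ▸ φ.map_source hz
  have hzs : φ.symm (b, v b) = z := by rw [← hzb, φ.left_inv hz]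
  obtain ⟨-, -, -, g1, g2⟩ := hg.self_of_nhds
  have hx : xPart b ∈ κ.target := by
    have := hφ.x_mem z hz
    rwa [hzb] at this
  rw [hzb] at g1 g2
  have hb' : b' = translateX κ g b := by
    have := hm.map_eq
    simp only [OpenPartialHomeomorph.coe_trans, Function.comp, hzs] at this
    exact congrArg Prod.fst (this.symm.trans g2)
  rw [hb']
  refine inv2_eq_of_translateX hφ.chart_mem hx g1 (hb' ▸ hvs') ?_
  have hc : ContinuousAt (fun p => (p, v p)) b :=
    continuousAt_id.prodMk hvs.contDiffAt.continuousAt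
  have hc' : ContinuousAt (fun p => φ.symm (p, v p)) b :=
    ContinuousAt.comp (f := fun p => (p, v p)) (φ.symm.continuousAt hbt) hc
  have hc'' : Tendsto (fun p => φ.symm (p, v p)) (𝓝 b) (𝓝 z) := by
    rw [← hzs]
    exact hc'
  filter_upwards [hc.eventually hm.iff, hc''.eventually hg,
    hc.eventually (φ.open_target.mem_nhds hbt)] with p h1 h2 h3
  obtain ⟨-, -, -, -, h4⟩ := h2
  rw [φ.right_inv h3] at h4
  have h5 := h1.1 rfl
  have h6 : (φ.symm.trans ((A.transform g).trans φ)) (p, v p) = (translateX κ g p, v p) := h4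
  rw [h6] at h5
  exact h5.symm

/-- The coordinate jet at `(x, y)` with prescribed values of the invariants. -/
noncomputable def jetOfInv (κ : OpenPartialHomeomorph G (Fin n → ℝ))
    (β : Module.Basis (Fin n) ℝ (GroupLieAlgebra 𝓘(ℝ, Fin n → ℝ) G)) (x : Fin n → ℝ)
    (t : Inv2 n l) : Jet2 (Fin n ⊕ Fin l) :=
  ofFrame (adaptedFrame κ β) (packJet x t)

/-- The values of the invariants on a coordinate jet. -/
noncomputable def invOfJet (κ : OpenPartialHomeomorph G (Fin n → ℝ))
    (β : Module.Basis (Fin n) ℝ (GroupLieAlgebra 𝓘(ℝ, Fin n → ℝ) G))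
    (j : Jet2 (Fin n ⊕ Fin l)) : Inv2 n l :=
  unpackJet (toFrame (adaptedFrame κ β) j)

theorem jetOfInv_invOfJet (hκ : κ ∈ IsManifold.maximalAtlas 𝓘(ℝ, Fin n → ℝ) ∞ G)
    {j : Jet2 (Fin n ⊕ Fin l)} (hj : xPart j.1.1 ∈ κ.target) :
    jetOfInv κ β (xPart j.1.1) (invOfJet κ β j) = j := by
  have h := packJet_unpackJet (toFrame (adaptedFrame κ β) j)
  change packJet (xPart j.1.1) _ = _ at h
  rw [jetOfInv, invOfJet, h, ofFrame_toFrame (isUnit_det_adaptedFrame hκ hj)]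

theorem invOfJet_jetOfInv (hκ : κ ∈ IsManifold.maximalAtlas 𝓘(ℝ, Fin n → ℝ) ∞ G)
    {x : Fin n → ℝ} (hx : x ∈ κ.target) (t : Inv2 n l) :
    invOfJet κ β (jetOfInv κ β x t) = t := by
  have hx' : xPart (packJet x t).1.1 ∈ κ.target := hx
  rw [jetOfInv, invOfJet, toFrame_ofFrame (isUnit_det_adaptedFrame hκ hx'), unpackJet_packJet]

theorem contDiffAt_jetOfInv (hκ : κ ∈ IsManifold.maximalAtlas 𝓘(ℝ, Fin n → ℝ) ∞ G)
    {p : (Fin n → ℝ) × Inv2 n l} (hx : p.1 ∈ κ.target) :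
    ContDiffAt ℝ ∞ (fun p : (Fin n → ℝ) × Inv2 n l => jetOfInv κ β p.1 p.2) p :=
  ContDiffAt.comp p (contDiffAt_ofFrame (j := packJet p.1 p.2)
    (adaptedFrame_smoothNear hκ hx) (isUnit_det_adaptedFrame hκ hx)) contDiff_packJet.contDiffAt

theorem contDiffAt_invOfJet (hκ : κ ∈ IsManifold.maximalAtlas 𝓘(ℝ, Fin n → ℝ) ∞ G)
    {j : Jet2 (Fin n ⊕ Fin l)} (hj : xPart j.1.1 ∈ κ.target) :
    ContDiffAt ℝ ∞ (invOfJet κ β) j :=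
  contDiff_unpackJet.contDiffAt.comp j (contDiffAt_toFrame (adaptedFrame_smoothNear hκ hj))

theorem inv2_eq_invOfJet (hκ : κ ∈ IsManifold.maximalAtlas 𝓘(ℝ, Fin n → ℝ) ∞ G)
    {p : Fin n ⊕ Fin l → ℝ} (hp : xPart p ∈ κ.target) {v : (Fin n ⊕ Fin l → ℝ) → ℝ}
    (hv : SmoothNear v p) : inv2 κ β v p = invOfJet κ β (jet2 v p) :=
  inv2_eq_unpackJet hκ hp hv.two

/-- The left-hand side of the equation as a function of `x` and of the invariants. -/
noncomputable def invEquation (e : Jet2 ι → ℝ) (κ : OpenPartialHomeomorph G (Fin n → ℝ))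
    (β : Module.Basis (Fin n) ℝ (GroupLieAlgebra 𝓘(ℝ, Fin n → ℝ) G))
    (φ : OpenPartialHomeomorph ((ι → ℝ) × ℝ) ((Fin n ⊕ Fin l → ℝ) × ℝ)) (x : Fin n → ℝ)
    (t : Inv2 n l) : ℝ :=
  e (jetMap φ.symm (jetOfInv κ β x t))

/-- At `x`, the invariants of first order `t` are those of a graph that is mapped to a graph by the
inverse of the coordinates. -/
structure IsAdmissible (κ : OpenPartialHomeomorph G (Fin n → ℝ))
    (β : Module.Basis (Fin n) ℝ (GroupLieAlgebra 𝓘(ℝ, Fin n → ℝ) G))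
    (φ : OpenPartialHomeomorph ((ι → ℝ) × ℝ) ((Fin n ⊕ Fin l → ℝ) × ℝ)) (x : Fin n → ℝ)
    (t : Inv1 n l) : Prop where
  mem_target : (Sum.elim x t.1, t.2.1) ∈ φ.target
  isTransverse : IsTransverse φ.symm (jetOfInv κ β x (t, 0)).1

theorem IsAdmissible.x_mem {x : Fin n → ℝ} {t : Inv1 n l} (h : IsAdmissible κ β φ x t)
    (hφ : IsAdaptedChart A κ φ) : x ∈ κ.target := by
  have := hφ.x_mem _ (φ.map_target h.mem_target)
  rwa [φ.right_inv h.mem_target] at this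

theorem IsAdmissible.eventually {x : Fin n → ℝ} {t : Inv1 n l} (h : IsAdmissible κ β φ x t)
    (hφ : IsAdaptedChart A κ φ) :
    ∀ᶠ p : (Fin n → ℝ) × Inv1 n l in 𝓝 (x, t), IsAdmissible κ β φ p.1 p.2 := by
  have hx := h.x_mem hφ
  have h1 : ContinuousAt (fun p : (Fin n → ℝ) × Inv1 n l => jetOfInv κ β p.1 (p.2, 0)) (x, t) := by
    refine ContinuousAt.comp (g := fun p : (Fin n → ℝ) × Inv2 n l => jetOfInv κ β p.1 p.2)
      (f := fun p : (Fin n → ℝ) × Inv1 n l => (p.1, (p.2, 0))) ?_ (by fun_prop)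
    exact (contDiffAt_jetOfInv (p := (x, (t, 0))) hφ.chart_mem hx).continuousAt
  have h2 : ContinuousAt (fun p : (Fin n → ℝ) × Inv1 n l =>
      ((jetOfInv κ β p.1 (p.2, 0)).1.1, (jetOfInv κ β p.1 (p.2, 0)).1.2.1)) (x, t) :=
    h1.fst.fst.prodMk h1.fst.snd.fst
  have h3 := ContinuousAt.comp (x := (x, t)) (contDiffAt_transversality hφ.isDiffeo.symm
    (j := (jetOfInv κ β x (t, 0)).1) h.mem_target).continuousAt h1.fst
  filter_upwards [h2.eventually (φ.open_target.mem_nhds h.mem_target),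
    h3.eventually_ne h.isTransverse] with p hp1 hp2
  exact ⟨hp1, hp2⟩

theorem contDiffAt_invEquation (hφ : IsAdaptedChart A κ φ) (he : ContDiffOn ℝ ∞ e (jetsOver Z))
    {x : Fin n → ℝ} {t : Inv2 n l} (h : IsAdmissible κ β φ x t.1) :
    ContDiffAt ℝ ∞ (fun p : (Fin n → ℝ) × Inv2 n l => invEquation e κ β φ p.1 p.2) (x, t) := by
  have h1 := contDiffAt_jetOfInv (β := β) (p := (x, t)) hφ.chart_mem (h.x_mem hφ)
  have h2 := contDiffAt_jetMap hφ.isDiffeo.symm (j := jetOfInv κ β x t) h.mem_target h.isTransverse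
  have ho : IsOpen (jetsOver Z) :=
    A.isOpen_space.preimage (by fun_prop : Continuous fun j : Jet2 ι => (j.1.1, j.1.2.1))
  have hm : jetMap φ.symm (jetOfInv κ β x t) ∈ jetsOver Z :=
    hφ.source_subset (φ.map_target h.mem_target)
  have h3 : ContDiffAt ℝ ∞ (fun p : (Fin n → ℝ) × Inv2 n l =>
      jetMap φ.symm (jetOfInv κ β p.1 p.2)) (x, t) :=
    ContDiffAt.comp (g := jetMap φ.symm) (x, t) h2 h1
  exact ContDiffAt.comp (g := e) (x, t) (he.contDiffAt (ho.mem_nhds hm)) h3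

/-- A graph `v` with invariants `t` over `x` is translated to a graph `v'` over `x'`; it again has
invariants `t`. In the original coordinates the two graphs become `f` and `f'`, related by a group
element near `1`, so their jets satisfy `e = 0` simultaneously. -/
theorem eventually_invEquation_iff (hφ : IsAdaptedChart A κ φ) (he : A.PreservesEquation e)
    {x : Fin n → ℝ} {t : Inv2 n l} (h : IsAdmissible κ β φ x t.1) :
    ∀ᶠ x' in 𝓝 x, (invEquation e κ β φ x t = 0 ↔ invEquation e κ β φ x' t = 0) := by
  have htop := topologicalGroup_of_lieGroup 𝓘(ℝ, Fin n → ℝ) ∞ (G := G)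
  have hdif := hφ.isDiffeo
  have hx := h.x_mem hφ
  obtain ⟨v, f, hv, hf, hvj, hfj, hm⟩ := exists_mapsGerm_of_jet hdif.symm
    (j := jetOfInv κ β x t) h.mem_target h.isTransverse
  set b := (jetOfInv κ β x t).1.1 with hb
  set a := (jetMap φ.symm (jetOfInv κ β x t)).1.1 with ha
  have hbx : xPart b = x := rfl
  have hbt : (b, v b) ∈ φ.target := hm.mem
  have hms : MapsGerm φ f a v b := by simpa using hm.symm
  have hev := eventually_chart_act_eq hφ hms.mem
  rw [nhds_prod_eq] at hev
  have hgc : ContinuousAt (fun x' => (κ.symm x)⁻¹ * κ.symm x') x :=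
    continuousAt_const.mul (κ.symm.continuousAt hx)
  have hg1 : Tendsto (fun x' => (κ.symm x)⁻¹ * κ.symm x') (𝓝 x) (𝓝 1) := by
    have := hgc.tendsto
    rwa [inv_mul_cancel] at this
  have hadm : ∀ᶠ x' in 𝓝 x, IsAdmissible κ β φ x' t.1 := by
    have hc : ContinuousAt (fun x' => (x', t.1)) x := by fun_prop
    exact hc.eventually (h.eventually hφ)
  filter_upwards [hg1.eventually hev.curry, hadm] with x' hg hx'
  -- The unique element whose right translation takes `x` to `x'`; it tends to `1` as `x'` tends to
  -- `x`.
  set g := (κ.symm x)⁻¹ * κ.symm x' with hgdef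
  have hxt' := hx'.x_mem hφ
  have hmul : κ.symm x * g = κ.symm x' := by rw [hgdef]; group
  have hmul' : κ.symm x' * g⁻¹ = κ.symm x := by rw [hgdef]; group
  have hbs : κ.symm (xPart b) * g ∈ κ.source := by
    rw [hbx, hmul]
    exact κ.map_target hxt'
  set b' : Fin n ⊕ Fin l → ℝ := translateX κ g b with hb'
  have hb'x : xPart b' = x' := by
    change κ (κ.symm (xPart b) * g) = x'
    rw [hbx, hmul, κ.right_inv hxt']
  have hb'e : b' = Sum.elim x' t.1.1 := by
    funext s
    cases s with
    | inl i => exact congrFun hb'x i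
    | inr μ => rfl
  have hback : ∀ p : Fin n ⊕ Fin l → ℝ, xPart p ∈ κ.target → κ.symm (xPart p) * g ∈ κ.source →
      translateX κ g⁻¹ (translateX κ g p) = p := by
    intro p hp hps
    funext s
    cases s with
    | inl i =>
      change κ (κ.symm (κ (κ.symm (xPart p) * g)) * g⁻¹) i = p (Sum.inl i)
      rw [κ.left_inv hps, mul_inv_cancel_right, κ.right_inv hp]
      rfl
    | inr μ => rfl
  have hb'b : translateX κ g⁻¹ b' = b := hback b hx hbs
  set v' : (Fin n ⊕ Fin l → ℝ) → ℝ := v ∘ translateX κ g⁻¹ with hv'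
  have hvs' : SmoothNear v' b' := by
    refine SmoothNear.comp (by rwa [hb'b]) (translateX_smoothNear hφ.chart_mem ?_ ?_)
    · rwa [hb'x]
    · rw [hb'x, hmul']
      exact κ.map_target hx
  have hv'b' : v' b' = v b := by simp only [hv', Function.comp, hb'b]
  have hxc : ContinuousAt (xPart : (Fin n ⊕ Fin l → ℝ) → _) b :=
    (xPartL n l).continuous.continuousAt
  have hr : ContinuousAt (fun p : Fin n ⊕ Fin l → ℝ => κ.symm (xPart p) * g) b :=
    (ContinuousAt.comp (g := κ.symm) (κ.symm.continuousAt hx) hxc).mul continuousAt_const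
  have hvv : ∀ᶠ p in 𝓝 b, v' (translateX κ g p) = v p := by
    filter_upwards [hxc.eventually (κ.open_target.mem_nhds hx),
      hr.eventually (κ.open_source.mem_nhds hbs)] with p hp1 hp2
    simp only [hv', Function.comp, hback p hp1 hp2]
  have hinv : inv2 κ β v b = inv2 κ β v' b' :=
    inv2_eq_of_translateX (b := b) hφ.chart_mem hx hbs hvs' hvv
  -- A coordinate jet is determined by `x` and the invariants, so equality of invariants identifies
  -- the whole jet of `v'`.
  have hjv' : jet2 v' b' = jetOfInv κ β x' t := by
    have e1 : inv2 κ β v b = t := by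
      rw [inv2_eq_invOfJet (p := b) hφ.chart_mem hx hv, hvj, invOfJet_jetOfInv hφ.chart_mem hx]
    have e2 : xPart (jet2 v' b').1.1 = x' := hb'x
    rw [← jetOfInv_invOfJet (β := β) hφ.chart_mem (j := jet2 v' b') (by rwa [e2]),
      ← inv2_eq_invOfJet hφ.chart_mem (by rwa [hb'x]) hvs', ← hinv, e1, e2]
  have hu : v b = t.1.2.1 := congrArg (fun j => j.1.2.1) hvj
  have hmem' : (b', v' b') ∈ φ.target := by
    rw [hv'b', hb'e, hu]
    exact hx'.mem_target
  obtain ⟨f', hf', hm'⟩ := exists_mapsGerm hdif.symm hvs' hmem'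
    (by
      have : jet1 v' b' = (jetOfInv κ β x' t).1 := congrArg Prod.fst hjv'
      rw [this]
      exact hx'.isTransverse)
  set a' := (φ.symm (b', v' b')).1 with ha'
  have hms' : MapsGerm φ f' a' v' b' := by simpa using hm'.symm
  obtain ⟨g0, -, g1, -, g2⟩ := hg.self_of_nhds
  have hact : A.act (a, f a) g = (a', f' a') := by
    rw [hms.map_eq] at g2
    rw [← φ.left_inv g1, g2, ← hb', ← hm'.map_eq, hv'b']
  -- In the coordinates `φ` the action of `g` is the translation, which takes the graph of `v` to
  -- that of `v'` by construction.
  have hT : MapsGerm (A.transform g) f a f' a' := by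
    refine ⟨g0, hact, ?_⟩
    have hc1 : ContinuousAt (fun z => A.act z g) (a, f a) := (A.contDiffAt_act_right g0).continuousAt
    have hi' := hms'.iff
    rw [← hact] at hi'
    have hc2 : ContinuousAt (fun z => (φ z).1) (a, f a) := (φ.continuousAt hms.mem).fst
    have hvv' : ∀ᶠ z in 𝓝 (a, f a), v' (translateX κ g (φ z).1) = v (φ z).1 := by
      refine hc2.eventually (p := fun p => v' (translateX κ g p) = v p) ?_
      change ∀ᶠ p in 𝓝 (φ (a, f a)).1, _
      rw [hms.map_eq]
      exact hvv
    filter_upwards [hms.iff, hc1.eventually hi', hg, hvv'] with z h1 h2 h3 h4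
    obtain ⟨-, -, -, -, h5⟩ := h3
    change _ ↔ (A.act z g).2 = f' (A.act z g).1
    rw [h1, h2, h5]
    change _ ↔ (φ z).2 = v' (translateX κ g (φ z).1)
    rw [h4]
  have hfin := he.iff_of_mapsGerm hT hf hf'
  have hj' := hm'.jet2_eq hdif.symm hvs' hf'
  rw [hfj, hj', hjv'] at hfin
  exact hfin

end LocalAction

/-! ### Equations linear in the highest derivatives. -/

/-- Summation over ordered pairs, each unordered pair having total weight one. -/
theorem Sym2.sum_eq_sum_div_card {m : Type*} [Fintype m] [DecidableEq m] (f : Sym2 m → ℝ) :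
    ∑ s, f s = ∑ i, ∑ k,
      f s(i, k) / ({p : m × m | s(p.1, p.2) = s(i, k)} : Finset (m × m)).card := by
  rw [← Fintype.sum_prod_type',
    ← Finset.sum_fiberwise_of_maps_to (t := Finset.univ) (g := fun p : m × m => s(p.1, p.2))
      (fun _ _ => Finset.mem_univ _)]
  refine Finset.sum_congr rfl fun s _ => ?_
  have h : ∀ p ∈ ({p : m × m | s(p.1, p.2) = s} : Finset (m × m)),
      f s(p.1, p.2) / ({q : m × m | s(q.1, q.2) = s(p.1, p.2)} : Finset (m × m)).card =
        f s / ({q : m × m | s(q.1, q.2) = s} : Finset (m × m)).card := by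
    intro p hp
    rw [(Finset.mem_filter.1 hp).2]
  rw [Finset.sum_congr rfl h, Finset.sum_const, nsmul_eq_mul]
  have : (({q : m × m | s(q.1, q.2) = s} : Finset (m × m)).card : ℝ) ≠ 0 := by
    induction s using Sym2.ind with | _ i k => ?_
    exact Nat.cast_ne_zero.2 (Finset.card_ne_zero.2 ⟨(i, k), by simp⟩)
  field_simp

/-- The coefficients are differences of values of `F` at unit vectors and at zero, so they inherit
the smoothness of `F`. The divisors count the ordered pairs that represent one unordered pair: two
off the diagonal, one on it. -/
theorem hasQuasilinearForm_of_linear {n l : ℕ} {O : Set (Inv1 n l)} {F : Inv2 n l → ℝ}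
    (hF : ContDiffOn ℝ ∞ F (O ×ˢ univ))
    (h : ∀ t ∈ O, ∃ L : ((Sym2 (Fin l) → ℝ) × (Sym2 (Fin n) → ℝ) × (Fin n → Fin l → ℝ)) →ₗ[ℝ] ℝ,
      ∀ s, F (t, s) = L s + F (t, 0)) : HasQuasilinearForm O F := by
  have hs : ∀ s, ContDiffOn ℝ ∞ (fun t => F (t, s)) O := fun s =>
    hF.comp (contDiffOn_id.prodMk contDiffOn_const) fun t ht => ⟨ht, trivial⟩
  refine ⟨fun μ ν t => (F (t, Pi.single s(μ, ν) 1, 0, 0) - F (t, 0)) /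
      ({p : Fin l × Fin l | s(p.1, p.2) = s(μ, ν)} : Finset _).card,
    fun i j t => (F (t, 0, Pi.single s(i, j) 1, 0) - F (t, 0)) /
      ({p : Fin n × Fin n | s(p.1, p.2) = s(i, j)} : Finset _).card,
    fun μ i t => F (t, 0, 0, Pi.single i (Pi.single μ 1)) - F (t, 0), fun t => F (t, 0),
    fun μ ν => ((hs _).sub (hs _)).div_const _, fun i j => ((hs _).sub (hs _)).div_const _,
    fun μ i => (hs _).sub (hs _), hs _, fun t ht uyy uxx uxy => ?_⟩
  obtain ⟨L, hL⟩ := h t ht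
  have h0 : ∀ s, F (t, s) - F (t, 0) = L s := fun s => by rw [hL s]; ring
  simp only [h0]
  rw [hL (uyy, uxx, uxy)]
  congr 1
  have e0 : ((uyy, uxx, uxy) : (Sym2 (Fin l) → ℝ) × (Sym2 (Fin n) → ℝ) × (Fin n → Fin l → ℝ)) =
      (uyy, 0, 0) + (0, uxx, 0) + (0, 0, uxy) := by simp
  have e1 : ∀ {m : Type} [Fintype m] [DecidableEq m] (M : (Sym2 m → ℝ) →ₗ[ℝ] ℝ) (w : Sym2 m → ℝ),
      M w = ∑ i, ∑ k, M (Pi.single s(i, k) 1) /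
        ({p : m × m | s(p.1, p.2) = s(i, k)} : Finset (m × m)).card * w s(i, k) := by
    intro m _ _ M w
    conv_lhs => rw [pi_eq_sum_univ' w]
    rw [map_sum, Sym2.sum_eq_sum_div_card]
    refine Finset.sum_congr rfl fun i _ => Finset.sum_congr rfl fun k _ => ?_
    rw [map_smul, smul_eq_mul]
    ring
  rw [e0, map_add, map_add]
  congr 1
  · congr 1
    · exact e1 (L ∘ₗ LinearMap.inl ℝ _ _) uyy
    · exact e1 (L ∘ₗ LinearMap.inr ℝ _ _ ∘ₗ LinearMap.inl ℝ _ _) uxx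
  · have e2 : uxy = ∑ μ, ∑ i, uxy i μ • Pi.single i (Pi.single μ (1 : ℝ)) := by
      funext i μ
      simp [Finset.sum_apply, Pi.single_apply, apply_ite, Finset.sum_ite_eq]
    have e3 := congrArg (L ∘ₗ LinearMap.inr ℝ _ _ ∘ₗ LinearMap.inr ℝ _ _) e2
    rw [map_sum] at e3
    simp only [map_sum, map_smul, smul_eq_mul] at e3
    refine e3.trans (Finset.sum_congr rfl fun μ _ => Finset.sum_congr rfl fun i _ => mul_comm _ _)

namespace LocalAction

variable {n l : ℕ} {G : Type*} [Group G] [TopologicalSpace G] [ChartedSpace (Fin n → ℝ) G]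
  [LieGroup 𝓘(ℝ, Fin n → ℝ) ∞ G] {ι : Type*} [Fintype ι] [DecidableEq ι]
  {Z : Set ((ι → ℝ) × ℝ)} {A : LocalAction n G Z} {e : Jet2 ι → ℝ}
  {κ : OpenPartialHomeomorph G (Fin n → ℝ)}
  {φ : OpenPartialHomeomorph ((ι → ℝ) × ℝ) ((Fin n ⊕ Fin l → ℝ) × ℝ)}
  {β : Module.Basis (Fin n) ℝ (GroupLieAlgebra 𝓘(ℝ, Fin n → ℝ) G)}

/-- The second derivatives in `a` depend affinely on the second-order invariants. -/
theorem exists_linear_jetMap_jetOfInv (κ : OpenPartialHomeomorph G (Fin n → ℝ))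
    (β : Module.Basis (Fin n) ℝ (GroupLieAlgebra 𝓘(ℝ, Fin n → ℝ) G))
    (φ : OpenPartialHomeomorph ((ι → ℝ) × ℝ) ((Fin n ⊕ Fin l → ℝ) × ℝ)) (x : Fin n → ℝ)
    (t : Inv1 n l) :
    ∃ L : ((Sym2 (Fin l) → ℝ) × (Sym2 (Fin n) → ℝ) × (Fin n → Fin l → ℝ)) →ₗ[ℝ] (Sym2 ι → ℝ),
      ∀ s, (jetMap φ.symm (jetOfInv κ β x (t, s))).2 =
        L s + (jetMap φ.symm (jetOfInv κ β x (t, 0))).2 := by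
  let L₀ : ((Sym2 (Fin l) → ℝ) × (Sym2 (Fin n) → ℝ) × (Fin n → Fin l → ℝ)) →ₗ[ℝ]
      (Sym2 (Fin n ⊕ Fin l) → ℝ) :=
    { toFun := fun s => (packJet x (t, s)).2
      map_add' := fun s s' => by
        funext p
        induction p using Sym2.ind with | _ i k => ?_
        cases i <;> cases k <;> rfl
      map_smul' := fun c s => by
        funext p
        induction p using Sym2.ind with | _ i k => ?_
        cases i <;> cases k <;> rfl }
  obtain ⟨L₁, h₁⟩ := exists_linear_ofFrame (adaptedFrame κ β) (packJet x (t, 0)).1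
  obtain ⟨L₂, h₂⟩ := exists_linear_jetMap φ.symm (jetOfInv κ β x (t, 0)).1
  have key : ∀ s, (jetMap φ.symm (jetOfInv κ β x (t, s))).2 = L₂ (L₁ (L₀ s)) +
      (L₂ (ofFrame (adaptedFrame κ β) ((packJet x (t, 0)).1, 0)).2 +
        (jetMap φ.symm ((jetOfInv κ β x (t, 0)).1, 0)).2) := fun s => by
    rw [← add_assoc, ← map_add, ← h₁, ← h₂]
    rfl
  refine ⟨L₂ ∘ₗ L₁ ∘ₗ L₀, fun s => ?_⟩
  rw [key s, key 0]
  simp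

theorem IsAdmissible.jetMap_mem {x : Fin n → ℝ} {t : Inv2 n l} (h : IsAdmissible κ β φ x t.1)
    (hφ : IsAdaptedChart A κ φ) : jetMap φ.symm (jetOfInv κ β x t) ∈ jetsOver Z :=
  hφ.source_subset (φ.map_target h.mem_target)

/-- A composition of affine maps: `e` is affine in `u_{ij}`, and `u_{ij}` is affine in the
second-order invariants, while the first-order jet in `a` does not involve them. `IsQuasilinear`
asks no smoothness of its coefficients; here it comes from that of the left-hand side. -/
theorem hasQuasilinearForm_invEquation (hφ : IsAdaptedChart A κ φ)
    {O : Set (Inv1 n l)} {x : Fin n → ℝ} (hO : ∀ t ∈ O, IsAdmissible κ β φ x t)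
    (hF : ContDiffOn ℝ ∞ (invEquation e κ β φ x) (O ×ˢ univ)) (h : IsQuasilinear Z e) :
    HasQuasilinearForm O (invEquation e κ β φ x) := by
  obtain ⟨a, b, hab⟩ := h
  refine hasQuasilinearForm_of_linear hF fun t ht => ?_
  obtain ⟨L, hL⟩ := exists_linear_jetMap_jetOfInv κ β φ x t
  refine ⟨∑ i, ∑ k, a (jetMap φ.symm (jetOfInv κ β x (t, 0))).1 i k •
    (LinearMap.proj s(i, k) ∘ₗ L), fun s => ?_⟩
  have h1 : ∀ s, (jetMap φ.symm (jetOfInv κ β x (t, s))).1 =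
    (jetMap φ.symm (jetOfInv κ β x (t, 0))).1 := fun _ => rfl
  rw [invEquation, invEquation, hab _ (IsAdmissible.jetMap_mem (t := (t, s)) (hO t ht) hφ),
    hab _ (IsAdmissible.jetMap_mem (t := (t, 0)) (hO t ht) hφ), hL s, h1 s, ← add_assoc]
  congr 1
  simp [mul_add, Finset.sum_add_distrib, LinearMap.sum_apply]

/-! ### Coordinates `(x, t)` on jets, regularity, and the choice of `F`. -/

/-- The coordinate `x` and the invariants of a jet. -/
noncomputable def coordOfJet (κ : OpenPartialHomeomorph G (Fin n → ℝ))
    (β : Module.Basis (Fin n) ℝ (GroupLieAlgebra 𝓘(ℝ, Fin n → ℝ) G))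
    (φ : OpenPartialHomeomorph ((ι → ℝ) × ℝ) ((Fin n ⊕ Fin l → ℝ) × ℝ)) (j : Jet2 ι) :
    (Fin n → ℝ) × Inv2 n l :=
  (xPart (jetMap φ j).1.1, invOfJet κ β (jetMap φ j))

theorem invOfJet_fst_congr {j j' : Jet2 (Fin n ⊕ Fin l)} (h : j.1 = j'.1) :
    (invOfJet κ β j).1 = (invOfJet κ β j').1 := by
  obtain ⟨j, Q⟩ := j
  obtain ⟨j', Q'⟩ := j'
  obtain rfl : j = j' := h
  rfl

theorem coordOfJet_fst (j : Jet1 ι) (Q : Sym2 ι → ℝ) :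
    (coordOfJet κ β φ (j, Q)).1 = (coordOfJet κ β φ (j, 0)).1 := rfl

theorem coordOfJet_snd_fst (j : Jet1 ι) (Q : Sym2 ι → ℝ) :
    (coordOfJet κ β φ (j, Q)).2.1 = (coordOfJet κ β φ (j, 0)).2.1 :=
  invOfJet_fst_congr (jetMap_fst j Q)

theorem contDiffAt_coordOfJet (hφ : IsAdaptedChart A κ φ) {j : Jet2 ι}
    (hj : (j.1.1, j.1.2.1) ∈ φ.source) (ht : IsTransverse φ j.1) :
    ContDiffAt ℝ ∞ (coordOfJet κ β φ) j := by
  have h1 := contDiffAt_jetMap hφ.isDiffeo hj ht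
  have h2 : ContDiffAt ℝ ∞ (fun j => invOfJet κ β (jetMap φ j)) j :=
    ContDiffAt.comp (g := invOfJet κ β) j (contDiffAt_invOfJet hφ.chart_mem (hφ.x_mem _ hj)) h1
  exact ((xPartL n l).contDiff.contDiffAt.comp j h1.fst.fst).prodMk h2

theorem jetMap_jetOfInv_coordOfJet (hφ : IsAdaptedChart A κ φ) {j : Jet2 ι}
    (hj : (j.1.1, j.1.2.1) ∈ φ.source) (ht : IsTransverse φ j.1) :
    jetMap φ.symm (jetOfInv κ β (coordOfJet κ β φ j).1 (coordOfJet κ β φ j).2) = j := by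
  have h := jetOfInv_invOfJet (β := β) hφ.chart_mem (j := jetMap φ j) (hφ.x_mem _ hj)
  change jetOfInv κ β (coordOfJet κ β φ j).1 (coordOfJet κ β φ j).2 = _ at h
  rw [h, jetMap_symm_jetMap hφ.isDiffeo hj ht]

theorem IsAdmissible.coordOfJet_eq (hφ : IsAdaptedChart A κ φ) {x : Fin n → ℝ} {t : Inv2 n l}
    (h : IsAdmissible κ β φ x t.1) :
    coordOfJet κ β φ (jetMap φ.symm (jetOfInv κ β x t)) = (x, t) := by
  have h1 := jetMap_symm_jetMap hφ.isDiffeo.symm (j := jetOfInv κ β x t) h.mem_target h.isTransverse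
  rw [OpenPartialHomeomorph.symm_symm] at h1
  rw [coordOfJet, h1, invOfJet_jetOfInv hφ.chart_mem (h.x_mem hφ)]
  rfl

theorem IsAdmissible.isTransverse_jetMap (hφ : IsAdaptedChart A κ φ) {x : Fin n → ℝ} {t : Inv2 n l}
    (h : IsAdmissible κ β φ x t.1) : IsTransverse φ (jetMap φ.symm (jetOfInv κ β x t)).1 := by
  simpa using isTransverse_symm_jetMap hφ.isDiffeo.symm (j := jetOfInv κ β x t) h.mem_target
    h.isTransverse

/-- At a zero, the left-hand side vanishes for all nearby `x` with `t` fixed, so its `x`-derivative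
is zero. If the `t`-derivative were zero as well, the full differential would vanish, and so would
that of `e`, since `(x, t)` are smooth functions of the jet. -/
theorem fderiv_invEquation_ne_zero (hφ : IsAdaptedChart A κ φ)
    (he : ContDiffOn ℝ ∞ e (jetsOver Z)) (hpe : A.PreservesEquation e)
    (hreg : ∀ j ∈ jetsOver Z, e j = 0 → fderiv ℝ e j ≠ 0) {x : Fin n → ℝ} {t : Inv2 n l}
    (h : IsAdmissible κ β φ x t.1) (h0 : invEquation e κ β φ x t = 0) :
    fderiv ℝ (invEquation e κ β φ x) t ≠ 0 := by
  intro hd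
  set j := jetMap φ.symm (jetOfInv κ β x t) with hj
  refine hreg j (h.jetMap_mem hφ) h0 ?_
  set Ee : (Fin n → ℝ) × Inv2 n l → ℝ := fun p => invEquation e κ β φ p.1 p.2 with hEe
  have hE : DifferentiableAt ℝ Ee (x, t) :=
    (contDiffAt_invEquation hφ he h).differentiableAt (by simp)
  have hE0 : fderiv ℝ Ee (x, t) = 0 := by
    have h1 : fderiv ℝ (invEquation e κ β φ x) t =
        (fderiv ℝ Ee (x, t)).comp (ContinuousLinearMap.inr ℝ _ _) :=
      (HasFDerivAt.comp t hE.hasFDerivAt (hasFDerivAt_prodMk_right x t)).fderiv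
    have h2 : fderiv ℝ (fun x' => invEquation e κ β φ x' t) x =
        (fderiv ℝ Ee (x, t)).comp (ContinuousLinearMap.inl ℝ _ _) :=
      (HasFDerivAt.comp (g := Ee) (f := fun x' => (x', t)) x hE.hasFDerivAt
        (hasFDerivAt_prodMk_left x t)).fderiv
    have h3 : (fun x' => invEquation e κ β φ x' t) =ᶠ[𝓝 x] fun _ => 0 := by
      filter_upwards [eventually_invEquation_iff hφ hpe h] with x' hx'
      exact hx'.1 h0
    rw [h3.fderiv_eq, fderiv_const_apply] at h2
    rw [hd] at h1
    refine ContinuousLinearMap.ext fun p => ?_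
    have e1 := congrArg (fun L => L p.2) h1
    have e2 := congrArg (fun L => L p.1) h2
    have e3 : p = (p.1, 0) + (0, p.2) := by simp
    rw [e3, map_add]
    simp at e1 e2
    simp [← e1, ← e2]
  have hjs : (j.1.1, j.1.2.1) ∈ φ.source := φ.map_target h.mem_target
  have hjt : IsTransverse φ j.1 := h.isTransverse_jetMap hφ
  have hc : coordOfJet κ β φ j = (x, t) := h.coordOfJet_eq hφ
  -- Transversality is an open condition, so near `j` every jet is recovered from its coordinates
  -- `(x, t)`.
  have hev : e =ᶠ[𝓝 j] Ee ∘ coordOfJet κ β φ := by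
    have hb : ContinuousAt (fun j : Jet2 ι => (j.1.1, j.1.2.1)) j := by fun_prop
    have ht := (contDiffAt_transversality hφ.isDiffeo hjs).continuousAt.comp
      (x := j) (f := fun j : Jet2 ι => j.1) continuousAt_fst
    filter_upwards [hb.eventually (φ.open_source.mem_nhds hjs), ht.eventually_ne hjt] with j' h1 h2
    change e j' = e (jetMap φ.symm (jetOfInv κ β (coordOfJet κ β φ j').1 (coordOfJet κ β φ j').2))
    rw [jetMap_jetOfInv_coordOfJet hφ h1 h2]
  rw [hev.fderiv_eq, fderiv_comp j (by rwa [hc])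
    ((contDiffAt_coordOfJet hφ hjs hjt).differentiableAt (by simp)), hc, hE0,
    ContinuousLinearMap.zero_comp]

/-- The local independence of `x` propagates as a locally constant truth value on a preconnected
set; admissibility is needed at every point of it. -/
theorem invEquation_iff_of_isPreconnected (hφ : IsAdaptedChart A κ φ) (hpe : A.PreservesEquation e)
    {X : Set (Fin n → ℝ)} (hX : IsPreconnected X) {t : Inv2 n l}
    (h : ∀ x ∈ X, IsAdmissible κ β φ x t.1) {x x' : Fin n → ℝ} (hx : x ∈ X) (hx' : x' ∈ X) :
    invEquation e κ β φ x t = 0 ↔ invEquation e κ β φ x' t = 0 :=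
  hX.induction₂ (fun x x' => invEquation e κ β φ x t = 0 ↔ invEquation e κ β φ x' t = 0)
    (fun x hx => nhdsWithin_le_nhds (eventually_invEquation_iff hφ hpe (h x hx)))
    (fun _ _ _ _ _ _ h1 h2 => h1.trans h2) (fun _ _ _ _ h => h.symm) hx hx'

/-- The equation in terms of the invariants is obtained by fixing the value of `x`. -/
theorem hasInvariantForm (hφ : IsAdaptedChart A κ φ) (he : ContDiffOn ℝ ∞ e (jetsOver Z))
    (hpe : A.PreservesEquation e) {X : Set (Fin n → ℝ)} (hX : IsConnected X)
    {O : Set (Inv1 n l)} (hO : IsOpen O) (hadm : ∀ x ∈ X, ∀ t ∈ O, IsAdmissible κ β φ x t)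
    {S : Set (Jet1 ι)} (hS : ∀ j ∈ S, (j.1, j.2.1) ∈ φ.source ∧ IsTransverse φ j ∧
      (coordOfJet κ β φ (j, 0)).1 ∈ X ∧ (coordOfJet κ β φ (j, 0)).2.1 ∈ O) :
    HasInvariantForm Z e κ β φ S O := by
  -- Any `x₀` will do: `F` is the left-hand side at `x₀`. Other choices give functions with the same
  -- zeros over `O`.
  obtain ⟨x₀, hx₀⟩ := hX.nonempty
  have hF : ContDiffOn ℝ ∞ (invEquation e κ β φ x₀) (O ×ˢ univ) := fun t ht =>
    (ContDiffAt.comp t (contDiffAt_invEquation hφ he (hadm x₀ hx₀ t.1 ht.1))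
      (contDiffAt_const.prodMk contDiffAt_id)).contDiffWithinAt
  refine ⟨hO, invEquation e κ β φ x₀, hF, ?_, fun hreg t ht h0 =>
    fderiv_invEquation_ne_zero hφ he hpe hreg (hadm x₀ hx₀ t.1 ht) h0,
    hasQuasilinearForm_invEquation hφ (hadm x₀ hx₀) hF⟩
  intro f Ω a hf ha hj
  obtain ⟨h1, h2, h3, h4⟩ := hS _ hj
  rw [← coordOfJet_fst _ (jet2 f a).2] at h3
  rw [← coordOfJet_snd_fst _ (jet2 f a).2] at h4
  have hjj : (jet1 f a, (jet2 f a).2) = jet2 f a := rfl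
  rw [hjj] at h3 h4
  have hfs := hf.smoothNear ha
  constructor
  · obtain ⟨v, hv, hm⟩ := exists_mapsGerm hφ.isDiffeo hfs h1 h2
    obtain ⟨Ω', hv', hG⟩ := hm.graphInImageAt (hf.isOpen.mem_nhds ha) hv univ_mem
    exact ⟨v, Ω', _, hv', hG⟩
  · intro v Ω' b hv hG
    have hvs := hv.smoothNear hG.mem_target
    have hm := hG.mapsGerm hφ.isDiffeo hfs hvs (hv.isOpen.mem_nhds hG.mem_target)
    have hvj := hm.jet2_eq hφ.isDiffeo hfs hvs
    have hb : (jetMap φ (jet2 f a)).1.1 = b := by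
      rw [← hvj]
      rfl
    have hbx : xPart b ∈ κ.target := by
      rw [← hb]
      exact hφ.x_mem _ h1
    have hinv : coordOfJet κ β φ (jet2 f a) = (xPart b, inv2 κ β v b) := by
      rw [inv2_eq_invOfJet hφ.chart_mem hbx hvs, hvj, coordOfJet, hb]
    rw [hinv] at h3 h4
    have h5 : (inv2 κ β v b).1 ∈ O := h4
    have h6 : xPart b ∈ X := h3
    refine ⟨h5, ?_⟩
    have h7 := jetMap_jetOfInv_coordOfJet (β := β) hφ (j := jet2 f a) h1 h2
    rw [hinv] at h7
    rw [invEquation_iff_of_isPreconnected hφ hpe hX.isPreconnected (fun x hx => hadm x hx _ h5)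
      hx₀ h6, invEquation, h7]

end LocalAction

/-! ### The sets of jets on which the invariant form holds. -/

namespace LocalAction

variable {n l : ℕ} {G : Type*} [Group G] [TopologicalSpace G] [ChartedSpace (Fin n → ℝ) G]
  [LieGroup 𝓘(ℝ, Fin n → ℝ) ∞ G] {ι : Type*} [Fintype ι] [DecidableEq ι]
  {Z : Set ((ι → ℝ) × ℝ)} {A : LocalAction n G Z} {e : Jet2 ι → ℝ}
  {κ : OpenPartialHomeomorph G (Fin n → ℝ)}
  {φ : OpenPartialHomeomorph ((ι → ℝ) × ℝ) ((Fin n ⊕ Fin l → ℝ) × ℝ)}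
  {β : Module.Basis (Fin n) ℝ (GroupLieAlgebra 𝓘(ℝ, Fin n → ℝ) G)}

/-- A point that is the image of a transverse jet is admissible. -/
theorem isAdmissible_coordOfJet (hφ : IsAdaptedChart A κ φ) {j : Jet2 ι}
    (hj : (j.1.1, j.1.2.1) ∈ φ.source) (ht : IsTransverse φ j.1) :
    IsAdmissible κ β φ (coordOfJet κ β φ j).1 (coordOfJet κ β φ j).2.1 := by
  have h := jetOfInv_invOfJet (β := β) hφ.chart_mem (j := jetMap φ j) (hφ.x_mem _ hj)
  change jetOfInv κ β (coordOfJet κ β φ j).1 (coordOfJet κ β φ j).2 = _ at h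
  have h1 := isTransverse_symm_jetMap hφ.isDiffeo hj ht
  have h2 : ((jetMap φ j).1.1, (jetMap φ j).1.2.1) ∈ φ.target := φ.map_source hj
  rw [← h] at h1 h2
  exact ⟨h2, h1⟩

/-- Admissibility is open in `(x, t)`, so it holds on a product of a ball, which is connected, with
an open set `O`; `S` consists of the transverse jets whose coordinates lie in this product. -/
theorem exists_hasInvariantForm_nhds (hφ : IsAdaptedChart A κ φ)
    (he : ContDiffOn ℝ ∞ e (jetsOver Z)) (hpe : A.PreservesEquation e) {j : Jet1 ι}
    (hj : (j.1, j.2.1) ∈ φ.source) (ht : IsTransverse φ j) :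
    ∃ S ∈ 𝓝 j, ∃ O : Set (Inv1 n l), HasInvariantForm Z e κ β φ S O := by
  have h := (isAdmissible_coordOfJet (β := β) hφ (j := (j, 0)) hj ht).eventually hφ
  rw [nhds_prod_eq, eventually_prod_iff] at h
  obtain ⟨p, hp, q, hq, hpq⟩ := h
  obtain ⟨ε, hε, hX⟩ := Metric.eventually_nhds_iff_ball.1 hp
  obtain ⟨O, hO, hOo, hOj⟩ := mem_nhds_iff.1 hq
  set x₀ := (coordOfJet κ β φ (j, 0)).1
  have hb : ContinuousAt (fun j : Jet1 ι => (j.1, j.2.1)) j := by fun_prop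
  have hc : ContinuousAt (fun j : Jet1 ι => coordOfJet κ β φ (j, 0)) j :=
    ContinuousAt.comp (g := coordOfJet κ β φ) (f := fun j : Jet1 ι => (j, 0))
      (contDiffAt_coordOfJet hφ (j := (j, 0)) hj ht).continuousAt (by fun_prop)
  refine ⟨{j | (j.1, j.2.1) ∈ φ.source ∧ IsTransverse φ j ∧
      (coordOfJet κ β φ (j, 0)).1 ∈ Metric.ball x₀ ε ∧ (coordOfJet κ β φ (j, 0)).2.1 ∈ O},
    ?_, O, hasInvariantForm hφ he hpe
      ⟨⟨x₀, Metric.mem_ball_self hε⟩, (convex_ball x₀ ε).isPreconnected⟩ hOo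
      (fun x hx t ht => hpq (hX x hx) (hO ht)) fun j hj => hj⟩
  filter_upwards [hb.eventually (φ.open_source.mem_nhds hj),
    (contDiffAt_transversality hφ.isDiffeo hj).continuousAt.eventually_ne ht,
    hc.fst.eventually (Metric.ball_mem_nhds x₀ hε),
    hc.snd.fst.eventually (hOo.mem_nhds hOj)] with j' h1 h2 h3 h4
  exact ⟨h1, h2, h3, h4⟩

/-- If the independent variables `(x, y)` do not depend on `u`, the differential of the coordinates
preserves the `u`-direction. -/
theorem exists_fderiv_eq_of_fst (hφ : IsAdaptedChart A κ φ)
    (h : ∀ z ∈ φ.source, ∀ z' ∈ φ.source, z.1 = z'.1 → (φ z).1 = (φ z').1)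
    {z : (ι → ℝ) × ℝ} (hz : z ∈ φ.source) :
    ∃ c : ℝ, c ≠ 0 ∧ fderiv ℝ φ z (0, 1) = (0, c) := by
  have h1 : HasDerivAt (fun t : ℝ => φ (z + t • (0, 1))) (fderiv ℝ φ z (0, 1)) 0 :=
    (hφ.isDiffeo.smoothNear hz).differentiableAt.hasFDerivAt.hasLineDerivAt (0, 1)
  have h2 : (fun t : ℝ => (φ (z + t • (0, 1))).1) =ᶠ[𝓝 0] fun _ => (φ z).1 := by
    have hc : ContinuousAt (fun t : ℝ => z + t • ((0, 1) : (ι → ℝ) × ℝ)) 0 := by fun_prop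
    filter_upwards [hc.eventually (φ.open_source.mem_nhds (by simpa using hz))] with t ht
    exact h _ ht _ hz (by simp)
  have h3 : (fderiv ℝ φ z (0, 1)).1 = 0 :=
    (hasFDerivAt_fst.comp_hasDerivAt 0 h1).unique
      ((hasDerivAt_const 0 (φ z).1).congr_of_eventuallyEq h2)
  refine ⟨(fderiv ℝ φ z (0, 1)).2, fun h4 => ?_, Prod.ext h3 rfl⟩
  have h5 := hφ.isDiffeo.fderiv_symm_apply hz (0, 1)
  rw [show fderiv ℝ φ z (0, 1) = 0 from Prod.ext h3 h4, map_zero] at h5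
  exact zero_ne_one (congrArg Prod.snd h5)

/-- If `(x, y)` depend on `a` alone, the differentials of `φ` and of its inverse map the
`u`-direction to nonzero multiples of itself. Then transversality holds in both directions for every
gradient, and the product form of the domain leaves no further restriction on jets. -/
theorem hasInvariantForm_of_fst (hφ : IsAdaptedChart A κ φ)
    (he : ContDiffOn ℝ ∞ e (jetsOver Z)) (hpe : A.PreservesEquation e)
    {X : Set (Fin n → ℝ)} {W : Set ((Fin l → ℝ) × ℝ)} (hX : IsConnected X)
    (htar : φ.target = {q | xPart q.1 ∈ X ∧ (yPart q.1, q.2) ∈ W})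
    (h : ∀ z ∈ φ.source, ∀ z' ∈ φ.source, z.1 = z'.1 → (φ z).1 = (φ z').1) :
    HasInvariantForm Z e κ β φ {j | (j.1, j.2.1) ∈ φ.source} {t | (t.1, t.2.1) ∈ W} := by
  have hmem : ∀ x ∈ X, ∀ t : Inv1 n l, (t.1, t.2.1) ∈ W → (Sum.elim x t.1, t.2.1) ∈ φ.target :=
    fun x hx t ht => by
      rw [htar]
      exact ⟨hx, ht⟩
  -- Openness is not assumed of `W`; it is that of the slice of the open target at a point of the
  -- nonempty set `X`.
  have hO : IsOpen {t : Inv1 n l | (t.1, t.2.1) ∈ W} := by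
    obtain ⟨x, hx⟩ := hX.nonempty
    have hc : Continuous fun t : Inv1 n l =>
        ((Sum.elim x t.1, t.2.1) : (Fin n ⊕ Fin l → ℝ) × ℝ) := by
      refine (continuous_pi fun s => ?_).prodMk (by fun_prop)
      cases s
      · exact continuous_const
      · exact (continuous_apply _).comp continuous_fst
    have heq : {t : Inv1 n l | (t.1, t.2.1) ∈ W} =
        (fun t : Inv1 n l => ((Sum.elim x t.1, t.2.1) : (Fin n ⊕ Fin l → ℝ) × ℝ)) ⁻¹' φ.target := by
      ext t
      refine ⟨fun ht => hmem x hx t ht, fun ht => ?_⟩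
      rw [mem_preimage, htar] at ht
      exact ht.2
    rw [heq]
    exact φ.open_target.preimage hc
  refine hasInvariantForm hφ he hpe hX hO (fun x hx t ht => ⟨hmem x hx t ht, ?_⟩) fun j hj => ?_
  · obtain ⟨c, hc, hd⟩ := exists_fderiv_eq_of_fst hφ h (φ.map_target (hmem x hx t ht))
    have h1 : ∀ p : Fin n ⊕ Fin l → ℝ,
        graphD φ.symm.symm (φ.symm (Sum.elim x t.1, t.2.1)) p (0, 1) ≠ 0 := fun p => by
      rw [φ.symm_symm, graphD, hd]
      simpa using hc
    exact h1 _
  · have htt : φ (j.1, j.2.1) ∈ φ.target := φ.map_source hj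
    rw [htar] at htt
    refine ⟨hj, ?_, htt.1, htt.2⟩
    obtain ⟨c, hc, hd⟩ := exists_fderiv_eq_of_fst hφ h hj
    have h1 := hφ.isDiffeo.fderiv_symm_apply hj (0, 1)
    rw [hd, show ((0, c) : (Fin n ⊕ Fin l → ℝ) × ℝ) = c • (0, 1) by simp, map_smul] at h1
    have h2 : fderiv ℝ φ.symm (φ (j.1, j.2.1)) (0, 1) = (0, c⁻¹) := by
      rw [← inv_smul_smul₀ hc (fderiv ℝ φ.symm (φ (j.1, j.2.1)) (0, 1)), h1]
      simp
    rw [IsTransverse, graphD, h2]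
    simpa using hc

theorem exists_isAdaptedChart_isTransverse (hE : Fintype.card ι = n + l) (hfree : A.IsFree)
    {j : Jet1 ι} (hj : (j.1, j.2.1) ∈ Z) :
    ∃ (κ : OpenPartialHomeomorph G (Fin n → ℝ))
      (φ : OpenPartialHomeomorph ((ι → ℝ) × ℝ) ((Fin n ⊕ Fin l → ℝ) × ℝ)),
      IsAdaptedChart A κ φ ∧ (j.1, j.2.1) ∈ φ.source ∧ IsTransverse φ j := by
  -- The form `du - p·da`, whose kernel is the tangent plane given by the jet.
  let m : (ι → ℝ) × ℝ →ₗ[ℝ] ℝ :=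
    LinearMap.snd ℝ _ _ - (dotL j.2.2).toLinearMap ∘ₗ LinearMap.fst ℝ _ _
  have hm : ∀ w, m w = w.2 - j.2.2 ⬝ᵥ w.1 := fun w => by simp [m, dotL_apply]
  have hm0 : m ≠ 0 := fun h0 => by
    have := hm (0, 1)
    rw [h0] at this
    simp at this
  obtain ⟨κ, φ, hφ, hz, ht⟩ := exists_isAdaptedChart (l := l) (A := A) (by simp [hE]) hfree hj hm0
  rw [hm] at ht
  exact ⟨κ, φ, hφ, hz, ht⟩

end LocalAction

/-! ### The theorem. -/

theorem theorem5 (n l : ℕ)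
    (G : Type*) [Group G] [TopologicalSpace G] [ChartedSpace (Fin n → ℝ) G]
    [LieGroup 𝓘(ℝ, Fin n → ℝ) ∞ G]
    (β : Module.Basis (Fin n) ℝ (GroupLieAlgebra 𝓘(ℝ, Fin n → ℝ) G))
    -- `n + l` independent variables, so that `dim G = n < n + l + 1 = dim Z`
    (Z : Set ((Fin (n + l) → ℝ) × ℝ)) (A : LocalAction n G Z) (hfree : A.IsFree)
    (e : Jet2 (Fin (n + l)) → ℝ) (he : ContDiffOn ℝ ∞ e (jetsOver Z))
    (hsym : (LocallySolvable Z e ∧ A.PreservesSolutions e) ∨ A.PreservesEquation e) :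
    -- near each first-order jet, suitable adapted coordinates bring the equation to the form `F = 0`
    (∀ j : Jet1 (Fin (n + l)), (j.1, j.2.1) ∈ Z →
      ∃ (κ : OpenPartialHomeomorph G (Fin n → ℝ))
        (φ : OpenPartialHomeomorph ((Fin (n + l) → ℝ) × ℝ) ((Fin n ⊕ Fin l → ℝ) × ℝ)),
        IsAdaptedChart A κ φ ∧ (j.1, j.2.1) ∈ φ.source ∧
        ∃ S ∈ 𝓝 j, ∃ O : Set (Inv1 n l), HasInvariantForm Z e κ β φ S O) ∧
    -- if adapted coordinates keep the dependent variable apart from the independent ones, then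
    -- the form `F = 0` holds for all jets over their domain
    (∀ (κ : OpenPartialHomeomorph G (Fin n → ℝ))
        (φ : OpenPartialHomeomorph ((Fin (n + l) → ℝ) × ℝ) ((Fin n ⊕ Fin l → ℝ) × ℝ))
        (X : Set (Fin n → ℝ)) (W : Set ((Fin l → ℝ) × ℝ)),
        IsAdaptedChart A κ φ → IsConnected X →
        φ.target = {q | xPart q.1 ∈ X ∧ (yPart q.1, q.2) ∈ W} →
        (∀ z ∈ φ.source, ∀ z' ∈ φ.source, z.1 = z'.1 → (φ z).1 = (φ z').1) →
        HasInvariantForm Z e κ β φ {j | (j.1, j.2.1) ∈ φ.source} {t | (t.1, t.2.1) ∈ W}) ∧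
    -- conversely, in all adapted coordinates the arguments of `F` are differential invariants
    (∀ (κ : OpenPartialHomeomorph G (Fin n → ℝ))
        (φ : OpenPartialHomeomorph ((Fin (n + l) → ℝ) × ℝ) ((Fin n ⊕ Fin l → ℝ) × ℝ)),
        IsAdaptedChart A κ φ → ∀ z ∈ φ.source, ∀ᶠ g in 𝓝 (1 : G),
        ∀ (v : (Fin n ⊕ Fin l → ℝ) → ℝ) (Ω : Set (Fin n ⊕ Fin l → ℝ)) (b : Fin n ⊕ Fin l → ℝ)
          (v' : (Fin n ⊕ Fin l → ℝ) → ℝ) (Ω' : Set (Fin n ⊕ Fin l → ℝ))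
          (b' : Fin n ⊕ Fin l → ℝ),
          IsSmoothGraph univ v Ω → IsSmoothGraph univ v' Ω' → φ z = (b, v b) →
          GraphInImageAt
            {q | q ∈ φ.target ∧ φ.symm q ∈ A.domAt g ∧ A.act (φ.symm q) g ∈ φ.source}
            (fun q => φ (A.act (φ.symm q) g)) v Ω b v' Ω' b' →
          inv2 κ β v b = inv2 κ β v' b') := by
  have hpe : A.PreservesEquation e := hsym.elim (fun h => h.2.preservesEquation h.1) id
  refine ⟨fun j hj => ?_, fun κ φ X W hφ hX htar h =>
    LocalAction.hasInvariantForm_of_fst hφ he hpe hX htar h,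
    fun κ φ hφ z hz => LocalAction.eventually_inv2_eq hφ hz⟩
  obtain ⟨κ, φ, hφ, hz, ht⟩ :=
    LocalAction.exists_isAdaptedChart_isTransverse (l := l) (by simp) hfree hj
  exact ⟨κ, φ, hφ, hz, LocalAction.exists_hasInvariantForm_nhds hφ he hpe hz ht⟩
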